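/- **Setting.** Let $\mathcal A$ be an alphabet with $d$ elements, $\pi=(\pi_0,\pi_1)$ an irreducible pair of bijections $\mathcal A\to\{1,\dots,d\}$, $\lambda\in\mathbb R_{>0}^{\mathcal A}$, and $T:I\to I$, $I=[0,|\lambda|)$, the interval exchange transformation with this data; it exchanges $I_\alpha=[l_\alpha,r_\alpha)$, and $Tx=x+(\Omega_\pi\lambda)_\alpha$ on $I_\alpha$, where $\Omega_{\alpha\beta}=1$ if $\pi_1(\alpha)>\pi_1(\beta)$ and $\pi_0(\alpha)<\pi_0(\beta)$, $\Omega_{\alpha\beta}=-1$ if $\pi_1(\alpha)<\pi_1(\beta)$ and $\pi_0(\alpha)>\pi_0(\beta)$, and $\Omega_{\alpha\beta}=0$ otherwise. Put $\Gamma=\mathbb R^{\mathcal A}$ (functions constant on each $I_\alpha$), $H(\pi)=\Omega_\pi\Gamma$ and $\dim H(\pi)=2g$. Suppose that $T$ satisfies Keane's condition ($T^i l_\alpha\ne l_\beta$ for $i\ge1$ and $\pi_0(\beta)\ne1$). Let $\mathcal R$ be Rauzy–Veech induction and $A^{(n)}(T)=A(T)A(\mathcal RT)\cdots A(\mathcal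 R^{n-1}T)$ the Kontsevich–Zorich cocycle: $A=\mathrm{Id}+E_{vw}$, where $v$ is the letter with the longer and $w$ the letter with the shorter interval among $\pi_0^{-1}(d),\pi_1^{-1}(d)$. For an accelerating sequence $0=n_0<n_1<\dots$ put $T^{(k)}=\mathcal R^{n_k}T:I^{(k)}\to I^{(k)}$ with exchanged intervals $I^{(k)}_\alpha$, $Q(k,l)=A^{(n_l-n_k)}(\mathcal R^{n_k}T)^t$, $Q(k)=Q(0,k)$, $Z(k+1)=Q(k,k+1)$, $Q_\alpha(k)=\sum_\beta Q_{\alpha\beta}(k)$. Vectors carry the norm $\sum_\alpha|v_\alpha|$, matrices the norm $\max_\alpha\sum_\beta|B_{\alpha\beta}|$, and restrictions to subspaces the operator norm. For a subspace $V\subset\Gamma$ let $V^{(k)}=Q(k)V$, and let $Q|_V(k,l):V^{(k)}\to V^{(l)}$ be the restriction of $Q(k,l)$. Instead of $Q|_{E_j}(0,k)$ we also write $Q_{E_j}(k)$. **Oseledets genericity.** $T$ is Oseledets generic, with exponents $\lambda_1>\dots>\lambda_g>\lambda_{g+1}=0$, if there are subspaces $0=E_0\subset E_{-1}\subset\dots\subset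 E_{-g}\subset E_{g+1}\subset E_g\subset\dots\subset E_1=\Gamma$ with $\dim E_{-i}-\dim E_{-i+1}=\dim E_i-\dim E_{i+1}=1$ $(1\le i\le g)$ such that, along some fixed accelerating sequence, $\frac1n\log\|Q(n)h\|$ tends to $-\lambda_i$ for $h\in E_{-i}\setminus E_{-i+1}$, to $0$ for $h\in E_{g+1}\setminus E_{-g}$, and to $\lambda_i$ for $h\in E_i\setminus E_{i+1}$ $(1\le i\le g)$. A complementary filtration is a sequence $0=U_1\subset\dots\subset U_{g+1}\subset H(\pi)$ with $E_j\oplus U_j=\Gamma$ for $1\le j\le g+1$. **FDC.** $T$ (irreducible, Keane, Oseledets generic) satisfies FDC if for every $\tau>0$ there are an accelerating sequence $(n_k)$ and a complementary filtration $(U_j)$ for which there exist $c>0$, $C,\kappa\ge1$ and natural numbers $(r_n)_{n\ge0}$, $r_0=0$, such that, with $r(k,l)=\sum_{k\le i<l}r_i$: * (Rokhlin towers) there is $0<\delta<1$ such that for every $k\ge1$ there is $0<p_k\le\min_\alpha Q_\alpha(k)$ for which $T^iI^{(k)}$, $0\le i<p_k$, are pairwise disjoint intervals with union of measure $\ge\delta|I|$;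 * $\lim_n r(0,n)/n$ exists and lies in $(1,1+\tau)$; * $\|Q|_{E_j}(k,l)\|\le Ce^{(\lambda_j+\tau)r(k,l)}$ for $0\le k<l$, $1\le j\le g+1$; * $\|Q|_{U_j}(k,l)^{-1}\|\le Ce^{(-\lambda_{j-1}+\tau)r(k,l)}$ for $0\le k<l$, $2\le j\le g+1$; * $\|Z(k+1)\|\le Ce^{\tau k}$ and $ce^{\lambda_1k}\le\|Q(k)\|\le Ce^{\lambda_1(1+\tau)k}$ for $k\ge0$; * $|I^{(k)}|\le\kappa|I^{(k)}_\alpha|$ for $k\ge 0$, $\alpha\in\mathcal A$; * $|\sin\angle(E_j^{(k)},U_j^{(k)})|\ge c\|Q(k)\|^{-\tau}$ for $k\ge0$, $2\le j\le g+1$. Such a pair $((n_k),(U_j))$ is called an FDC-acceleration for $\tau$. **Function spaces.** Let $0\le a<1$ and let $m_\alpha$ be the middle point of $I_\alpha$. For $\varphi\in C^1(\bigcup_\alpha(l_\alpha,r_\alpha))$ put $$p_a(\varphi)=\max_\alpha\max\Big\{\sup_{(l_\alpha,m_\alpha]}|\varphi'(x)(x-l_\alpha)^{1+a}|,\ \sup_{[m_\alpha,r_\alpha)}|\varphi'(x)(r_\alpha-x)^{1+a}|\Big\}.$$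 $P_a$ is the space of those $\varphi$ with $p_a(\varphi)<\infty$ for which the limits $C^+_\alpha=-\lim_{x\searrow l_\alpha}\varphi'(x)(x-l_\alpha)^{1+a}$ and $C^-_\alpha=\lim_{x\nearrow r_\alpha}\varphi'(x)(r_\alpha-x)^{1+a}$ exist for all $\alpha$, with the norm $\|\varphi\|_a=\|\varphi\|_{L^1(I)}+p_a(\varphi)$. $P_aG\subset P_a$ is the set (spanning $P_a$) of those $\varphi$ with $C^-_{\pi_0^{-1}(d)}C^-_{\pi_1^{-1}(d)}=0=C^+_{\pi_0^{-1}(1)}C^+_{\pi_1^{-1}(1)}$. Let $S(k)\varphi(x)=\sum_{0\le i<Q_\beta(k)}\varphi(T^ix)$ for $x\in I^{(k)}_\beta$, and let $\mathcal M^{(k)}f\in\mathbb R^{\mathcal A}$ be the vector of the mean values of $f$ on the intervals $I^{(k)}_\alpha$. **Diophantine series.** Let $\langle s\rangle^a=s^a$ if $a>0$ and $\langle s\rangle^0=1+\log s$. For an accelerating sequence and a complementary filtration $(U_j)$ put $$K^{a,j,\tau}_k=\sum_{i\ge k}\|Q|_{U_j}(k,i+1)^{-1}\|\,\|Z(i+1)\|\,\langle\|Q(i)\|\rangle^a\,\|Q(i+1)\|^\tau\in[0,\infty],$$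 $$C^{a,j,\tau}_k=\sum_{1\le l\le k}\|Q|_{E_j}(l,k)\|\,\|Z(l)\|\,\langle\|Q(l-1)\|\rangle^a\,\|Q(l)\|^\tau .$$ **Theorem.** Let $T$ satisfy FDC, let $0\le a<1$, and let $2\le j\le g+1$ be such that $\lambda_j\le\lambda_1a<\lambda_{j-1}$. For every complementary filtration $(U_i)$ there is a bounded linear operator $\mathfrak h_j:P_a\to U_j$ (defined, in particular, on $P_aG$) with the following properties. 1. For every $\tau>0$ and every FDC-acceleration for $\tau$ there is a constant $C\ge1$ such that for every $\varphi\in P_aG$ with $\mathfrak h_j(\varphi)=0$ and every $k\ge0$ $$\|\mathcal M^{(k)}(S(k)\varphi)\|\le C\Big(\big(K^{a,j,\tau}_k+C^{a,j,\tau}_k\big)p_a(\varphi)+\|Q_{E_j}(k)\|\frac{\|\varphi\|_{L^1(I)}}{|I|}\Big),$$ where all quantities, and the filtration used in $K^{a,j,\tau}_k$, are those of the FDC-acceleration, and $\infty\cdot0=0$. 2. For every $\tau>0$ there is an FDC-acceleration for $\tau$ along which $\|\mathcal M^{(k)}(S(k)\varphi)\|=O(e^{(\lambda_1a+\tau)k})$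 for every $\varphi\in P_aG$ with $\mathfrak h_j(\varphi)=0$. -/

import Mathlib

open Filter Topology MeasureTheory
open scoped ENNReal

set_option linter.unusedSectionVars false

noncomputable section

/-! ## Linear-algebra conventions on `Γ = ℝ^𝒜` -/

namespace KZ

variable {𝒜 : Type*} [Fintype 𝒜]

/-- The norm of a vector: the sum of the absolute values of its coefficients. -/
def vnorm (v : 𝒜 → ℝ) : ℝ := ∑ α, |v α|

/-- The norm of a matrix: `max_α ∑_β |B_{αβ}|`. -/
def mnorm (B : Matrix 𝒜 𝒜 ℝ) : ℝ := ⨆ α, ∑ β, |B α β|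

/-- The operator norm (for `vnorm`) of the restriction of `v ↦ B v` to the subspace `V`. -/
def opNormOn (B : Matrix 𝒜 𝒜 ℝ) (V : Submodule ℝ (𝒜 → ℝ)) : ℝ :=
  sSup {s : ℝ | ∃ v ∈ V, vnorm v ≤ 1 ∧ s = vnorm (B.mulVec v)}

/-- `|sin ∠(V, W)|`: the smallest `|sin ∠(v, w)|` over nonzero `v ∈ V`, `w ∈ W`, the angle being
taken for the Euclidean inner product. -/
def sinAngle (V W : Submodule ℝ (𝒜 → ℝ)) : ℝ :=
  sInf {s : ℝ | ∃ v ∈ V, ∃ w ∈ W, v ≠ 0 ∧ w ≠ 0 ∧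
    s = |Real.sin (InnerProductGeometry.angle (WithLp.toLp 2 v) (WithLp.toLp 2 w))|}

/-- `⟨s⟩^a = s^a` if `a > 0` and `⟨s⟩^0 = 1 + log s` (used for `a ≥ 0`, `s ≥ 1`). -/
def bracketPow (s a : ℝ) : ℝ := if 0 < a then s ^ a else 1 + Real.log s

/-- `r(k, l) = ∑_{k ≤ i < l} r_i`. -/
def rsum (r : ℕ → ℕ) (k l : ℕ) : ℕ := ∑ i ∈ Finset.Ico k l, r i

/-- An accelerating sequence: an increasing sequence of integers starting from `0`. -/
def IsAccelerating (n : ℕ → ℕ) : Prop := StrictMono n ∧ n 0 = 0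

end KZ

/-! ## Interval exchange transformations -/

/-- The data `(π, λ)` of an interval exchange of `d = m + 1` intervals labelled by `𝒜`:
`top = π₀`, `bot = π₁` (with values in `{0, …, m}` instead of `{1, …, d}`), `len = λ`.
Positivity of the lengths and irreducibility of `π` are required by `IET.IsIET`. -/
structure IET (𝒜 : Type*) (m : ℕ) where
  top : 𝒜 ≃ Fin (m + 1)
  bot : 𝒜 ≃ Fin (m + 1)
  len : 𝒜 → ℝ

namespace IET

open KZ

variable {𝒜 : Type*} [Fintype 𝒜] [DecidableEq 𝒜] {m : ℕ}

/-- `λ_α > 0` for all `α`, and `π` is irreducible: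
`π₁ ∘ π₀⁻¹ {1, …, k} ≠ {1, …, k}` for `1 ≤ k < d`. -/
def IsIET (T : IET 𝒜 m) : Prop :=
  (∀ α, 0 < T.len α) ∧
  ∀ k : ℕ, 1 ≤ k → k < m + 1 →
    (fun i => T.bot (T.top.symm i)) '' {i : Fin (m + 1) | i.val < k}
      ≠ {i : Fin (m + 1) | i.val < k}

/-- `|I| = |λ|`. -/
def total (T : IET 𝒜 m) : ℝ := ∑ α, T.len α

/-- The interval `I = [0, |λ|)`. -/
def base (T : IET 𝒜 m) : Set ℝ := Set.Ico 0 T.total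

/-- The left end point `l_α` of `I_α`. -/
def left (T : IET 𝒜 m) (α : 𝒜) : ℝ :=
  ∑ β ∈ Finset.univ.filter (fun β => T.top β < T.top α), T.len β

/-- The right end point `r_α` of `I_α`. -/
def right (T : IET 𝒜 m) (α : 𝒜) : ℝ :=
  ∑ β ∈ Finset.univ.filter (fun β => T.top β ≤ T.top α), T.len β

/-- The middle point of `I_α`. -/
def mid (T : IET 𝒜 m) (α : 𝒜) : ℝ := (T.left α + T.right α) / 2

/-- The exchanged interval `I_α = [l_α, r_α)`. -/
def piece (T : IET 𝒜 m) (α : 𝒜) : Set ℝ := Set.Ico (T.left α) (T.right α)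

/-- The union of the open intervals `(l_α, r_α)`. -/
def dom (T : IET 𝒜 m) : Set ℝ := ⋃ α, Set.Ioo (T.left α) (T.right α)

/-- The translation matrix `Ω_π`. -/
def Omega (T : IET 𝒜 m) : Matrix 𝒜 𝒜 ℝ := fun α β =>
  if T.bot β < T.bot α ∧ T.top α < T.top β then 1
  else if T.bot α < T.bot β ∧ T.top β < T.top α then -1
  else 0

/-- `H(π) = Ω_π (ℝ^𝒜)`. -/
def H (T : IET 𝒜 m) : Submodule ℝ (𝒜 → ℝ) := LinearMap.range T.Omega.mulVecLin

/-- The interval exchange transformation: `T x = x + w_α` for `x ∈ I_α`, where `w = Ω_π λ`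
(and `T x = x` outside of `I`). -/
def map (T : IET 𝒜 m) (x : ℝ) : ℝ :=
  x + ∑ α, (T.piece α).indicator (fun _ => T.Omega.mulVec T.len α) x

/-- The Keane condition: `T^k l_α ≠ l_β` for all `k ≥ 1` and all `α, β` with `π₀(β) ≠ 1`. -/
def Keane (T : IET 𝒜 m) : Prop :=
  ∀ k : ℕ, 1 ≤ k → ∀ α β : 𝒜, T.top β ≠ 0 → T.map^[k] (T.left α) ≠ T.left β

/-! ### Rauzy–Veech induction -/

/-- The type of the induction step: `topWins` means `ε = 0`, i.e. `λ_{π₀⁻¹(d)} > λ_{π₁⁻¹(d)}`.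
Under the Keane condition equality does not occur when `d ≥ 2`. -/
def topWins (T : IET 𝒜 m) : Prop :=
  T.len (T.bot.symm (Fin.last m)) < T.len (T.top.symm (Fin.last m))

open Classical in
/-- The winner `π_ε⁻¹(d)`. -/
def winner (T : IET 𝒜 m) : 𝒜 :=
  if T.topWins then T.top.symm (Fin.last m) else T.bot.symm (Fin.last m)

open Classical in
/-- The loser `π_{1-ε}⁻¹(d)`. -/
def loser (T : IET 𝒜 m) : 𝒜 :=
  if T.topWins then T.bot.symm (Fin.last m) else T.top.symm (Fin.last m)

/-- The permutation of positions that fixes all positions `≤ p`, moves the last position to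
`p + 1`, and increases the remaining ones by one (see `shiftAfter_apply`). -/
def shiftAfter (p : Fin (m + 1)) : Equiv.Perm (Fin (m + 1)) := Fin.cycleIcc (p + 1) (Fin.last m)

theorem shiftAfter_apply (p i : Fin (m + 1)) (hp : p < Fin.last m) :
    ((shiftAfter p i : Fin (m + 1)) : ℕ) =
      if i ≤ p then (i : ℕ) else if i < Fin.last m then (i : ℕ) + 1 else (p : ℕ) + 1 := by
  have hp1 : ((p + 1 : Fin (m + 1)) : ℕ) = p + 1 := Fin.val_add_one_of_lt hp
  unfold shiftAfter
  split_ifs with h1 h2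
  · rw [Fin.cycleIcc_of_lt]
    rw [Fin.lt_def, hp1]
    have := Fin.le_def.1 h1
    omega
  · rw [Fin.cycleIcc_of_ge_of_lt _ h2]
    · exact Fin.val_add_one_of_lt h2
    · rw [Fin.le_def, hp1]
      have := Fin.lt_def.1 (not_le.1 h1)
      omega
  · have hi : i = Fin.last m := le_antisymm (Fin.le_last i) (not_lt.1 h2)
    rw [hi, Fin.cycleIcc_of_last (Fin.le_last _), hp1]

open Classical in
/-- One step `R(T) = (π̃, λ̃)` of the Rauzy–Veech induction: `π̃_ε = π_ε`, `π̃_{1-ε}` is obtained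
from `π_{1-ε}` by moving the loser right behind the winner, and `λ̃ = A⁻¹ λ`, i.e. the length of
the loser is subtracted from the length of the winner. -/
def rauzy (T : IET 𝒜 m) : IET 𝒜 m where
  top := if T.topWins then T.top else T.top.trans (shiftAfter (T.top T.winner))
  bot := if T.topWins then T.bot.trans (shiftAfter (T.bot T.winner)) else T.bot
  len := Function.update T.len T.winner (T.len T.winner - T.len T.loser)

/-- The matrix `A(T) = Id + E_{winner, loser}`; its entries are non-negative integers. -/
def kzMatrix (T : IET 𝒜 m) : Matrix 𝒜 𝒜 ℕ := 1 + Matrix.single T.winner T.loser 1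

/-- The Kontsevich–Zorich cocycle `A^{(n)}(T) = A(T) A(R T) ⋯ A(R^{n-1} T)`. -/
def kzCocycle (T : IET 𝒜 m) : ℕ → Matrix 𝒜 𝒜 ℕ
  | 0 => 1
  | n + 1 => T.kzCocycle n * (rauzy^[n] T).kzMatrix

/-- `T^{(k)} = R^{n_k}(T)` for a sequence `n`. -/
def acc (T : IET 𝒜 m) (n : ℕ → ℕ) (k : ℕ) : IET 𝒜 m := rauzy^[n k] T

/-- `Q(k, l) = A^{(n_l - n_k)}(R^{n_k} T)^t` as a matrix of non-negative integers (`k ≤ l`). -/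
def QN (T : IET 𝒜 m) (n : ℕ → ℕ) (k l : ℕ) : Matrix 𝒜 𝒜 ℕ :=
  ((T.acc n k).kzCocycle (n l - n k)).transpose

/-- `Q(k, l)` as a real matrix (`k ≤ l`). In particular `Q(k) = Q(0, k)` and
`Z(k + 1) = Q(k, k + 1)`. -/
def Q (T : IET 𝒜 m) (n : ℕ → ℕ) (k l : ℕ) : Matrix 𝒜 𝒜 ℝ := (T.QN n k l).map (Nat.cast : ℕ → ℝ)

/-- The return time `Q_α(k) = ∑_β Q_{αβ}(k)` of `I_α^{(k)}` to `I^{(k)}`. -/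
def returnTime (T : IET 𝒜 m) (n : ℕ → ℕ) (k : ℕ) (α : 𝒜) : ℕ := ∑ β, T.QN n 0 k α β

/-- `V^{(k)} = Q(k) V`. -/
def push (T : IET 𝒜 m) (n : ℕ → ℕ) (k : ℕ) (V : Submodule ℝ (𝒜 → ℝ)) :
    Submodule ℝ (𝒜 → ℝ) := V.map (T.Q n 0 k).mulVecLin

/-- `‖Q|_V(k, l)‖`, the norm of the restriction `Q(k, l) : V^{(k)} → V^{(l)}`. -/
def normQ (T : IET 𝒜 m) (n : ℕ → ℕ) (V : Submodule ℝ (𝒜 → ℝ)) (k l : ℕ) : ℝ :=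
  opNormOn (T.Q n k l) (T.push n k V)

/-- `‖Q|_V(k, l)⁻¹‖`, the norm of the inverse `V^{(l)} → V^{(k)}` of `Q(k, l) : V^{(k)} → V^{(l)}`
(`Q(k, l)` has determinant one). -/
def normQInv (T : IET 𝒜 m) (n : ℕ → ℕ) (V : Submodule ℝ (𝒜 → ℝ)) (k l : ℕ) : ℝ :=
  opNormOn (T.Q n k l)⁻¹ (T.push n l V)

/-! ### The Filtration Diophantine Condition -/

/-- `T` is Oseledets generic with exponents `lam 1 > ⋯ > lam g > lam (g + 1) = 0` and Oseledets
filtration `0 = E 0 ⊂ E (-1) ⊂ ⋯ ⊂ E (-g) ⊂ E (g + 1) ⊂ E g ⊂ ⋯ ⊂ E 1 = Γ`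
(here `E (g + 1) = E_cs`, and `g` is the genus), the growth rates being measured along
some fixed acceleration `N` of the Kontsevich–Zorich cocycle. -/
structure IsOseledetsGeneric (T : IET 𝒜 m) (g : ℕ) (lam : ℕ → ℝ)
    (E : ℤ → Submodule ℝ (𝒜 → ℝ)) : Prop where
  genus : Module.finrank ℝ T.H = 2 * g
  lam_anti : ∀ i : ℕ, 1 ≤ i → i ≤ g → lam (i + 1) < lam i
  lam_last : lam (g + 1) = 0
  E_zero : E 0 = ⊥
  E_one : E 1 = ⊤
  E_neg_le : ∀ i : ℕ, 1 ≤ i → i ≤ g → E (-(i : ℤ) + 1) ≤ E (-(i : ℤ))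
  E_neg_le_cs : E (-(g : ℤ)) ≤ E ((g : ℤ) + 1)
  E_pos_le : ∀ i : ℕ, 1 ≤ i → i ≤ g → E ((i : ℤ) + 1) ≤ E (i : ℤ)
  finrank_neg : ∀ i : ℕ, 1 ≤ i → i ≤ g →
    Module.finrank ℝ (E (-(i : ℤ))) = Module.finrank ℝ (E (-(i : ℤ) + 1)) + 1
  finrank_pos : ∀ i : ℕ, 1 ≤ i → i ≤ g →
    Module.finrank ℝ (E (i : ℤ)) = Module.finrank ℝ (E ((i : ℤ) + 1)) + 1
  growth : ∃ N : ℕ → ℕ, IsAccelerating N ∧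
    (∀ i : ℕ, 1 ≤ i → i ≤ g → ∀ h ∈ E (-(i : ℤ)), h ∉ E (-(i : ℤ) + 1) →
      Tendsto (fun n : ℕ => Real.log (vnorm ((T.Q N 0 n).mulVec h)) / n) atTop (𝓝 (-lam i))) ∧
    (∀ h ∈ E ((g : ℤ) + 1), h ∉ E (-(g : ℤ)) →
      Tendsto (fun n : ℕ => Real.log (vnorm ((T.Q N 0 n).mulVec h)) / n) atTop (𝓝 0)) ∧
    (∀ i : ℕ, 1 ≤ i → i ≤ g → ∀ h ∈ E (i : ℤ), h ∉ E ((i : ℤ) + 1) →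
      Tendsto (fun n : ℕ => Real.log (vnorm ((T.Q N 0 n).mulVec h)) / n) atTop (𝓝 (lam i)))

/-- A filtration `0 = U 1 ⊂ U 2 ⊂ ⋯ ⊂ U (g + 1) ⊂ H(π)` complementary to the Oseledets
filtration: `E_j ⊕ U_j = Γ` for `1 ≤ j ≤ g + 1`. -/
structure IsComplementary (T : IET 𝒜 m) (g : ℕ) (E : ℤ → Submodule ℝ (𝒜 → ℝ))
    (U : ℕ → Submodule ℝ (𝒜 → ℝ)) : Prop where
  U_one : U 1 = ⊥
  U_le : ∀ j : ℕ, 1 ≤ j → j ≤ g → U j ≤ U (j + 1)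
  U_le_H : U (g + 1) ≤ T.H
  compl : ∀ j : ℕ, 1 ≤ j → j ≤ g + 1 → IsCompl (E (j : ℤ)) (U j)

/-- The Rokhlin Tower Condition: for some `0 < δ < 1` and every `k ≥ 1` there is
`0 < p ≤ min_α Q_α(k)` such that `{T^i I^{(k)} : 0 ≤ i < p}` is a Rokhlin tower of intervals of
measure at least `δ |I|`. -/
def RokhlinTower (T : IET 𝒜 m) (n : ℕ → ℕ) : Prop :=
  ∃ δ : ℝ, 0 < δ ∧ δ < 1 ∧ ∀ k : ℕ, 1 ≤ k → ∃ p : ℕ, 0 < p ∧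
    (∀ α, p ≤ T.returnTime n k α) ∧
    (∀ i < p, (T.map^[i] '' (T.acc n k).base).OrdConnected) ∧
    (∀ i < p, ∀ i' < p, i ≠ i' →
      Disjoint (T.map^[i] '' (T.acc n k).base) (T.map^[i'] '' (T.acc n k).base)) ∧
    ENNReal.ofReal (δ * T.total) ≤ volume (⋃ i ∈ Finset.range p, T.map^[i] '' (T.acc n k).base)

/-- `n` is an FDC-acceleration of `T` for the parameter `τ`, with complementary filtration `U`. -/
structure IsFDCAcceleration (T : IET 𝒜 m) (g : ℕ) (lam : ℕ → ℝ)
    (E : ℤ → Submodule ℝ (𝒜 → ℝ)) (τ : ℝ) (n : ℕ → ℕ)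
    (U : ℕ → Submodule ℝ (𝒜 → ℝ)) : Prop where
  accelerating : IsAccelerating n
  complementary : T.IsComplementary g E U
  tower : T.RokhlinTower n
  bounds : ∃ c C κ : ℝ, 0 < c ∧ 1 ≤ C ∧ 1 ≤ κ ∧ ∃ r : ℕ → ℕ, r 0 = 0 ∧
    (∃ ρ : ℝ, 1 < ρ ∧ ρ < 1 + τ ∧
      Tendsto (fun k : ℕ => (rsum r 0 k : ℝ) / k) atTop (𝓝 ρ)) ∧
    (∀ k l j : ℕ, k < l → 1 ≤ j → j ≤ g + 1 →
      T.normQ n (E (j : ℤ)) k l ≤ C * Real.exp ((lam j + τ) * rsum r k l)) ∧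
    (∀ k l j : ℕ, k < l → 2 ≤ j → j ≤ g + 1 →
      T.normQInv n (U j) k l ≤ C * Real.exp ((-lam (j - 1) + τ) * rsum r k l)) ∧
    (∀ k : ℕ, mnorm (T.Q n k (k + 1)) ≤ C * Real.exp (τ * k)) ∧
    (∀ k : ℕ, c * Real.exp (lam 1 * k) ≤ mnorm (T.Q n 0 k) ∧
      mnorm (T.Q n 0 k) ≤ C * Real.exp (lam 1 * (1 + τ) * k)) ∧
    (∀ (k : ℕ) (α : 𝒜), (T.acc n k).total / (T.acc n k).len α ≤ κ) ∧
    (∀ k j : ℕ, 2 ≤ j → j ≤ g + 1 →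
      c * mnorm (T.Q n 0 k) ^ (-τ) ≤ sinAngle (T.push n k (E (j : ℤ))) (T.push n k (U j)))

/-- The Filtration Diophantine Condition, for an interval exchange `T` with exponents `lam` and
Oseledets filtration `E`. -/
structure FDC (T : IET 𝒜 m) (g : ℕ) (lam : ℕ → ℝ) (E : ℤ → Submodule ℝ (𝒜 → ℝ)) : Prop where
  isIET : T.IsIET
  keane : T.Keane
  generic : T.IsOseledetsGeneric g lam E
  acceleration : ∀ τ : ℝ, 0 < τ → ∃ (n : ℕ → ℕ) (U : ℕ → Submodule ℝ (𝒜 → ℝ)),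
    T.IsFDCAcceleration g lam E τ n U

/-! ### Diophantine series -/

/-- `K_l^{a,τ} = ∑_{m' ≥ l} ‖Q|_V(l, m'+1)⁻¹‖ ‖Z(m'+1)‖ ⟨‖Q(m')‖⟩^a ‖Q(m'+1)‖^τ`, a series of
non-negative terms with sum in `[0, ∞]`; it is used with `V = U_j`. -/
def seriesK (T : IET 𝒜 m) (n : ℕ → ℕ) (V : Submodule ℝ (𝒜 → ℝ)) (a τ : ℝ) (l : ℕ) : ℝ≥0∞ :=
  ∑' i : ℕ, ENNReal.ofReal
    (T.normQInv n V l (l + i + 1) * mnorm (T.Q n (l + i) (l + i + 1)) *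
      bracketPow (mnorm (T.Q n 0 (l + i))) a * mnorm (T.Q n 0 (l + i + 1)) ^ τ)

/-- `C_k^{a,τ} = ∑_{1 ≤ l ≤ k} ‖Q|_V(l, k)‖ ‖Z(l)‖ ⟨‖Q(l-1)‖⟩^a ‖Q(l)‖^τ`, used with
`V = E_j`. -/
def seriesC (T : IET 𝒜 m) (n : ℕ → ℕ) (V : Submodule ℝ (𝒜 → ℝ)) (a τ : ℝ) (k : ℕ) : ℝ :=
  ∑ l ∈ Finset.Icc 1 k,
    T.normQ n V l k * mnorm (T.Q n (l - 1) l) *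
      bracketPow (mnorm (T.Q n 0 (l - 1))) a * mnorm (T.Q n 0 l) ^ τ

/-! ### Functions with polynomial singularities -/

/-- `p_a(φ)`, with value in `[0, ∞]`. -/
def pa (T : IET 𝒜 m) (a : ℝ) (φ : ℝ → ℝ) : ℝ≥0∞ :=
  ⨆ α : 𝒜,
    (⨆ x ∈ Set.Ioc (T.left α) (T.mid α), ENNReal.ofReal |deriv φ x * (x - T.left α) ^ (1 + a)|) ⊔
    (⨆ x ∈ Set.Ico (T.mid α) (T.right α), ENNReal.ofReal |deriv φ x * (T.right α - x) ^ (1 + a)|)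

/-- `C_α^+(φ) = c`. -/
def HasCPlus (T : IET 𝒜 m) (a : ℝ) (φ : ℝ → ℝ) (α : 𝒜) (c : ℝ) : Prop :=
  Tendsto (fun x => -(deriv φ x * (x - T.left α) ^ (1 + a))) (𝓝[>] T.left α) (𝓝 c)

/-- `C_α^-(φ) = c`. -/
def HasCMinus (T : IET 𝒜 m) (a : ℝ) (φ : ℝ → ℝ) (α : 𝒜) (c : ℝ) : Prop :=
  Tendsto (fun x => deriv φ x * (T.right α - x) ^ (1 + a)) (𝓝[<] T.right α) (𝓝 c)

theorem isOpen_dom (T : IET 𝒜 m) : IsOpen T.dom := isOpen_iUnion fun _ => isOpen_Ioo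

theorem differentiableAt_of_dom {T : IET 𝒜 m} {φ : ℝ → ℝ} (h : ContDiffOn ℝ 1 φ T.dom)
    {x : ℝ} (hx : x ∈ T.dom) : DifferentiableAt ℝ φ x :=
  (h.contDiffAt (T.isOpen_dom.mem_nhds hx)).differentiableAt (by norm_num)

theorem mem_dom (T : IET 𝒜 m) {α : 𝒜} {x : ℝ} (h1 : T.left α < x) (h2 : x < T.right α) :
    x ∈ T.dom := Set.mem_iUnion.2 ⟨α, h1, h2⟩

theorem mem_dom_of_mem_Ioc (T : IET 𝒜 m) {α : 𝒜} {x : ℝ}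
    (h : x ∈ Set.Ioc (T.left α) (T.mid α)) : x ∈ T.dom :=
  T.mem_dom h.1 (by have h1 := h.1; have h2 := h.2; unfold mid at h2; linarith)

theorem mem_dom_of_mem_Ico (T : IET 𝒜 m) {α : 𝒜} {x : ℝ}
    (h : x ∈ Set.Ico (T.mid α) (T.right α)) : x ∈ T.dom :=
  T.mem_dom (by have h1 := h.1; have h2 := h.2; unfold mid at h1; linarith) h.2

theorem pa_add_le (T : IET 𝒜 m) (a : ℝ) {φ ψ : ℝ → ℝ} (hφ : ContDiffOn ℝ 1 φ T.dom)
    (hψ : ContDiffOn ℝ 1 ψ T.dom) : T.pa a (φ + ψ) ≤ T.pa a φ + T.pa a ψ := by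
  refine iSup_le fun α => sup_le (iSup₂_le fun x hx => ?_) (iSup₂_le fun x hx => ?_)
  · have hd := T.mem_dom_of_mem_Ioc hx
    rw [deriv_add (differentiableAt_of_dom hφ hd) (differentiableAt_of_dom hψ hd), add_mul]
    refine (ENNReal.ofReal_le_ofReal (abs_add_le _ _)).trans ?_
    rw [ENNReal.ofReal_add (abs_nonneg _) (abs_nonneg _)]
    gcongr
    · exact le_iSup_of_le α (le_sup_of_le_left (le_iSup₂_of_le x hx le_rfl))
    · exact le_iSup_of_le α (le_sup_of_le_left (le_iSup₂_of_le x hx le_rfl))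
  · have hd := T.mem_dom_of_mem_Ico hx
    rw [deriv_add (differentiableAt_of_dom hφ hd) (differentiableAt_of_dom hψ hd), add_mul]
    refine (ENNReal.ofReal_le_ofReal (abs_add_le _ _)).trans ?_
    rw [ENNReal.ofReal_add (abs_nonneg _) (abs_nonneg _)]
    gcongr
    · exact le_iSup_of_le α (le_sup_of_le_right (le_iSup₂_of_le x hx le_rfl))
    · exact le_iSup_of_le α (le_sup_of_le_right (le_iSup₂_of_le x hx le_rfl))

theorem pa_smul_le (T : IET 𝒜 m) (a c : ℝ) {φ : ℝ → ℝ} :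
    T.pa a (c • φ) ≤ ENNReal.ofReal |c| * T.pa a φ := by
  refine iSup_le fun α => sup_le (iSup₂_le fun x hx => ?_) (iSup₂_le fun x hx => ?_)
  · rw [deriv_const_smul_field, smul_eq_mul, mul_assoc, abs_mul,
      ENNReal.ofReal_mul (abs_nonneg c)]
    gcongr
    exact le_iSup_of_le α (le_sup_of_le_left (le_iSup₂_of_le x hx le_rfl))
  · rw [deriv_const_smul_field, smul_eq_mul, mul_assoc, abs_mul,
      ENNReal.ofReal_mul (abs_nonneg c)]
    gcongr
    exact le_iSup_of_le α (le_sup_of_le_right (le_iSup₂_of_le x hx le_rfl))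

theorem pa_zero (T : IET 𝒜 m) (a : ℝ) : T.pa a 0 = 0 := by
  have h : deriv (0 : ℝ → ℝ) = 0 := by ext x; simp
  simp [pa, h]

theorem HasCPlus.add {T : IET 𝒜 m} {a c c' : ℝ} {φ ψ : ℝ → ℝ} {α : 𝒜}
    (hlr : T.left α < T.right α) (hφ : ContDiffOn ℝ 1 φ T.dom) (hψ : ContDiffOn ℝ 1 ψ T.dom)
    (h : T.HasCPlus a φ α c) (h' : T.HasCPlus a ψ α c') : T.HasCPlus a (φ + ψ) α (c + c') := by
  refine (Tendsto.add h h').congr' ?_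
  filter_upwards [Ioo_mem_nhdsGT hlr] with x hx
  have hd := T.mem_dom hx.1 hx.2
  rw [deriv_add (differentiableAt_of_dom hφ hd) (differentiableAt_of_dom hψ hd)]
  ring

theorem HasCMinus.add {T : IET 𝒜 m} {a c c' : ℝ} {φ ψ : ℝ → ℝ} {α : 𝒜}
    (hlr : T.left α < T.right α) (hφ : ContDiffOn ℝ 1 φ T.dom) (hψ : ContDiffOn ℝ 1 ψ T.dom)
    (h : T.HasCMinus a φ α c) (h' : T.HasCMinus a ψ α c') : T.HasCMinus a (φ + ψ) α (c + c') := by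
  refine (Tendsto.add h h').congr' ?_
  filter_upwards [Ioo_mem_nhdsLT hlr] with x hx
  have hd := T.mem_dom hx.1 hx.2
  rw [deriv_add (differentiableAt_of_dom hφ hd) (differentiableAt_of_dom hψ hd)]
  ring

theorem HasCPlus.smul {T : IET 𝒜 m} {a c : ℝ} {φ : ℝ → ℝ} {α : 𝒜} (s : ℝ)
    (h : T.HasCPlus a φ α c) : T.HasCPlus a (s • φ) α (s * c) := by
  refine (Tendsto.const_mul s h).congr fun x => ?_
  rw [deriv_const_smul_field, smul_eq_mul]
  ring

theorem HasCMinus.smul {T : IET 𝒜 m} {a c : ℝ} {φ : ℝ → ℝ} {α : 𝒜} (s : ℝ)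
    (h : T.HasCMinus a φ α c) : T.HasCMinus a (s • φ) α (s * c) := by
  refine (Tendsto.const_mul s h).congr fun x => ?_
  rw [deriv_const_smul_field, smul_eq_mul]
  ring

/-- The space `P_a` of functions with polynomial singularities of degree at most `a`.
A function on `⋃_α (l_α, r_α)` is represented by its extension by zero to `ℝ`. The limits are
required for the non-degenerate intervals, i.e. for all `α` when `T` satisfies `IsIET`. -/
def Pa (T : IET 𝒜 m) (a : ℝ) : Submodule ℝ (ℝ → ℝ) where
  carrier := {φ | (∀ x, x ∉ T.dom → φ x = 0) ∧ ContDiffOn ℝ 1 φ T.dom ∧ T.pa a φ ≠ ∞ ∧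
    ∀ α, T.left α < T.right α → (∃ c, T.HasCPlus a φ α c) ∧ (∃ c, T.HasCMinus a φ α c)}
  zero_mem' := by
    refine ⟨fun _ _ => rfl, contDiffOn_const, by simp [pa_zero], fun α _ => ⟨⟨0, ?_⟩, ⟨0, ?_⟩⟩⟩
    · have h : deriv (0 : ℝ → ℝ) = 0 := by ext x; simp
      simp [HasCPlus, h]
    · have h : deriv (0 : ℝ → ℝ) = 0 := by ext x; simp
      simp [HasCMinus, h]
  add_mem' := by
    rintro φ ψ ⟨h1, h2, h3, h4⟩ ⟨k1, k2, k3, k4⟩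
    refine ⟨fun x hx => by simp [h1 x hx, k1 x hx], h2.add k2,
      ne_top_of_le_ne_top (ENNReal.add_ne_top.2 ⟨h3, k3⟩) (T.pa_add_le a h2 k2), fun α hα => ?_⟩
    obtain ⟨⟨c, hc⟩, ⟨d, hd⟩⟩ := h4 α hα
    obtain ⟨⟨c', hc'⟩, ⟨d', hd'⟩⟩ := k4 α hα
    exact ⟨⟨_, hc.add hα h2 k2 hc'⟩, ⟨_, hd.add hα h2 k2 hd'⟩⟩
  smul_mem' := by
    rintro s φ ⟨h1, h2, h3, h4⟩
    refine ⟨fun x hx => by simp [h1 x hx], h2.const_smul s,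
      ne_top_of_le_ne_top (ENNReal.mul_ne_top ENNReal.ofReal_ne_top h3) (T.pa_smul_le a s),
      fun α hα => ?_⟩
    obtain ⟨⟨c, hc⟩, ⟨d, hd⟩⟩ := h4 α hα
    exact ⟨⟨_, hc.smul s⟩, ⟨_, hd.smul s⟩⟩

/-- The set `P_aG ⊂ P_a` of functions with polynomial singularities of geometric type. -/
def PaG (T : IET 𝒜 m) (a : ℝ) : Set (T.Pa a) :=
  {φ | (∃ c c' : ℝ, T.HasCMinus a φ (T.top.symm (Fin.last m)) c ∧
          T.HasCMinus a φ (T.bot.symm (Fin.last m)) c' ∧ c * c' = 0) ∧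
       (∃ c c' : ℝ, T.HasCPlus a φ (T.top.symm 0) c ∧
          T.HasCPlus a φ (T.bot.symm 0) c' ∧ c * c' = 0)}

/-- `‖φ‖_{L¹(I)}`. -/
def normL1 (T : IET 𝒜 m) (φ : ℝ → ℝ) : ℝ := ∫ x in T.base, |φ x|

/-- The norm `‖φ‖_a = ‖φ‖_{L¹(I)} + p_a(φ)` on `P_a`. -/
def normPa (T : IET 𝒜 m) (a : ℝ) (φ : ℝ → ℝ) : ℝ := T.normL1 φ + (T.pa a φ).toReal

/-! ### Special Birkhoff sums and mean values -/

/-- The special Birkhoff sum `S(k)φ : I^{(k)} → ℝ`,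
`S(k)φ(x) = ∑_{0 ≤ i < Q_β(k)} φ(T^i x)` for `x ∈ I_β^{(k)}` (and `0` outside of `I^{(k)}`). -/
def special (T : IET 𝒜 m) (n : ℕ → ℕ) (k : ℕ) (φ : ℝ → ℝ) (x : ℝ) : ℝ :=
  ∑ β, ((T.acc n k).piece β).indicator
    (fun y => ∑ i ∈ Finset.range (T.returnTime n k β), φ (T.map^[i] y)) x

/-- The mean value operator `M(f) = ∑_α m(f, I_α) χ_{I_α} ∈ Γ = ℝ^𝒜`. For `M^{(k)}` it is applied
to `T^{(k)}`. -/
def mean (T : IET 𝒜 m) (f : ℝ → ℝ) (α : 𝒜) : ℝ := ⨍ x in T.piece α, f x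

/-- `‖M^{(k)}(S(k)φ)‖`. -/
def specialMeanNorm (T : IET 𝒜 m) (n : ℕ → ℕ) (k : ℕ) (φ : ℝ → ℝ) : ℝ :=
  vnorm ((T.acc n k).mean (T.special n k φ))

end IET

end

/-!
A renormalization step of the induction acts on functions by special Birkhoff sums, and the floors
of the Rokhlin towers are disjoint translates of the base intervals. On the derivative of a function
`φ` with singularities of order `1 + a`, the floors visiting a fixed interval are separated by the
length of the base; so the derivative of a special sum again has singularities of order `1 + a`, now
only at the end points of the new intervals, with a constant `O(p_a(φ))` if `a > 0` and with an
additional logarithm if `a = 0` (`IsInduced.hasSingularDeriv`). Such a function deviates from its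
mean values by `O(p_a(φ))` times the length to the power `1 - a` in `L¹`
(`integrable_and_oscillation`). Let `f_N` be the vector of mean values of the special sums at
time `N` of the induction. At times `N ≤ N'` at which the interval lengths are balanced,

`f_{N'} = Q(N, N') f_N + O(‖Q(N, N')‖ ⟨‖Q(N)‖⟩^a p_a(φ))`,

see `IsKeane.exists_specialMean_error`. Hence the transported vectors `Q(N)⁻¹ f_N` change little
modulo `E_j`, where the cocycle expands at least like `exp (λ_{j-1} k)` while the error grows
only like `exp (λ_1 a k)`. Along an acceleration with a sufficiently small parameter the increments
are summable (`ExpBounds.summable_gapTerm`), so `Q(N)⁻¹ f_N` converges modulo `E_j`. The limit,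
projected along `E_j` to the prescribed complement `U_j`, is the correction operator
(`SplitsAlong.exists_correction`).

A class modulo `E_j` knows nothing of the complement, and the estimate of the increments covers all
balanced times between two consecutive times of the acceleration. Therefore a function with
vanishing correction has `Q(N)⁻¹ f_N → 0` modulo `E_j` along every other balanced
sequence of times and for every other complementary filtration. For such a function, the component of `f` at the `k`-th time
along the complement is minus the sum of all later increments, transported back, which gives the
series `K`; its component along `E_j` is the initial value plus the sum of all earlier increments,
transported forward, which gives the sum `C` and the last term of the bound
(`SplitsAlong.exists_bound`). The angle condition is what allows the increments to be split into
components. For an acceleration with a small parameter, `λ_j ≤ λ_1 a < λ_{j-1}` turns the two series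
into exponentials of rate close to `λ_1 a` (`ExpBounds.exists_seriesK_le`,
`ExpBounds.exists_seriesC_le`).

That a step of the induction is an induced map with the expected towers, and keeps Keane's
condition, is `IsKeane.isInduced_rauzy` and `IsKeane.isKeane_rauzy`; the composition of such
steps is `IsInduced.comp`.
-/

noncomputable section

/-! ### Norms of vectors, matrices and restrictions -/

namespace KZ

variable {𝒜 : Type*} [Fintype 𝒜]

theorem vnorm_nonneg (v : 𝒜 → ℝ) : 0 ≤ vnorm v := Finset.sum_nonneg fun _ _ => abs_nonneg _

@[simp] theorem vnorm_zero : vnorm (0 : 𝒜 → ℝ) = 0 := by simp [vnorm]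

theorem vnorm_add_le (v w : 𝒜 → ℝ) : vnorm (v + w) ≤ vnorm v + vnorm w := by
  rw [vnorm, vnorm, vnorm, ← Finset.sum_add_distrib]
  exact Finset.sum_le_sum fun α _ => abs_add_le _ _

theorem vnorm_neg (v : 𝒜 → ℝ) : vnorm (-v) = vnorm v := by simp [vnorm]

theorem vnorm_sub_le (v w : 𝒜 → ℝ) : vnorm (v - w) ≤ vnorm v + vnorm w := by
  rw [sub_eq_add_neg, ← vnorm_neg w]
  exact vnorm_add_le _ _

theorem vnorm_smul (c : ℝ) (v : 𝒜 → ℝ) : vnorm (c • v) = |c| * vnorm v := by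
  simp [vnorm, abs_mul, Finset.mul_sum]

theorem vnorm_eq_zero {v : 𝒜 → ℝ} (h : vnorm v = 0) : v = 0 := by
  ext α
  rw [vnorm, Finset.sum_eq_zero_iff_of_nonneg fun _ _ => abs_nonneg _] at h
  simpa using h α (Finset.mem_univ α)

theorem continuous_vnorm : Continuous (vnorm : (𝒜 → ℝ) → ℝ) := by
  unfold vnorm
  fun_prop

theorem row_sum_le_mnorm (B : Matrix 𝒜 𝒜 ℝ) (α : 𝒜) : ∑ β, |B α β| ≤ mnorm B :=
  le_ciSup (f := fun α => ∑ β, |B α β|) (Set.finite_range _).bddAbove α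

theorem mnorm_nonneg (B : Matrix 𝒜 𝒜 ℝ) : 0 ≤ mnorm B :=
  Real.iSup_nonneg fun _ => Finset.sum_nonneg fun _ _ => abs_nonneg _

theorem mnorm_mono [Nonempty 𝒜] {B B' : Matrix 𝒜 𝒜 ℝ} (h0 : ∀ α β, 0 ≤ B α β)
    (h : ∀ α β, B α β ≤ B' α β) : mnorm B ≤ mnorm B' := by
  refine ciSup_le fun α => le_trans (Finset.sum_le_sum fun β _ => ?_) (row_sum_le_mnorm B' α)
  exact abs_le_abs_of_nonneg (h0 α β) (h α β)

/-- The norm of matrices is not the operator norm of the norm of vectors, whence the factor `d`. -/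
theorem vnorm_mulVec_le (B : Matrix 𝒜 𝒜 ℝ) (v : 𝒜 → ℝ) :
    vnorm (B.mulVec v) ≤ Fintype.card 𝒜 * mnorm B * vnorm v := by
  have h : ∀ α, |B.mulVec v α| ≤ mnorm B * vnorm v := by
    intro α
    calc |B.mulVec v α| ≤ ∑ β, |B α β * v β| := Finset.abs_sum_le_sum_abs _ _
      _ ≤ ∑ β, mnorm B * |v β| := by
          refine Finset.sum_le_sum fun β _ => ?_
          rw [abs_mul]
          refine mul_le_mul_of_nonneg_right ?_ (abs_nonneg _)
          exact (Finset.single_le_sum (f := fun β => |B α β|) (fun _ _ => abs_nonneg _)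
            (Finset.mem_univ β)).trans (row_sum_le_mnorm B α)
      _ = _ := by rw [vnorm, Finset.mul_sum]
  calc vnorm (B.mulVec v) ≤ ∑ _α : 𝒜, mnorm B * vnorm v := Finset.sum_le_sum fun α _ => h α
    _ = _ := by rw [Finset.sum_const, Finset.card_univ, nsmul_eq_mul, mul_assoc]

theorem opNormOn_nonneg (B : Matrix 𝒜 𝒜 ℝ) (V : Submodule ℝ (𝒜 → ℝ)) : 0 ≤ opNormOn B V := by
  refine Real.sSup_nonneg ?_
  rintro s ⟨v, -, -, rfl⟩
  exact vnorm_nonneg _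

theorem le_opNormOn (B : Matrix 𝒜 𝒜 ℝ) {V : Submodule ℝ (𝒜 → ℝ)} {v : 𝒜 → ℝ} (hv : v ∈ V) :
    vnorm (B.mulVec v) ≤ opNormOn B V * vnorm v := by
  have hbdd : BddAbove {s : ℝ | ∃ v ∈ V, vnorm v ≤ 1 ∧ s = vnorm (B.mulVec v)} := by
    refine ⟨Fintype.card 𝒜 * mnorm B, ?_⟩
    rintro s ⟨v, -, hv, rfl⟩
    refine (vnorm_mulVec_le B v).trans (mul_le_of_le_one_right ?_ hv)
    exact mul_nonneg (Nat.cast_nonneg _) (mnorm_nonneg B)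
  rcases (vnorm_nonneg v).eq_or_lt with h0 | h0
  · rw [vnorm_eq_zero h0.symm]
    simp
  · have h1 : vnorm (B.mulVec ((vnorm v)⁻¹ • v)) ≤ opNormOn B V := by
      refine le_csSup hbdd ⟨_, V.smul_mem _ hv, ?_, rfl⟩
      rw [vnorm_smul, abs_of_pos (inv_pos.2 h0), inv_mul_cancel₀ h0.ne']
    rw [Matrix.mulVec_smul, vnorm_smul, abs_of_pos (inv_pos.2 h0), inv_mul_le_iff₀ h0] at h1
    linarith

theorem opNormOn_one_le [DecidableEq 𝒜] (V : Submodule ℝ (𝒜 → ℝ)) :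
    opNormOn (1 : Matrix 𝒜 𝒜 ℝ) V ≤ 1 := by
  refine Real.sSup_le ?_ zero_le_one
  rintro s ⟨v, -, hv, rfl⟩
  rwa [Matrix.one_mulVec]

theorem norm_le_vnorm (v : 𝒜 → ℝ) : ‖v‖ ≤ vnorm v := by
  refine (pi_norm_le_iff_of_nonneg (vnorm_nonneg v)).2 fun α => ?_
  exact Finset.single_le_sum (f := fun α => |v α|) (fun _ _ => abs_nonneg _) (Finset.mem_univ α)

theorem vnorm_le_norm (v : 𝒜 → ℝ) : vnorm v ≤ Fintype.card 𝒜 * ‖v‖ := by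
  calc vnorm v ≤ ∑ _α : 𝒜, ‖v‖ := Finset.sum_le_sum fun α _ => norm_le_pi_norm v α
    _ = _ := by rw [Finset.sum_const, Finset.card_univ, nsmul_eq_mul]

/-! ### Angles and projections -/

theorem sinAngle_le_abs_sin {V W : Submodule ℝ (𝒜 → ℝ)} {v w : 𝒜 → ℝ} (hv : v ∈ V) (hw : w ∈ W)
    (hv0 : v ≠ 0) (hw0 : w ≠ 0) : sinAngle V W ≤
      |Real.sin (InnerProductGeometry.angle (WithLp.toLp 2 v) (WithLp.toLp 2 w))| := by
  refine csInf_le ⟨0, ?_⟩ ⟨v, hv, w, hw, hv0, hw0, rfl⟩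
  rintro s ⟨_, _, _, _, _, _, rfl⟩
  exact abs_nonneg _

theorem sinAngle_nonneg (V W : Submodule ℝ (𝒜 → ℝ)) : 0 ≤ sinAngle V W := by
  refine Real.sInf_nonneg ?_
  rintro s ⟨_, _, _, _, _, _, rfl⟩
  exact abs_nonneg _

theorem sinAngle_le_one (V W : Submodule ℝ (𝒜 → ℝ)) : sinAngle V W ≤ 1 := by
  rcases Set.eq_empty_or_nonempty {s : ℝ | ∃ v ∈ V, ∃ w ∈ W, v ≠ 0 ∧ w ≠ 0 ∧
    s = |Real.sin (InnerProductGeometry.angle (WithLp.toLp 2 v) (WithLp.toLp 2 w))|} with h | h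
  · rw [sinAngle, h, Real.sInf_empty]
    exact zero_le_one
  · obtain ⟨s, v, hv, w, hw, hv0, hw0, rfl⟩ := h
    exact (sinAngle_le_abs_sin hv hw hv0 hw0).trans (Real.abs_sin_le_one _)

theorem norm_mul_abs_sin_angle_le {F : Type*} [NormedAddCommGroup F] [InnerProductSpace ℝ F]
    (x y : F) : ‖x‖ * |Real.sin (InnerProductGeometry.angle x y)| ≤ ‖x + y‖ := by
  refine le_of_sq_le_sq ?_ (norm_nonneg _)
  rw [norm_add_sq_real, ← InnerProductGeometry.cos_angle_mul_norm_mul_norm x y, mul_pow, sq_abs,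
    Real.sin_sq]
  nlinarith [sq_nonneg (‖x‖ * Real.cos (InnerProductGeometry.angle x y) + ‖y‖)]

theorem norm_toLp_le_vnorm (v : 𝒜 → ℝ) : ‖WithLp.toLp 2 v‖ ≤ vnorm v := by
  rw [EuclideanSpace.norm_eq]
  refine Real.sqrt_le_iff.2 ⟨vnorm_nonneg v, ?_⟩
  simp only [Real.norm_eq_abs]
  exact Finset.sum_sq_le_sq_sum_of_nonneg fun _ _ => abs_nonneg _

theorem vnorm_le_norm_toLp (v : 𝒜 → ℝ) : vnorm v ≤ Fintype.card 𝒜 * ‖WithLp.toLp 2 v‖ := by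
  calc vnorm v ≤ ∑ _α : 𝒜, ‖WithLp.toLp 2 v‖ := by
        refine Finset.sum_le_sum fun α _ => ?_
        rw [← Real.norm_eq_abs]
        exact PiLp.norm_apply_le (WithLp.toLp 2 v) α
    _ = _ := by rw [Finset.sum_const, Finset.card_univ, nsmul_eq_mul]

/-- The component of `v + w` in `V` is controlled by the angle between `V` and `W`. -/
theorem vnorm_mul_sinAngle_le {V W : Submodule ℝ (𝒜 → ℝ)} {v w : 𝒜 → ℝ} (hv : v ∈ V)
    (hw : w ∈ W) : vnorm v * sinAngle V W ≤ Fintype.card 𝒜 * vnorm (v + w) ∧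
      vnorm w * sinAngle V W ≤ Fintype.card 𝒜 * vnorm (v + w) := by
  have hcard : (0 : ℝ) ≤ Fintype.card 𝒜 := Nat.cast_nonneg _
  have hs1 := sinAngle_le_one V W
  have hs0 := sinAngle_nonneg V W
  have key : ∀ u u' : 𝒜 → ℝ, (u ≠ 0 → u' ≠ 0 → sinAngle V W ≤
      |Real.sin (InnerProductGeometry.angle (WithLp.toLp 2 u) (WithLp.toLp 2 u'))|) →
      vnorm u * sinAngle V W ≤ Fintype.card 𝒜 * vnorm (u + u') := by
    intro u u' hsin
    have h1 : ‖WithLp.toLp 2 u‖ * sinAngle V W ≤ ‖WithLp.toLp 2 u + WithLp.toLp 2 u'‖ := by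
      by_cases hu : u = 0
      · subst hu; simp
      by_cases hu' : u' = 0
      · subst hu'
        simpa using mul_le_of_le_one_right (norm_nonneg (WithLp.toLp 2 u)) hs1
      exact (mul_le_mul_of_nonneg_left (hsin hu hu') (norm_nonneg _)).trans
        (norm_mul_abs_sin_angle_le _ _)
    rw [← WithLp.toLp_add] at h1
    calc vnorm u * sinAngle V W
        ≤ (Fintype.card 𝒜 * ‖WithLp.toLp 2 u‖) * sinAngle V W := by
          gcongr; exact vnorm_le_norm_toLp u
      _ = Fintype.card 𝒜 * (‖WithLp.toLp 2 u‖ * sinAngle V W) := by ring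
      _ ≤ _ := by
          gcongr
          exact h1.trans (norm_toLp_le_vnorm _)
  refine ⟨key v w fun hv0 hw0 => sinAngle_le_abs_sin hv hw hv0 hw0, ?_⟩
  rw [add_comm v w]
  refine key w v fun hw0 hv0 => ?_
  rw [InnerProductGeometry.angle_comm]
  exact sinAngle_le_abs_sin hv hw hv0 hw0

/-! ### The weights `⟨s⟩^a` -/

theorem bracketPow_nonneg {s a : ℝ} (hs : 1 ≤ s) : 0 ≤ bracketPow s a := by
  rw [bracketPow]
  split_ifs
  · positivity
  · linarith [Real.log_nonneg hs]

/-- Both cases of `⟨s⟩^a` are dominated by slightly larger powers. -/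
theorem bracketPow_le_rpow {s a ε : ℝ} (hs : 1 ≤ s) (ha : 0 ≤ a) (hε : 0 < ε) :
    bracketPow s a ≤ (1 + ε⁻¹) * s ^ (a + ε) := by
  have hε' := inv_pos.2 hε
  rw [bracketPow]
  split_ifs with h
  · calc s ^ a ≤ s ^ (a + ε) := Real.rpow_le_rpow_of_exponent_le hs (by linarith)
      _ ≤ _ := le_mul_of_one_le_left (by positivity) (by linarith)
  · obtain rfl : a = 0 := le_antisymm (not_lt.1 h) ha
    have h1 := Real.log_le_rpow_div (by linarith : 0 ≤ s) hε
    have h2 : 1 ≤ s ^ ε := Real.one_le_rpow hs hε.le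
    rw [zero_add, add_mul, one_mul, inv_mul_eq_div]
    linarith

end KZ

namespace IET

open KZ

variable {𝒜 : Type*} [Fintype 𝒜] [DecidableEq 𝒜] {m : ℕ}

/-! ### The two orders of an interval exchange -/

/-- The left end point of the interval with label `α` when intervals of lengths `len` are laid out
on the line, starting from `0`, in the order given by `e`. -/
def posLeft (e : 𝒜 ≃ Fin (m + 1)) (len : 𝒜 → ℝ) (α : 𝒜) : ℝ :=
  ∑ β ∈ Finset.univ.filter (fun β => e β < e α), len β

theorem left_eq_posLeft (T : IET 𝒜 m) (α : 𝒜) : T.left α = posLeft T.top T.len α := rfl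

theorem right_eq (T : IET 𝒜 m) (α : 𝒜) : T.right α = T.left α + T.len α := by
  have : (Finset.univ.filter (fun β => T.top β ≤ T.top α)) =
      insert α (Finset.univ.filter (fun β => T.top β < T.top α)) := by
    ext β
    simp [le_iff_lt_or_eq, or_comm]
  rw [right, this, Finset.sum_insert (by simp), add_comm]
  rfl

theorem posLeft_nonneg (e : 𝒜 ≃ Fin (m + 1)) {len : 𝒜 → ℝ} (h : ∀ α, 0 < len α) (α : 𝒜) :
    0 ≤ posLeft e len α := Finset.sum_nonneg fun β _ => (h β).le

theorem posLeft_add_le_of_lt (e : 𝒜 ≃ Fin (m + 1)) {len : 𝒜 → ℝ} (h : ∀ α, 0 < len α)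
    {α β : 𝒜} (hαβ : e α < e β) : posLeft e len α + len α ≤ posLeft e len β := by
  rw [posLeft, posLeft, add_comm, ← Finset.sum_insert (by simp)]
  refine Finset.sum_le_sum_of_subset_of_nonneg ?_ fun i _ _ => (h i).le
  intro i hi
  rcases Finset.mem_insert.1 hi with rfl | hi
  · simpa using hαβ
  · simp only [Finset.mem_filter, Finset.mem_univ, true_and] at hi ⊢
    exact hi.trans hαβ

theorem posLeft_add_le_sum (e : 𝒜 ≃ Fin (m + 1)) {len : 𝒜 → ℝ} (h : ∀ α, 0 < len α) (α : 𝒜) :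
    posLeft e len α + len α ≤ ∑ β, len β := by
  rw [posLeft, add_comm, ← Finset.sum_insert (by simp)]
  exact Finset.sum_le_sum_of_subset_of_nonneg (Finset.subset_univ _) fun i _ _ => (h i).le

theorem posLeft_last (e : 𝒜 ≃ Fin (m + 1)) (len : 𝒜 → ℝ) {α : 𝒜} (hα : e α = Fin.last m) :
    posLeft e len α + len α = ∑ β, len β := by
  rw [posLeft, add_comm, ← Finset.sum_insert (by simp)]
  congr 1
  ext β
  simp only [Finset.mem_insert, Finset.mem_filter, Finset.mem_univ, true_and, iff_true, hα]
  rcases (Fin.le_last (e β)).lt_or_eq with h | h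
  · exact Or.inr h
  · exact Or.inl (e.injective (h.trans hα.symm))

/-- The displacement on `I_α` is the difference of the left end points in the two orders. -/
theorem Omega_mulVec (T : IET 𝒜 m) (α : 𝒜) :
    T.Omega.mulVec T.len α = posLeft T.bot T.len α - T.left α := by
  simp only [Matrix.mulVec, dotProduct, left, posLeft, Finset.sum_filter,
    ← Finset.sum_sub_distrib, Omega]
  refine Finset.sum_congr rfl fun β _ => ?_
  by_cases h : β = α
  · subst h; simp
  · have h1 : T.bot β ≠ T.bot α := fun h' => h (T.bot.injective h')
    have h2 : T.top β ≠ T.top α := fun h' => h (T.top.injective h')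
    rcases lt_or_gt_of_ne h1 with h1 | h1 <;> rcases lt_or_gt_of_ne h2 with h2 | h2 <;>
      simp [h1, h2, h1.not_gt, h2.not_gt]

theorem mem_piece {T : IET 𝒜 m} {α : 𝒜} {x : ℝ} :
    x ∈ T.piece α ↔ T.left α ≤ x ∧ x < T.left α + T.len α := by
  rw [piece, right_eq, Set.mem_Ico]

theorem left_mem_piece {T : IET 𝒜 m} (h : ∀ α, 0 < T.len α) (α : 𝒜) : T.left α ∈ T.piece α :=
  mem_piece.2 ⟨le_rfl, by linarith [h α]⟩

theorem piece_subset_base {T : IET 𝒜 m} (h : ∀ α, 0 < T.len α) (α : 𝒜) :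
    T.piece α ⊆ T.base := by
  intro x hx
  rw [mem_piece] at hx
  exact ⟨(posLeft_nonneg T.top h α).trans hx.1, hx.2.trans_le (posLeft_add_le_sum T.top h α)⟩

theorem eq_of_mem_piece {T : IET 𝒜 m} (h : ∀ α, 0 < T.len α) {α β : 𝒜} {x : ℝ}
    (hα : x ∈ T.piece α) (hβ : x ∈ T.piece β) : α = β := by
  rw [mem_piece] at hα hβ
  by_contra hne
  rcases lt_or_gt_of_ne (fun h' => hne (T.top.injective h')) with h' | h'
  · have := posLeft_add_le_of_lt T.top h h'
    simp only [← left_eq_posLeft] at this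
    linarith
  · have := posLeft_add_le_of_lt T.top h h'
    simp only [← left_eq_posLeft] at this
    linarith

theorem exists_mem_piece {T : IET 𝒜 m} {x : ℝ} (hx : x ∈ T.base) : ∃ α, x ∈ T.piece α := by
  classical
  have hne : (Finset.univ.filter fun α => T.left α ≤ x).Nonempty := by
    refine ⟨T.top.symm 0, ?_⟩
    have h0 : ∀ β, ¬ T.top β < 0 := fun β => Fin.not_lt_zero _
    have h1 : T.left (T.top.symm 0) = 0 := by simp [left, h0]
    simpa [h1] using hx.1
  obtain ⟨α, hα, hmax⟩ := Finset.exists_max_image _ (fun α => T.top α) hne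
  simp only [Finset.mem_filter, Finset.mem_univ, true_and] at hα hmax
  refine ⟨α, mem_piece.2 ⟨hα, ?_⟩⟩
  rcases (Fin.le_last (T.top α)).lt_or_eq with hl | hl
  · have hs : ((T.top α + 1 : Fin (m + 1)) : ℕ) = T.top α + 1 := Fin.val_add_one_of_lt hl
    have hleft : T.left (T.top.symm (T.top α + 1)) = T.left α + T.len α := by
      rw [← right_eq, left, right]
      congr 1
      ext β
      simp only [Finset.mem_filter, Finset.mem_univ, true_and, Equiv.apply_symm_apply]
      rw [Fin.lt_def, hs, Fin.le_def, Nat.lt_succ_iff]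
    by_contra hcon
    have := hmax (T.top.symm (T.top α + 1)) (by rw [hleft]; linarith)
    rw [Equiv.apply_symm_apply, Fin.le_def, hs] at this
    omega
  · have := posLeft_last T.top T.len hl
    rw [left_eq_posLeft, this]
    exact hx.2

theorem map_of_mem {T : IET 𝒜 m} (h : ∀ α, 0 < T.len α) {α : 𝒜} {x : ℝ} (hx : x ∈ T.piece α) :
    T.map x = x + (posLeft T.bot T.len α - T.left α) := by
  rw [map, Finset.sum_eq_single α]
  · rw [Set.indicator_of_mem hx, Omega_mulVec]
  · intro β _ hβ
    exact Set.indicator_of_notMem (fun h' => hβ (eq_of_mem_piece h h' hx)) _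
  · simp

theorem map_mem_base {T : IET 𝒜 m} (h : ∀ α, 0 < T.len α) {x : ℝ} (hx : x ∈ T.base) :
    T.map x ∈ T.base := by
  obtain ⟨α, hα⟩ := exists_mem_piece hx
  rw [map_of_mem h hα]
  rw [mem_piece] at hα
  have h1 := posLeft_nonneg T.bot h α
  have h2 := posLeft_add_le_sum T.bot h α
  constructor
  · linarith
  · rw [total]; linarith

/-! ### The combinatorics of one step of the Rauzy–Veech induction -/

theorem trans_shiftAfter_val {e : 𝒜 ≃ Fin (m + 1)} {v w : 𝒜} (hvw : v ≠ w)
    (hw : e w = Fin.last m) (β : 𝒜) : ((e.trans (shiftAfter (e v)) β : Fin (m + 1)) : ℕ) =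
      if (e β : ℕ) ≤ e v then (e β : ℕ) else if (e β : ℕ) < m then (e β : ℕ) + 1
        else (e v : ℕ) + 1 :=
  shiftAfter_apply (e v) (e β)
    (lt_of_le_of_ne (Fin.le_last _) fun h' => hvw (e.injective (h'.trans hw.symm)))

/-- Effect on the left end points of subtracting the length of the last letter `w` from that of
`v` and moving `w` right behind `v`: the other intervals keep their left end points. -/
theorem posLeft_shiftAfter {e : 𝒜 ≃ Fin (m + 1)} (len : 𝒜 → ℝ) {v w : 𝒜} (hvw : v ≠ w)
    (hw : e w = Fin.last m) {α : 𝒜} (hα : α ≠ w) :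
    posLeft (e.trans (shiftAfter (e v))) (Function.update len v (len v - len w)) α =
      posLeft e len α := by
  have hval := trans_shiftAfter_val hvw hw
  have hwm : (e w : ℕ) = m := by simp [hw]
  have hne : ∀ β γ, β ≠ γ → (e β : ℕ) ≠ e γ := fun β γ h h' => h (e.injective (Fin.ext h'))
  have hle : ∀ β, (e β : ℕ) ≤ m := fun β => Nat.lt_succ_iff.1 (e β).2
  have key : ∀ β, (if e.trans (shiftAfter (e v)) β < e.trans (shiftAfter (e v)) α then
      Function.update len v (len v - len w) β else 0) =
      ((if e β < e α then len β else 0) + (if β = w then (if e v < e α then len w else 0) else 0))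
        - (if β = v then (if e v < e α then len w else 0) else 0) := by
    intro β
    simp only [Fin.lt_def, hval]
    have h1 := hle α
    have h2 := hne α w hα
    have h3 := hne v w hvw
    have h4 := hle v
    rcases eq_or_ne β w with rfl | hβw
    · rw [if_pos rfl, if_neg hvw.symm,
        Function.update_of_ne hvw.symm]
      have : ¬ ((e β : ℕ) ≤ e v) := by omega
      have h5 : ¬ ((e β : ℕ) < m) := by omega
      rw [if_neg this, if_neg h5]
      split_ifs <;> first | omega | simp
    · rw [if_neg hβw]
      have h6 := hne β w hβw
      have h7 := hle β
      rcases eq_or_ne β v with rfl | hβv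
      · rw [if_pos rfl, Function.update_self]
        split_ifs <;> first | omega | simp
      · rw [if_neg hβv, Function.update_of_ne hβv]
        split_ifs <;> first | omega | simp
  simp only [posLeft, Finset.sum_filter]
  rw [Finset.sum_congr rfl fun β _ => key β, Finset.sum_sub_distrib, Finset.sum_add_distrib]
  simp

theorem posLeft_shiftAfter_self {e : 𝒜 ≃ Fin (m + 1)} (len : 𝒜 → ℝ) {v w : 𝒜} (hvw : v ≠ w)
    (hw : e w = Fin.last m) :
    posLeft (e.trans (shiftAfter (e v))) (Function.update len v (len v - len w)) w =
      posLeft e len v + (len v - len w) := by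
  have hval := trans_shiftAfter_val hvw hw
  have hwm : (e w : ℕ) = m := by simp [hw]
  have hne : ∀ β γ, β ≠ γ → (e β : ℕ) ≠ e γ := fun β γ h h' => h (e.injective (Fin.ext h'))
  have hle : ∀ β, (e β : ℕ) ≤ m := fun β => Nat.lt_succ_iff.1 (e β).2
  have key : ∀ β, (if e.trans (shiftAfter (e v)) β < e.trans (shiftAfter (e v)) w then
      Function.update len v (len v - len w) β else 0) =
      (if e β < e v then len β else 0) + (if β = v then len v - len w else 0) := by
    intro β
    simp only [Fin.lt_def, hval]
    have h3 := hne v w hvw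
    have h4 := hle v
    have h7 := hle β
    rcases eq_or_ne β v with rfl | hβv
    · rw [if_pos rfl, Function.update_self]
      split_ifs <;> first | omega | simp
    · have := hne β v hβv
      rw [if_neg hβv, Function.update_of_ne hβv]
      split_ifs <;> first | omega | simp
  simp only [posLeft, Finset.sum_filter]
  rw [Finset.sum_congr rfl fun β _ => key β, Finset.sum_add_distrib]
  simp

theorem posLeft_update_of_last {e : 𝒜 ≃ Fin (m + 1)} (len : 𝒜 → ℝ) {v : 𝒜} (s : ℝ)
    (hv : e v = Fin.last m) (α : 𝒜) :
    posLeft e (Function.update len v s) α = posLeft e len α := by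
  refine Finset.sum_congr rfl fun β hβ => Function.update_of_ne ?_ _ _
  rintro rfl
  simp only [Finset.mem_filter, Finset.mem_univ, true_and, hv] at hβ
  exact absurd hβ (not_lt.2 (Fin.le_last _))

/-- Positive lengths, Keane's condition, and at least two intervals: the properties preserved by
the Rauzy–Veech induction on which its combinatorics rests. -/
structure IsKeane (T : IET 𝒜 m) : Prop where
  pos : ∀ α, 0 < T.len α
  keane : T.Keane
  two_le : m ≠ 0

theorem IsKeane.last_ne {T : IET 𝒜 m} (h : T.IsKeane) {v w : 𝒜} (hv : T.bot v = Fin.last m)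
    (hw : T.top w = Fin.last m) : v ≠ w ∧ T.len v ≠ T.len w := by
  have h0 : T.top w ≠ 0 := by
    rw [hw]
    intro h'
    exact h.two_le (by simpa using congrArg Fin.val h')
  -- Otherwise the last interval is mapped by translation onto an interval with left end `l_w`.
  have key : T.len v ≠ T.len w := by
    intro hlen
    refine h.keane 1 le_rfl v w h0 ?_
    have h1 := posLeft_last T.bot T.len hv
    have h2 := posLeft_last T.top T.len hw
    rw [Function.iterate_one, map_of_mem h.pos (left_mem_piece h.pos v), left_eq_posLeft,
      left_eq_posLeft]
    linarith
  exact ⟨fun h' => key (h' ▸ rfl), key⟩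

/-- The two cases of the Rauzy–Veech step, in terms of the winner `v` and the loser `w`. -/
theorem IsKeane.rauzy_cases {T : IET 𝒜 m} (h : T.IsKeane) :
    T.winner ≠ T.loser ∧ T.len T.loser < T.len T.winner ∧
    ((T.top T.winner = Fin.last m ∧ T.bot T.loser = Fin.last m ∧ T.rauzy.top = T.top ∧
        T.rauzy.bot = T.bot.trans (shiftAfter (T.bot T.winner))) ∨
     (T.bot T.winner = Fin.last m ∧ T.top T.loser = Fin.last m ∧ T.rauzy.bot = T.bot ∧
        T.rauzy.top = T.top.trans (shiftAfter (T.top T.winner)))) := by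
  have key := h.last_ne (v := T.bot.symm (Fin.last m)) (w := T.top.symm (Fin.last m))
    (by simp) (by simp)
  by_cases hT : T.topWins
  · have hv : T.winner = T.top.symm (Fin.last m) := if_pos hT
    have hw : T.loser = T.bot.symm (Fin.last m) := if_pos hT
    refine ⟨by rw [hv, hw]; exact key.1.symm, by rw [hv, hw]; exact hT, Or.inl ⟨by simp [hv],
      by simp [hw], if_pos hT, if_pos hT⟩⟩
  · have hv : T.winner = T.bot.symm (Fin.last m) := if_neg hT
    have hw : T.loser = T.top.symm (Fin.last m) := if_neg hT
    refine ⟨by rw [hv, hw]; exact key.1, ?_, Or.inr ⟨by simp [hv],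
      by simp [hw], if_neg hT, if_neg hT⟩⟩
    rw [hv, hw]
    exact lt_of_le_of_ne (not_lt.1 hT) key.2.symm

theorem rauzy_len (T : IET 𝒜 m) :
    T.rauzy.len = Function.update T.len T.winner (T.len T.winner - T.len T.loser) := rfl

theorem IsKeane.rauzy_pos {T : IET 𝒜 m} (h : T.IsKeane) (α : 𝒜) : 0 < T.rauzy.len α := by
  obtain ⟨_, h2, _⟩ := h.rauzy_cases
  rw [rauzy_len]
  rcases eq_or_ne α T.winner with rfl | hα
  · rw [Function.update_self]; linarith
  · rw [Function.update_of_ne hα]; exact h.pos α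

theorem kzMatrix_row_sum (T : IET 𝒜 m) (β : 𝒜) :
    ∑ γ, T.kzMatrix.transpose β γ = if β = T.loser then 2 else 1 := by
  have : ∀ γ, T.kzMatrix.transpose β γ =
      (if γ = β then 1 else 0) + (if γ = T.winner then (if β = T.loser then 1 else 0) else 0) := by
    intro γ
    simp only [kzMatrix, Matrix.transpose_apply, Matrix.add_apply, Matrix.one_apply,
      Matrix.single_apply]
    congr 1
    grind
  rw [Finset.sum_congr rfl fun γ _ => this γ, Finset.sum_add_distrib]
  simp
  split_ifs <;> rfl

theorem rauzy_total (T : IET 𝒜 m) :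
    T.rauzy.total = T.total - T.len T.loser := by
  rw [total, rauzy_len, Finset.sum_update_of_mem (Finset.mem_univ _), total,
    ← Finset.add_sum_erase _ _ (Finset.mem_univ T.winner), Finset.sdiff_singleton_eq_erase]
  ring

/-- Away from the loser, the Rauzy–Veech step restricts the map to a smaller interval. -/
theorem IsKeane.rauzy_piece_of_ne {T : IET 𝒜 m} (h : T.IsKeane) {β : 𝒜} (hβ : β ≠ T.loser)
    {x : ℝ} (hx : x ∈ T.rauzy.piece β) : x ∈ T.piece β ∧ T.rauzy.map x = T.map x := by
  obtain ⟨hvw, hlen, hc⟩ := h.rauzy_cases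
  have hle : T.rauzy.len β ≤ T.len β := by
    rw [rauzy_len]
    rcases eq_or_ne β T.winner with rfl | hβ'
    · rw [Function.update_self]; linarith [h.pos T.loser]
    · rw [Function.update_of_ne hβ']
  have hleft : T.rauzy.left β = T.left β := by
    rw [left_eq_posLeft, left_eq_posLeft, rauzy_len]
    rcases hc with ⟨hv, hw, ht, hb⟩ | ⟨hv, hw, hb, ht⟩
    · rw [ht, posLeft_update_of_last _ _ hv]
    · rw [ht, posLeft_shiftAfter _ hvw hw hβ]
  have hbot : posLeft T.rauzy.bot T.rauzy.len β = posLeft T.bot T.len β := by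
    rw [rauzy_len]
    rcases hc with ⟨hv, hw, ht, hb⟩ | ⟨hv, hw, hb, ht⟩
    · rw [hb, posLeft_shiftAfter _ hvw hw hβ]
    · rw [hb, posLeft_update_of_last _ _ hv]
  have hx' : x ∈ T.piece β := by
    rw [mem_piece] at hx ⊢
    exact ⟨hleft ▸ hx.1, by linarith [hx.2]⟩
  exact ⟨hx', by rw [map_of_mem h.rauzy_pos hx, map_of_mem h.pos hx', hbot, hleft]⟩

/-- The new interval labelled by the loser visits the old intervals of the loser and the winner,
in an order depending on the type of the step, before it returns. -/
theorem IsKeane.rauzy_piece_loser {T : IET 𝒜 m} (h : T.IsKeane) :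
    ∃ γ γ' c, ((γ = T.loser ∧ γ' = T.winner) ∨ (γ = T.winner ∧ γ' = T.loser ∧
        T.top T.loser = Fin.last m ∧ T.map (T.rauzy.left T.loser) = T.left T.loser)) ∧
      ∀ x ∈ T.rauzy.piece T.loser, x ∈ T.piece γ ∧ T.map x = x + c ∧ x + c ∈ T.piece γ' ∧
        T.rauzy.map x = T.map (x + c) ∧ T.rauzy.total ≤ x + c := by
  obtain ⟨hvw, hlen, hc⟩ := h.rauzy_cases
  have htot := T.rauzy_total
  have hw' : T.rauzy.len T.loser = T.len T.loser := by
    rw [rauzy_len, Function.update_of_ne hvw.symm]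
  rcases hc with ⟨hv, hw, ht, hb⟩ | ⟨hv, hw, hb, ht⟩
  · have hleft : T.rauzy.left T.loser = T.left T.loser := by
      rw [left_eq_posLeft, left_eq_posLeft, rauzy_len, ht, posLeft_update_of_last _ _ hv]
    have hbot : posLeft T.rauzy.bot T.rauzy.len T.loser =
        posLeft T.bot T.len T.winner + (T.len T.winner - T.len T.loser) := by
      rw [rauzy_len, hb, posLeft_shiftAfter_self _ hvw hw]
    have e1 := posLeft_last T.bot T.len hw
    have e2 := posLeft_last T.top T.len hv
    rw [← left_eq_posLeft] at e2
    change _ = T.total at e1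
    change _ = T.total at e2
    refine ⟨T.loser, T.winner, posLeft T.bot T.len T.loser - T.left T.loser, Or.inl ⟨rfl, rfl⟩,
      fun x hx => ?_⟩
    have hx1 : x ∈ T.piece T.loser := by
      rw [mem_piece] at hx ⊢
      rwa [hleft, hw'] at hx
    have hx2 := mem_piece.1 hx1
    have hx3 : x + (posLeft T.bot T.len T.loser - T.left T.loser) ∈ T.piece T.winner := by
      rw [mem_piece]
      constructor <;> linarith
    refine ⟨hx1, map_of_mem h.pos hx1, hx3, ?_, by linarith⟩
    rw [map_of_mem h.rauzy_pos hx, map_of_mem h.pos hx3, hbot, hleft]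
    linarith
  · have hleft : T.rauzy.left T.loser =
        posLeft T.top T.len T.winner + (T.len T.winner - T.len T.loser) := by
      rw [left_eq_posLeft, rauzy_len, ht, posLeft_shiftAfter_self _ hvw hw]
    have hbot : posLeft T.rauzy.bot T.rauzy.len T.loser = posLeft T.bot T.len T.loser := by
      rw [rauzy_len, hb, posLeft_update_of_last _ _ hv]
    have e1 := posLeft_last T.bot T.len hv
    have e2 := posLeft_last T.top T.len hw
    rw [← left_eq_posLeft] at e2 hleft
    change _ = T.total at e1
    change _ = T.total at e2
    have hpiece : ∀ x ∈ T.rauzy.piece T.loser, x ∈ T.piece T.winner := by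
      intro x hx
      rw [mem_piece] at hx ⊢
      rw [hleft, hw'] at hx
      constructor <;> linarith
    refine ⟨T.winner, T.loser, posLeft T.bot T.len T.winner - T.left T.winner,
      Or.inr ⟨rfl, rfl, hw, ?_⟩, fun x hx => ?_⟩
    · rw [map_of_mem h.pos (hpiece _ (left_mem_piece h.rauzy_pos _)), hleft]
      linarith
    have hx1 := hpiece x hx
    have hx2 := mem_piece.1 hx
    rw [hleft, hw'] at hx2
    have hx3 : x + (posLeft T.bot T.len T.winner - T.left T.winner) ∈ T.piece T.loser := by
      rw [mem_piece]
      constructor <;> linarith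
    refine ⟨hx1, map_of_mem h.pos hx1, hx3, ?_, by linarith⟩
    rw [map_of_mem h.rauzy_pos hx, map_of_mem h.pos hx3, hbot, hleft]
    linarith

/-! ### Induced interval exchanges and their towers -/

/-- `T'` is the map induced by `T` on a subinterval, the tower over the interval `β` of `T'`
having height `∑ γ, q β γ` and passing `q β γ` times through the interval `γ` of `T`. Each floor
of a tower is a translate of its base contained in an interval of `T`, and the floors of
all towers are pairwise disjoint. -/
structure IsInduced (T T' : IET 𝒜 m) (q : Matrix 𝒜 𝒜 ℕ) : Prop where
  floor : ∀ β, ∀ i < ∑ γ, q β γ, ∃ γ c, ∀ x ∈ T'.piece β, T.map^[i] x = x + c ∧ x + c ∈ T.piece γ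
  disjoint : ∀ β β' i i' x x', i < ∑ γ, q β γ → i' < ∑ γ, q β' γ → x ∈ T'.piece β →
    x' ∈ T'.piece β' → T.map^[i] x = T.map^[i'] x' → β = β' ∧ i = i'
  map_eq : ∀ β, ∀ x ∈ T'.piece β, T'.map x = T.map^[∑ γ, q β γ] x
  visits : ∀ β, ∀ x ∈ T'.piece β, ∀ γ,
    birkhoffSum T.map ((T.piece γ).indicator fun _ => (1 : ℕ)) (∑ γ, q β γ) x = q β γ
  len_eq : ∀ γ, T.len γ = ∑ β, q β γ * T'.len β

/-- One step of the induction: the tower over the loser has two floors, the others have one. -/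
theorem IsKeane.isInduced_rauzy {T : IET 𝒜 m} (h : T.IsKeane) :
    T.IsInduced T.rauzy T.kzMatrix.transpose := by
  obtain ⟨hvw, hlen, -⟩ := h.rauzy_cases
  obtain ⟨γ, γ', c, hγ, hw⟩ := h.rauzy_piece_loser
  refine ⟨?_, ?_, ?_, ?_, ?_⟩
  · intro β i hi
    rw [kzMatrix_row_sum] at hi
    by_cases hβ : β = T.loser
    · subst hβ
      rw [if_pos rfl] at hi
      interval_cases i
      · exact ⟨γ, 0, fun x hx => by simpa using (hw x hx).1⟩
      · exact ⟨γ', c, fun x hx => ⟨(hw x hx).2.1, (hw x hx).2.2.1⟩⟩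
    · rw [if_neg hβ, Nat.lt_one_iff] at hi
      subst hi
      exact ⟨β, 0, fun x hx => by simpa using (h.rauzy_piece_of_ne hβ hx).1⟩
  · -- The image of the loser's interval lies to the right of the new base interval.
    have key : ∀ β i x, i < ∑ γ, T.kzMatrix.transpose β γ → x ∈ T.rauzy.piece β →
        i = 0 ∨ (i = 1 ∧ β = T.loser ∧ T.rauzy.total ≤ T.map^[i] x) := by
      intro β i x hi hx
      rw [kzMatrix_row_sum] at hi
      split_ifs at hi with hβ
      · subst hβ
        interval_cases i
        · exact Or.inl rfl
        · refine Or.inr ⟨rfl, rfl, ?_⟩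
          rw [Function.iterate_one, (hw x hx).2.1]
          exact (hw x hx).2.2.2.2
      · exact Or.inl (by omega)
    intro β β' i i' x x' hi hi' hx hx' heq
    have hb := piece_subset_base h.rauzy_pos β hx
    have hb' := piece_subset_base h.rauzy_pos β' hx'
    rcases key β i x hi hx with rfl | ⟨rfl, rfl, h1⟩
    · rcases key β' i' x' hi' hx' with rfl | ⟨rfl, rfl, h2⟩
      · refine ⟨eq_of_mem_piece h.rauzy_pos hx ?_, rfl⟩
        simp only [Function.iterate_zero, id_eq] at heq
        rwa [heq]
      · rw [← heq] at h2
        exact absurd hb.2 (not_lt.2 h2)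
    · rcases key β' i' x' hi' hx' with rfl | ⟨rfl, rfl, h2⟩
      · rw [heq] at h1
        exact absurd hb'.2 (not_lt.2 h1)
      · exact ⟨rfl, rfl⟩
  · intro β x hx
    rw [kzMatrix_row_sum]
    split_ifs with hβ
    · subst hβ
      rw [(hw x hx).2.2.2.1, ← (hw x hx).2.1]
      rfl
    · rw [(h.rauzy_piece_of_ne hβ hx).2, Function.iterate_one]
  · intro β x hx δ
    have hind : ∀ {y ε}, y ∈ T.piece ε →
        (T.piece δ).indicator (fun _ => (1 : ℕ)) y = if ε = δ then 1 else 0 := by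
      intro y ε hy
      split_ifs with hεδ
      · subst hεδ
        exact Set.indicator_of_mem hy _
      · exact Set.indicator_of_notMem (fun h' => hεδ (eq_of_mem_piece h.pos hy h')) _
    rw [kzMatrix_row_sum]
    simp only [kzMatrix, Matrix.transpose_apply, Matrix.add_apply, Matrix.one_apply,
      Matrix.single_apply]
    by_cases hβ : β = T.loser
    · subst hβ
      rw [if_pos rfl, birkhoffSum, Finset.sum_range_succ, Finset.sum_range_one,
        Function.iterate_zero, id_eq, Function.iterate_one, hind (hw x hx).1, (hw x hx).2.1,
        hind (hw x hx).2.2.1]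
      grind
    · rw [if_neg hβ, birkhoffSum, Finset.sum_range_one, Function.iterate_zero, id_eq,
        hind (h.rauzy_piece_of_ne hβ hx).1]
      grind
  · intro δ
    have : ∀ β, ((T.kzMatrix.transpose β δ : ℕ) : ℝ) * T.rauzy.len β =
        (if β = δ then T.rauzy.len β else 0) +
          (if β = T.loser then (if δ = T.winner then T.len T.loser else 0) else 0) := by
      intro β
      simp only [kzMatrix, Matrix.transpose_apply, Matrix.add_apply, Matrix.one_apply,
        Matrix.single_apply]
      have h1 : T.rauzy.len T.loser = T.len T.loser := by
        rw [rauzy_len, Function.update_of_ne hvw.symm]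
      by_cases hβ : β = T.loser
      · subst hβ
        rw [h1]
        by_cases h2 : δ = T.winner
        · subst h2; simp [hvw, hvw.symm]
        · simp [h2, Ne.symm h2, eq_comm]
      · simp [hβ, Ne.symm hβ, eq_comm]
    rw [Finset.sum_congr rfl fun β _ => this β, Finset.sum_add_distrib]
    simp only [Finset.sum_ite_eq', Finset.mem_univ, if_true]
    rw [rauzy_len]
    by_cases h2 : δ = T.winner
    · subst h2; simp
    · simp [h2]

theorem IsInduced.exists_iterate {T T' : IET 𝒜 m} {q : Matrix 𝒜 𝒜 ℕ} (h : T.IsInduced T' q)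
    (hpos : ∀ α, 0 < T'.len α) (hq : ∀ β, 1 ≤ ∑ γ, q β γ) (k : ℕ) :
    ∀ x ∈ T'.base, ∃ k', k ≤ k' ∧ T'.map^[k] x = T.map^[k'] x := by
  induction k with
  | zero => exact fun x _ => ⟨0, le_rfl, rfl⟩
  | succ k ih =>
    intro x hx
    obtain ⟨β, hβ⟩ := exists_mem_piece hx
    obtain ⟨k', hk, hk'⟩ := ih _ (map_mem_base hpos hx)
    refine ⟨k' + ∑ γ, q β γ, by have := hq β; omega, ?_⟩
    rw [Function.iterate_succ_apply, hk', Function.iterate_add_apply, h.map_eq β x hβ]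

/-- A connection of the new exchange lengthens to a connection of the old one. -/
theorem IsKeane.isKeane_rauzy {T : IET 𝒜 m} (h : T.IsKeane) : T.rauzy.IsKeane := by
  refine ⟨h.rauzy_pos, ?_, h.two_le⟩
  obtain ⟨hvw, hlen, hc⟩ := h.rauzy_cases
  obtain ⟨γ, γ', c, hγ, hw⟩ := h.rauzy_piece_loser
  have hone : ∀ β, 1 ≤ ∑ γ, T.kzMatrix.transpose β γ := fun β => by
    rw [kzMatrix_row_sum]; split_ifs <;> simp
  have hit := h.isInduced_rauzy.exists_iterate h.rauzy_pos hone
  have hleft_ne : ∀ β, β ≠ T.loser → T.rauzy.left β = T.left β := by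
    intro β hβ
    rw [left_eq_posLeft, left_eq_posLeft, rauzy_len]
    rcases hc with ⟨hv, hw, ht, hb⟩ | ⟨hv, hw, hb, ht⟩
    · rw [ht, posLeft_update_of_last _ _ hv]
    · rw [ht, posLeft_shiftAfter _ hvw hw hβ]
  have hleft_w : T.rauzy.left T.loser = T.left T.loser ∨
      (T.top T.loser = Fin.last m ∧ T.map (T.rauzy.left T.loser) = T.left T.loser) := by
    rcases hc with ⟨hv, hw, ht, hb⟩ | hc
    · left
      rw [left_eq_posLeft, left_eq_posLeft, rauzy_len, ht, posLeft_update_of_last _ _ hv]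
    · rcases hγ with ⟨rfl, rfl⟩ | h'
      · exfalso
        -- in the bottom case the first letter of the loser's tower is the winner
        have hx := left_mem_piece h.rauzy_pos T.loser
        have h1 := mem_piece.1 (hw _ hx).1
        have h2 : T.rauzy.left T.loser =
            posLeft T.top T.len T.winner + (T.len T.winner - T.len T.loser) := by
          rw [left_eq_posLeft, rauzy_len, hc.2.2.2, posLeft_shiftAfter_self _ hvw hc.2.1]
        have h3 : T.rauzy.left T.loser ∈ T.piece T.winner := by
          rw [mem_piece, h2, ← left_eq_posLeft]
          constructor <;> linarith [h.pos T.loser]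
        exact hvw (eq_of_mem_piece h.pos h3 (hw _ hx).1)
      · exact Or.inr h'.2.2
  -- Every left end point of the new exchange has an old left end point in its forward orbit.
  have htarget : ∀ β, T.rauzy.top β ≠ 0 → ∃ δ s, T.top δ ≠ 0 ∧
      T.map^[s] (T.rauzy.left β) = T.left δ := by
    intro β hβ
    have hlast : Fin.last m ≠ 0 := fun h' => h.two_le (by simpa using congrArg Fin.val h')
    by_cases hβw : β = T.loser
    · subst hβw
      rcases hleft_w with h1 | ⟨h1, h2⟩
      · refine ⟨T.loser, 0, ?_, h1⟩
        intro h0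
        rcases hc with ⟨hv, hw, ht, hb⟩ | ⟨hv, hw, hb, ht⟩
        · exact hβ (ht ▸ h0)
        · exact hlast (hw ▸ h0)
      · exact ⟨T.loser, 1, by rw [h1]; exact hlast, h2⟩
    · refine ⟨β, 0, fun h0 => hβ ?_, hleft_ne β hβw⟩
      rcases hc with ⟨hv, hw, ht, hb⟩ | ⟨hv, hw, hb, ht⟩
      · rw [ht, h0]
      · rw [ht]
        apply Fin.ext
        rw [trans_shiftAfter_val hvw hw, h0]
        simp
  intro k hk α β hβ heq
  obtain ⟨δ, s, hδ, hs⟩ := htarget β hβ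
  have hbase : T.rauzy.left α ∈ T.rauzy.base :=
    piece_subset_base h.rauzy_pos α (left_mem_piece h.rauzy_pos α)
  by_cases hα : T.rauzy.left α = T.left α
  · obtain ⟨k', hk', e⟩ := hit k _ hbase
    refine h.keane (s + k') (by omega) α δ hδ ?_
    rw [Function.iterate_add_apply, ← hα, ← e, heq, hs]
  · have hαw : α = T.loser := by
      by_contra h'
      exact hα (hleft_ne α h')
    subst hαw
    obtain ⟨-, h2⟩ := hleft_w.resolve_left hα
    obtain ⟨k, rfl⟩ : ∃ k0, k = k0 + 1 := ⟨k - 1, by omega⟩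
    obtain ⟨k', hk', e⟩ := hit k _ (map_mem_base h.rauzy_pos hbase)
    refine h.keane (s + (k' + 1)) (by omega) T.loser δ hδ ?_
    have hx := left_mem_piece h.rauzy_pos T.loser
    rw [Function.iterate_add_apply, Function.iterate_add_apply, Function.iterate_one, ← h2,
      (hw _ hx).2.1, ← (hw _ hx).2.2.2.1, ← e, ← Function.iterate_succ_apply, heq, hs]

/-! ### Special sums and the composition of induced maps -/

/-- The sums of `φ` over the orbits of `T` up to the return to the base of the induced map `T'`;
the special Birkhoff sums for a general induced map and with values in any monoid. -/
def inducedSum {M : Type*} [AddCommMonoid M] (T T' : IET 𝒜 m) (q : Matrix 𝒜 𝒜 ℕ) (φ : ℝ → M)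
    (x : ℝ) : M :=
  ∑ β, ((T'.piece β).indicator fun y => birkhoffSum T.map φ (∑ γ, q β γ) y) x

theorem sum_indicator_piece {M : Type*} [AddCommMonoid M] {T : IET 𝒜 m}
    (hpos : ∀ α, 0 < T.len α) {β : 𝒜} {x : ℝ} (hx : x ∈ T.piece β) (F : 𝒜 → ℝ → M) :
    ∑ β, (T.piece β).indicator (F β) x = F β x := by
  rw [Finset.sum_eq_single β]
  · exact Set.indicator_of_mem hx _
  · exact fun δ _ hδ => Set.indicator_of_notMem (fun h' => hδ (eq_of_mem_piece hpos h' hx)) _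
  · simp

theorem inducedSum_of_mem {M : Type*} [AddCommMonoid M] (T : IET 𝒜 m) {T' : IET 𝒜 m}
    (hpos : ∀ α, 0 < T'.len α) (q : Matrix 𝒜 𝒜 ℕ) (φ : ℝ → M) {β : 𝒜} {x : ℝ}
    (hx : x ∈ T'.piece β) :
    inducedSum T T' q φ x = birkhoffSum T.map φ (∑ γ, q β γ) x :=
  sum_indicator_piece hpos hx _

namespace IsInduced

variable {T T' T'' : IET 𝒜 m} {q q' : Matrix 𝒜 𝒜 ℕ}

/-- The first `J` steps of the orbit of `x` under the induced map, read as steps of `T`. -/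
theorem unfold_iterate (h : T.IsInduced T' q) (hpos : ∀ α, 0 < T'.len α) {x : ℝ} (J : ℕ)
    (hx : ∀ i < J, ∃ δ, T'.map^[i] x ∈ T'.piece δ) :
    T.map^[birkhoffSum T'.map (inducedSum T T' q fun _ => (1 : ℕ)) J x] x = T'.map^[J] x ∧
    (∀ {M : Type} [AddCommMonoid M] (φ : ℝ → M),
      birkhoffSum T.map φ (birkhoffSum T'.map (inducedSum T T' q fun _ => (1 : ℕ)) J x) x =
        birkhoffSum T'.map (inducedSum T T' q φ) J x) ∧
    ∀ l < birkhoffSum T'.map (inducedSum T T' q fun _ => (1 : ℕ)) J x, ∃ i < J, ∃ s δ,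
      T'.map^[i] x ∈ T'.piece δ ∧ s < ∑ γ, q δ γ ∧
      l = s + birkhoffSum T'.map (inducedSum T T' q fun _ => (1 : ℕ)) i x ∧
      T.map^[birkhoffSum T'.map (inducedSum T T' q fun _ => (1 : ℕ)) i x] x = T'.map^[i] x := by
  induction J with
  | zero => simp
  | succ J ih =>
    obtain ⟨h1, h2, h3⟩ := ih fun i hi => hx i (by omega)
    obtain ⟨δ, hδ⟩ := hx J (by omega)
    have hret : inducedSum T T' q (fun _ => (1 : ℕ)) (T'.map^[J] x) = ∑ γ, q δ γ := by
      rw [inducedSum_of_mem T hpos q _ hδ]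
      simp [birkhoffSum]
    rw [birkhoffSum_succ, hret]
    refine ⟨?_, ?_, ?_⟩
    · rw [add_comm, Function.iterate_add_apply, h1, Function.iterate_succ_apply',
        h.map_eq δ _ hδ]
    · intro M _ φ
      rw [birkhoffSum_add, h1, h2 φ, birkhoffSum_succ, inducedSum_of_mem T hpos q _ hδ]
    · intro l hl
      by_cases hl' : l < birkhoffSum T'.map (inducedSum T T' q fun _ => (1 : ℕ)) J x
      · obtain ⟨i, hi, r⟩ := h3 l hl'
        exact ⟨i, by omega, r⟩
      · exact ⟨J, by omega, l - birkhoffSum T'.map (inducedSum T T' q fun _ => (1 : ℕ)) J x, δ, hδ,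
          by omega, by omega, h1⟩

/-- Sums over a tower of functions constant on the intervals of the base map. -/
theorem birkhoffSum_const {R : Type*} [Semiring R] (h : T.IsInduced T' q) {β : 𝒜} {x : ℝ}
    (hx : x ∈ T'.piece β) (G : 𝒜 → R) :
    birkhoffSum T.map (fun y => ∑ δ, (T.piece δ).indicator (fun _ => G δ) y) (∑ γ, q β γ) x =
      ∑ δ, (q β δ : R) * G δ := by
  simp only [birkhoffSum]
  rw [Finset.sum_comm]
  refine Finset.sum_congr rfl fun δ _ => ?_
  rw [← h.visits β x hx δ, birkhoffSum, Nat.cast_sum, Finset.sum_mul]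
  refine Finset.sum_congr rfl fun i _ => ?_
  by_cases hi : T.map^[i] x ∈ T.piece δ <;> simp [hi]

theorem birkhoffSum_const_nat (h : T.IsInduced T' q) {β : 𝒜} {x : ℝ} (hx : x ∈ T'.piece β)
    (G : 𝒜 → ℕ) :
    birkhoffSum T.map (fun y => ∑ δ, (T.piece δ).indicator (fun _ => G δ) y) (∑ γ, q β γ) x =
      ∑ δ, q β δ * G δ := by
  simpa using h.birkhoffSum_const hx G

theorem height_mul (q q' : Matrix 𝒜 𝒜 ℕ) (β : 𝒜) :
    ∑ γ, (q' * q) β γ = ∑ δ, q' β δ * ∑ γ, q δ γ := by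
  simp only [Matrix.mul_apply, Finset.mul_sum]
  exact Finset.sum_comm

theorem exists_piece (h : T.IsInduced T' q) {β : 𝒜} {x : ℝ} (hx : x ∈ T'.piece β) :
    ∀ i < ∑ γ, q β γ, ∃ δ, T.map^[i] x ∈ T.piece δ := by
  intro i hi
  obtain ⟨γ, c, hc⟩ := h.floor β i hi
  exact ⟨γ, by rw [(hc x hx).1]; exact (hc x hx).2⟩

theorem height_comp (h' : T'.IsInduced T'' q')
    {β : 𝒜} {x : ℝ} (hx : x ∈ T''.piece β) :
    birkhoffSum T'.map (inducedSum T T' q fun _ => (1 : ℕ)) (∑ γ, q' β γ) x =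
      ∑ γ, (q' * q) β γ := by
  rw [height_mul, ← h'.birkhoffSum_const_nat hx]
  congr 1
  ext y
  simp [inducedSum, birkhoffSum]

/-- Inducing in two steps gives the same special sums as inducing at once. -/
theorem inducedSum_comp {M : Type} [AddCommMonoid M] (h : T.IsInduced T' q)
    (h' : T'.IsInduced T'' q') (hpos' : ∀ α, 0 < T'.len α) (hpos'' : ∀ α, 0 < T''.len α)
    (φ : ℝ → M) {β : 𝒜} {x : ℝ} (hx : x ∈ T''.piece β) :
    inducedSum T T'' (q' * q) φ x = inducedSum T' T'' q' (inducedSum T T' q φ) x := by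
  rw [inducedSum_of_mem T hpos'' _ _ hx, inducedSum_of_mem T' hpos'' _ _ hx,
    ← h'.height_comp (T := T) (q := q) hx]
  exact (h.unfold_iterate hpos' _ (h'.exists_piece hx)).2.1 φ

/-- An induced map of an induced map is induced, and the matrices multiply. -/
theorem comp (h : T.IsInduced T' q) (h' : T'.IsInduced T'' q') (hpos' : ∀ α, 0 < T'.len α)
    (hpos'' : ∀ α, 0 < T''.len α) : T.IsInduced T'' (q' * q) := by
  -- The number of steps of `T` made by `i` steps of `T'` is constant on the intervals of `T''`.
  have hconst : ∀ β x y, x ∈ T''.piece β → y ∈ T''.piece β → ∀ i ≤ ∑ γ, q' β γ,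
      birkhoffSum T'.map (inducedSum T T' q fun _ => (1 : ℕ)) i x =
        birkhoffSum T'.map (inducedSum T T' q fun _ => (1 : ℕ)) i y := by
    intro β x y hx hy i hi
    refine Finset.sum_congr rfl fun l hl => ?_
    obtain ⟨γ, c, hc⟩ := h'.floor β l ((Finset.mem_range.1 hl).trans_le hi)
    rw [(hc x hx).1, (hc y hy).1, inducedSum_of_mem T hpos' q _ (hc x hx).2,
      inducedSum_of_mem T hpos' q _ (hc y hy).2]
    simp [birkhoffSum]
  refine ⟨?_, ?_, ?_, ?_, ?_⟩
  · intro β l hl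
    have hx0 := left_mem_piece hpos'' β
    rw [← h'.height_comp (T := T) (q := q) hx0] at hl
    obtain ⟨i, hi, s, δ, hδ, hs, rfl, -⟩ :=
      (h.unfold_iterate hpos' _ (h'.exists_piece hx0)).2.2 l hl
    obtain ⟨γ, c, hc⟩ := h.floor δ s hs
    obtain ⟨δ', c', hc'⟩ := h'.floor β i hi
    have hδδ' : δ' = δ := by
      refine eq_of_mem_piece hpos' (hc' _ hx0).2 ?_
      rwa [← (hc' _ hx0).1]
    subst hδδ'
    refine ⟨γ, c' + c, fun x hx => ?_⟩
    have e := (h.unfold_iterate hpos' i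
      fun i' hi' => h'.exists_piece hx i' (hi'.trans hi)).1
    rw [hconst β _ x hx0 hx i hi.le, Function.iterate_add_apply, e, (hc' x hx).1, ← add_assoc]
    exact hc _ (hc' x hx).2
  · intro β β' l l' x x' hl hl' hx hx' heq
    rw [← h'.height_comp (T := T) (q := q) hx] at hl
    rw [← h'.height_comp (T := T) (q := q) hx'] at hl'
    obtain ⟨i, hi, s, δ, hδ, hs, rfl, e⟩ :=
      (h.unfold_iterate hpos' _ (h'.exists_piece hx)).2.2 l hl
    obtain ⟨i', hi', s', δ', hδ', hs', rfl, e'⟩ :=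
      (h.unfold_iterate hpos' _ (h'.exists_piece hx')).2.2 l' hl'
    rw [Function.iterate_add_apply, e, Function.iterate_add_apply, e'] at heq
    obtain ⟨rfl, rfl⟩ := h.disjoint _ _ _ _ _ _ hs hs' hδ hδ' heq
    obtain ⟨γ, c, hc⟩ := h.floor δ s hs
    rw [(hc _ hδ).1, (hc _ hδ').1, add_left_inj] at heq
    obtain ⟨rfl, rfl⟩ := h'.disjoint _ _ _ _ _ _ hi hi' hx hx' heq
    exact ⟨rfl, by rw [hconst β x x' hx hx' i hi.le]⟩
  · intro β x hx
    rw [h'.map_eq β x hx, ← h'.height_comp (T := T) (q := q) hx]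
    exact (h.unfold_iterate hpos' _ (h'.exists_piece hx)).1.symm
  · intro β x hx γ
    rw [← h'.height_comp (T := T) (q := q) hx,
      (h.unfold_iterate hpos' _ (h'.exists_piece hx)).2.1, Matrix.mul_apply,
      ← h'.birkhoffSum_const_nat hx]
    refine Finset.sum_congr rfl fun i hi => ?_
    obtain ⟨δ, hδ⟩ := h'.exists_piece hx i (Finset.mem_range.1 hi)
    rw [inducedSum_of_mem T hpos' q _ hδ, h.visits δ _ hδ γ]
    exact (sum_indicator_piece hpos' hδ fun δ _ => q δ γ).symm
  · intro γ
    simp only [h.len_eq γ, h'.len_eq, Matrix.mul_apply, Finset.mul_sum, Nat.cast_sum, Nat.cast_mul,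
      Finset.sum_mul]
    rw [Finset.sum_comm]
    refine Finset.sum_congr rfl fun β _ => Finset.sum_congr rfl fun δ _ => by ring

end IsInduced

/-! ### The iterates of the Rauzy–Veech induction -/

theorem IsKeane.iterate {T : IET 𝒜 m} (h : T.IsKeane) (N : ℕ) : (rauzy^[N] T).IsKeane := by
  induction N with
  | zero => exact h
  | succ N ih => rw [Function.iterate_succ_apply']; exact ih.isKeane_rauzy

theorem kzCocycle_add (T : IET 𝒜 m) (N N' : ℕ) :
    T.kzCocycle (N + N') = T.kzCocycle N * (rauzy^[N] T).kzCocycle N' := by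
  induction N' with
  | zero => simp [kzCocycle]
  | succ N' ih =>
    rw [← add_assoc, kzCocycle, ih, kzCocycle, mul_assoc, ← Function.iterate_add_apply,
      add_comm N' N]

theorem IsKeane.isInduced_iterate {T : IET 𝒜 m} (h : T.IsKeane) (N : ℕ) :
    T.IsInduced (rauzy^[N] T) (T.kzCocycle N).transpose := by
  induction N with
  | zero =>
    have hr : ∀ β : 𝒜, ∑ γ, ((1 : Matrix 𝒜 𝒜 ℕ).transpose) β γ = 1 := by
      intro β; simp [Matrix.one_apply]
    simp only [kzCocycle, Function.iterate_zero, id_eq]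
    refine ⟨?_, ?_, ?_, ?_, ?_⟩
    · intro β i hi
      rw [hr, Nat.lt_one_iff] at hi
      subst hi
      exact ⟨β, 0, fun x hx => by simpa using hx⟩
    · intro β β' i i' x x' hi hi' hx hx' heq
      rw [hr, Nat.lt_one_iff] at hi hi'
      subst hi hi'
      simp only [Function.iterate_zero, id_eq] at heq
      exact ⟨eq_of_mem_piece h.pos hx (heq ▸ hx'), rfl⟩
    · intro β x _
      rw [hr, Function.iterate_one]
    · intro β x hx γ
      rw [hr, birkhoffSum_one, Matrix.transpose_one, Matrix.one_apply]
      split_ifs with hβ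
      · subst hβ; exact Set.indicator_of_mem hx _
      · exact Set.indicator_of_notMem (fun h' => hβ (eq_of_mem_piece h.pos hx h')) _
    · intro γ
      simp [Matrix.one_apply]
  | succ N ih =>
    rw [kzCocycle, Matrix.transpose_mul, Function.iterate_succ_apply']
    exact ih.comp (h.iterate N).isInduced_rauzy (h.iterate N).pos (h.iterate N).rauzy_pos

theorem one_le_kzCocycle_diag (T : IET 𝒜 m) (N : ℕ) (α : 𝒜) : 1 ≤ T.kzCocycle N α α := by
  induction N with
  | zero => simp [kzCocycle]
  | succ N ih =>
    rw [kzCocycle, kzMatrix, mul_add, mul_one, Matrix.add_apply]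
    omega

theorem IsKeane.det_kzCocycle {T : IET 𝒜 m} (h : T.IsKeane) (N : ℕ) :
    ((T.kzCocycle N).map (Nat.cast : ℕ → ℝ)).det = 1 := by
  induction N with
  | zero => simp [kzCocycle]
  | succ N ih =>
    have h1 : ((rauzy^[N] T).kzMatrix).map (Nat.cast : ℕ → ℝ) =
        Matrix.transvection (rauzy^[N] T).winner (rauzy^[N] T).loser 1 := by
      ext i j
      simp [kzMatrix, Matrix.transvection, Matrix.one_apply, Matrix.single_apply]
    have h2 := Matrix.map_mul (f := Nat.castRingHom ℝ) (L := T.kzCocycle N)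
      (M := (rauzy^[N] T).kzMatrix)
    simp only [Nat.coe_castRingHom] at h2
    rw [kzCocycle, h2, Matrix.det_mul, ih, h1,
      Matrix.det_transvection_of_ne _ _ (h.iterate N).rauzy_cases.1, one_mul]

/-! ### Functions of one variable with polynomial singularities -/

/-- If `|f'|` is at most `A (z - l) ^ (-(1 + b))`, then the increments of `f` are bounded by those
of the primitive. -/
theorem abs_sub_le_of_deriv_le {f f' : ℝ → ℝ} {l x y A b : ℝ} (hb : 0 < b) (hlx : l < x)
    (hxy : x ≤ y) (hf : ∀ z ∈ Set.Icc x y, HasDerivAt f (f' z) z)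
    (hA : ∀ z ∈ Set.Icc x y, |f' z| ≤ A * (z - l) ^ (-(1 + b))) (hA0 : 0 ≤ A) :
    |f y - f x| ≤ A / b * (x - l) ^ (-b) := by
  have key : ∀ ⦃z⦄, z ∈ Set.Icc x y →
      ‖f z - f x‖ ≤ A / b * (x - l) ^ (-b) - A / b * (z - l) ^ (-b) := by
    refine image_norm_le_of_norm_deriv_right_le_deriv_boundary'
      (B' := fun z => A * (z - l) ^ (-(1 + b))) (f' := f') ?_ ?_ ?_ ?_ ?_ ?_
    · exact fun z hz => ((hf z hz).sub_const _).continuousAt.continuousWithinAt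
    · exact fun z hz => ((hf z ⟨hz.1, hz.2.le⟩).sub_const _).hasDerivWithinAt
    · simp
    · refine continuousOn_const.sub (continuousOn_const.mul ?_)
      refine ContinuousOn.rpow_const (by fun_prop) fun z hz => Or.inl ?_
      linarith [hz.1]
    · intro z hz
      have hz0 : z - l ≠ 0 := by linarith [hz.1]
      have h1 : HasDerivAt (fun z => (z - l) ^ (-b)) (1 * (-b) * (z - l) ^ (-b - 1)) z :=
        ((hasDerivAt_id z).sub_const l).rpow_const (Or.inl hz0)
      have h2 := (h1.const_mul (A / b)).const_sub (A / b * (x - l) ^ (-b))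
      refine (h2.congr_deriv ?_).hasDerivWithinAt
      have : -(1 + b) = -b - 1 := by ring
      rw [this]
      field_simp
    · exact fun z hz => hA z ⟨hz.1, hz.2.le⟩
  have h1 := key (Set.right_mem_Icc.2 hxy)
  rw [Real.norm_eq_abs] at h1
  have h2 : 0 ≤ A / b * (y - l) ^ (-b) :=
    mul_nonneg (div_nonneg hA0 hb.le) (Real.rpow_nonneg (by linarith) _)
  linarith

/-- The order `1 + a` is raised to `1 + b` with `b = (1 + a) / 2`, at the cost of a power of the
length: then `0 < b < 1` also for `a = 0`, where the primitive would be a logarithm, and the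
resulting bound is integrable. -/
theorem abs_sub_mid_le_left {f f' : ℝ → ℝ} {l r D a : ℝ} (ha0 : 0 ≤ a) (ha1 : a < 1)
    (hD : 0 ≤ D) (hf : ∀ z ∈ Set.Ioo l r, HasDerivAt f (f' z) z)
    (hf' : ∀ z ∈ Set.Ioo l r, |f' z| ≤ D * ((z - l) ^ (-(1 + a)) + (r - z) ^ (-(1 + a))))
    {x : ℝ} (hlx : l < x) (hx : x ≤ (l + r) / 2) :
    |f x - f ((l + r) / 2)| ≤
      2 * D * (r - l) ^ ((1 - a) / 2) / ((1 + a) / 2) * (x - l) ^ (-((1 + a) / 2)) := by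
  rw [abs_sub_comm]
  refine abs_sub_le_of_deriv_le (f' := f') (by linarith) hlx hx
    (fun z hz => hf z ⟨by linarith [hz.1], by linarith [hz.2]⟩) (fun z hz => ?_) ?_
  · have hz0 : 0 < z - l := by linarith [hz.1]
    have hz1 : z - l ≤ r - z := by linarith [hz.2]
    have h1 : (r - z) ^ (-(1 + a)) ≤ (z - l) ^ (-(1 + a)) :=
      Real.rpow_le_rpow_of_nonpos hz0 hz1 (by linarith)
    have h2 : (z - l) ^ (-(1 + a)) ≤ (r - l) ^ ((1 - a) / 2) * (z - l) ^ (-(1 + (1 + a) / 2)) := by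
      have h3 : (z - l) ^ (-(1 + a)) =
          (z - l) ^ ((1 - a) / 2) * (z - l) ^ (-(1 + (1 + a) / 2)) := by
        rw [← Real.rpow_add hz0]; congr 1; ring
      rw [h3]
      refine mul_le_mul_of_nonneg_right ?_ (Real.rpow_nonneg hz0.le _)
      exact Real.rpow_le_rpow hz0.le (by linarith) (by linarith)
    calc |f' z| ≤ D * ((z - l) ^ (-(1 + a)) + (r - z) ^ (-(1 + a))) :=
          hf' z ⟨by linarith, by linarith⟩
      _ ≤ D * (2 * ((r - l) ^ ((1 - a) / 2) * (z - l) ^ (-(1 + (1 + a) / 2)))) := by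
          gcongr; linarith
      _ = _ := by ring
  · have : 0 ≤ (r - l) ^ ((1 - a) / 2) := Real.rpow_nonneg (by linarith) _
    positivity

theorem abs_sub_mid_le {f f' : ℝ → ℝ} {l r D a : ℝ} (ha0 : 0 ≤ a) (ha1 : a < 1)
    (hD : 0 ≤ D) (hf : ∀ z ∈ Set.Ioo l r, HasDerivAt f (f' z) z)
    (hf' : ∀ z ∈ Set.Ioo l r, |f' z| ≤ D * ((z - l) ^ (-(1 + a)) + (r - z) ^ (-(1 + a))))
    {x : ℝ} (hx : x ∈ Set.Ioo l r) :
    |f x - f ((l + r) / 2)| ≤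
      2 * D * (r - l) ^ ((1 - a) / 2) / ((1 + a) / 2) *
        ((x - l) ^ (-((1 + a) / 2)) + (r - x) ^ (-((1 + a) / 2))) := by
  have hc : 0 ≤ 2 * D * (r - l) ^ ((1 - a) / 2) / ((1 + a) / 2) := by
    have : 0 ≤ (r - l) ^ ((1 - a) / 2) := Real.rpow_nonneg (by linarith [hx.1, hx.2]) _
    positivity
  have h1 : 0 ≤ (x - l) ^ (-((1 + a) / 2)) := Real.rpow_nonneg (by linarith [hx.1]) _
  have h2 : 0 ≤ (r - x) ^ (-((1 + a) / 2)) := Real.rpow_nonneg (by linarith [hx.2]) _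
  rcases le_total x ((l + r) / 2) with h | h
  · refine (abs_sub_mid_le_left ha0 ha1 hD hf hf' hx.1 h).trans ?_
    gcongr
    linarith
  · -- reflect the interval
    have hrefl : ∀ z ∈ Set.Ioo l r, l + r - z ∈ Set.Ioo l r :=
      fun z hz => ⟨by linarith [hz.2], by linarith [hz.1]⟩
    have := abs_sub_mid_le_left (f := fun z => f (l + r - z)) (f' := fun z => -f' (l + r - z))
      (x := l + r - x) (l := l) (r := r) ha0 ha1 hD
      (fun z hz => by
        simpa using (hf _ (hrefl z hz)).comp_const_sub (l + r) z)
      (fun z hz => by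
        rw [abs_neg]
        refine (hf' _ (hrefl z hz)).trans_eq ?_
        rw [show l + r - z - l = r - z by ring, show r - (l + r - z) = z - l by ring, add_comm])
      (hrefl x hx).1 (by linarith)
    have e1 : l + r - (l + r - x) = x := by ring
    have e2 : l + r - (l + r) / 2 = (l + r) / 2 := by ring
    have e3 : l + r - x - l = r - x := by ring
    simp only [e1, e2, e3] at this
    refine this.trans ?_
    gcongr
    linarith

/-- The constant in the `L¹` estimate of the oscillation. -/
def oscConst (a : ℝ) : ℝ := 8 / ((1 + a) / 2 * (1 - (1 + a) / 2))

theorem oscConst_pos {a : ℝ} (ha0 : 0 ≤ a) (ha1 : a < 1) : 0 < oscConst a :=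
  div_pos (by norm_num) (mul_pos (by linarith) (by linarith))

theorem integrableOn_Ioo_rpow {l r b : ℝ} (hlr : l ≤ r) (hb1 : b < 1) :
    IntegrableOn (fun x => (x - l) ^ (-b) + (r - x) ^ (-b)) (Set.Ioo l r) ∧
      ∫ x in Set.Ioo l r, ((x - l) ^ (-b) + (r - x) ^ (-b)) =
        2 * ((r - l) ^ (1 - b) / (1 - b)) := by
  have h1 : IntervalIntegrable (fun x : ℝ => (x - l) ^ (-b)) volume l r := by
    have := (intervalIntegral.intervalIntegrable_rpow' (a := 0) (b := r - l)
      (r := -b) (by linarith)).comp_sub_right l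
    simpa using this
  have h2 : IntervalIntegrable (fun x : ℝ => (r - x) ^ (-b)) volume l r := by
    have := (intervalIntegral.intervalIntegrable_rpow' (a := 0) (b := r - l)
      (r := -b) (by linarith)).comp_sub_left r
    simpa using this.symm
  have e1 : ∫ x in l..r, (x - l) ^ (-b) = (r - l) ^ (1 - b) / (1 - b) := by
    rw [intervalIntegral.integral_comp_sub_right (fun x => x ^ (-b)) l, sub_self,
      integral_rpow (Or.inl (by linarith)), Real.zero_rpow (by linarith)]
    rw [show -b + 1 = 1 - b by ring, sub_zero]
  have e2 : ∫ x in l..r, (r - x) ^ (-b) = (r - l) ^ (1 - b) / (1 - b) := by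
    rw [intervalIntegral.integral_comp_sub_left (fun x => x ^ (-b)) r, sub_self,
      integral_rpow (Or.inl (by linarith)), Real.zero_rpow (by linarith)]
    rw [show -b + 1 = 1 - b by ring, sub_zero]
  refine ⟨((intervalIntegrable_iff_integrableOn_Ioo_of_le hlr).1 (h1.add h2)), ?_⟩
  rw [← integral_Ioc_eq_integral_Ioo, ← intervalIntegral.integral_of_le hlr,
    intervalIntegral.integral_add h1 h2, e1, e2]
  ring

/-- A function whose derivative has singularities of order at most `1 + a < 2` at the end points
is integrable, and its mean oscillation is controlled by the size of the derivative. -/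
theorem integrable_and_oscillation {f f' : ℝ → ℝ} {l r D a : ℝ} (ha0 : 0 ≤ a) (ha1 : a < 1)
    (hlr : l < r) (hD : 0 ≤ D) (hf : ∀ z ∈ Set.Ioo l r, HasDerivAt f (f' z) z)
    (hf' : ∀ z ∈ Set.Ioo l r, |f' z| ≤ D * ((z - l) ^ (-(1 + a)) + (r - z) ^ (-(1 + a)))) :
    IntegrableOn f (Set.Ico l r) ∧
      ∫ x in Set.Ico l r, |f x - ⨍ y in Set.Ico l r, f y| ≤ oscConst a * D * (r - l) ^ (1 - a) := by
  set b := (1 + a) / 2 with hb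
  have hb0 : 0 < b := by linarith
  have hb1 : b < 1 := by linarith
  set K := 2 * D * (r - l) ^ ((1 - a) / 2) / b with hK
  obtain ⟨hint, hval⟩ := integrableOn_Ioo_rpow hlr.le hb1
  set c := f ((l + r) / 2) with hc
  have hbound : ∀ x ∈ Set.Ioo l r, |f x - c| ≤ K * ((x - l) ^ (-b) + (r - x) ^ (-b)) :=
    fun x hx => abs_sub_mid_le ha0 ha1 hD hf hf' hx
  have hcont : ContinuousOn f (Set.Ioo l r) := fun z hz => (hf z hz).continuousAt.continuousWithinAt
  have hint1 : IntegrableOn (fun x => f x - c) (Set.Ioo l r) := by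
    refine (hint.const_mul K).mono' ((hcont.sub continuousOn_const).aestronglyMeasurable
      measurableSet_Ioo) ?_
    exact (ae_restrict_iff' measurableSet_Ioo).2 (Eventually.of_forall hbound)
  have hconst : ∀ s : ℝ, IntegrableOn (fun _ : ℝ => s) (Set.Ioo l r) := fun s =>
    integrableOn_const measure_Ioo_lt_top.ne
  have hint2 : IntegrableOn f (Set.Ioo l r) := by
    have := hint1.add (hconst c)
    refine this.congr_fun (fun x _ => by simp) measurableSet_Ioo
  refine ⟨by rwa [integrableOn_Ico_iff_integrableOn_Ioo], ?_⟩
  have hvol : volume.real (Set.Ico l r) = r - l := by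
    rw [Measure.real, Real.volume_Ico, ENNReal.toReal_ofReal (by linarith)]
  rw [setAverage_eq, hvol]
  simp only [integral_Ico_eq_integral_Ioo, smul_eq_mul]
  set M := (r - l)⁻¹ * ∫ x in Set.Ioo l r, f x with hM
  have hpos : 0 < r - l := by linarith
  -- the mean differs from the value at the middle point by at most the oscillation there
  have hosc : ∫ x in Set.Ioo l r, |f x - c| ≤ K * (2 * ((r - l) ^ (1 - b) / (1 - b))) := by
    rw [← hval, ← integral_const_mul]
    exact setIntegral_mono_on hint1.abs (hint.const_mul K) measurableSet_Ioo hbound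
  have hvol' : volume.real (Set.Ioo l r) = r - l := by
    rw [Measure.real, Real.volume_Ioo, ENNReal.toReal_ofReal (by linarith)]
  have hMc : (r - l) * |c - M| ≤ ∫ x in Set.Ioo l r, |f x - c| := by
    have e : (r - l) * (M - c) = ∫ x in Set.Ioo l r, (f x - c) := by
      rw [integral_sub hint2 (hconst c), setIntegral_const, hvol', hM, smul_eq_mul]
      field_simp
    rw [abs_sub_comm]
    calc (r - l) * |M - c| = |∫ x in Set.Ioo l r, (f x - c)| := by
          rw [← e, abs_mul, abs_of_pos hpos]
      _ ≤ _ := abs_integral_le_integral_abs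
  have hfinal : ∫ x in Set.Ioo l r, |f x - M| ≤ 2 * ∫ x in Set.Ioo l r, |f x - c| := by
    calc ∫ x in Set.Ioo l r, |f x - M| ≤ ∫ x in Set.Ioo l r, (|f x - c| + |c - M|) := by
          refine setIntegral_mono_on (hint2.sub (hconst M)).abs (hint1.abs.add (hconst _))
            measurableSet_Ioo fun x _ => abs_sub_le _ _ _
      _ = (∫ x in Set.Ioo l r, |f x - c|) + (r - l) * |c - M| := by
          rw [integral_add hint1.abs (hconst _), setIntegral_const, hvol', smul_eq_mul]
      _ ≤ _ := by linarith
  refine hfinal.trans ((mul_le_mul_of_nonneg_left hosc zero_le_two).trans_eq ?_)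
  have hsplit : (r - l) ^ (1 - a) = (r - l) ^ ((1 - a) / 2) * (r - l) ^ (1 - b) := by
    rw [← Real.rpow_add hpos]; congr 1; rw [hb]; ring
  have h1b : 1 - b ≠ 0 := by linarith
  rw [hsplit, oscConst, ← hb, hK]
  field_simp
  ring

/-! ### Sums of negative powers over separated points -/

/-- For points at distance at least `t` from the singularity and at mutual distance at
least `J`, the sum of the powers is controlled by the closest point and a partial sum of the zeta
series. -/
theorem sum_rpow_separated_le {ι : Type*} (s : Finset ι) (u : ι → ℝ) {t J R a : ℝ} (ha : 0 ≤ a)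
    (ht : 0 < t) (hJ : 0 < J) (hut : ∀ i ∈ s, t ≤ u i) (huR : ∀ i ∈ s, u i ≤ R)
    (hsep : ∀ i ∈ s, ∀ i' ∈ s, i ≠ i' → J ≤ |u i - u i'|) :
    ∑ i ∈ s, u i ^ (-(1 + a)) ≤ t ^ (-(1 + a)) +
      J ^ (-(1 + a)) * ∑ n ∈ Finset.range ⌊R / J⌋₊, ((n : ℝ) + 1) ^ (-(1 + a)) := by
  classical
  set F : ℕ → ℝ := fun n => if n = 0 then t ^ (-(1 + a)) else J ^ (-(1 + a)) * (n : ℝ) ^ (-(1 + a))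
  have hF0 : ∀ n, 0 ≤ F n := by
    intro n
    simp only [F]
    split_ifs <;> positivity
  have hle : ∀ i ∈ s, u i ^ (-(1 + a)) ≤ F ⌊u i / J⌋₊ := by
    intro i hi
    have hui : 0 < u i := ht.trans_le (hut i hi)
    simp only [F]
    split_ifs with h0
    · exact Real.rpow_le_rpow_of_nonpos ht (hut i hi) (by linarith)
    · have hn : (0 : ℝ) < ⌊u i / J⌋₊ := Nat.cast_pos.2 (Nat.pos_of_ne_zero h0)
      rw [← Real.mul_rpow hJ.le hn.le]
      refine Real.rpow_le_rpow_of_nonpos (by positivity) ?_ (by linarith)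
      have := Nat.floor_le (div_nonneg hui.le hJ.le)
      rw [le_div_iff₀ hJ] at this
      linarith
  have hinj : Set.InjOn (fun i => ⌊u i / J⌋₊) s := by
    intro i hi i' hi' heq
    by_contra hne
    have h1 := hsep i hi i' hi' hne
    have hpos : ∀ i ∈ s, 0 ≤ u i / J := fun i hi => div_nonneg (ht.le.trans (hut i hi)) hJ.le
    have a1 := Nat.floor_le (hpos i hi)
    have a2 := Nat.lt_floor_add_one (u i / J)
    have b1 := Nat.floor_le (hpos i' hi')
    have b2 := Nat.lt_floor_add_one (u i' / J)
    simp only at heq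
    rw [heq] at a1 a2
    have h2 : |u i / J - u i' / J| < 1 := abs_lt.2 ⟨by linarith, by linarith⟩
    rw [← sub_div, abs_div, abs_of_pos hJ, div_lt_one hJ] at h2
    linarith
  calc ∑ i ∈ s, u i ^ (-(1 + a)) ≤ ∑ i ∈ s, F ⌊u i / J⌋₊ := Finset.sum_le_sum hle
    _ = ∑ n ∈ s.image fun i => ⌊u i / J⌋₊, F n := (Finset.sum_image hinj).symm
    _ ≤ ∑ n ∈ Finset.range (⌊R / J⌋₊ + 1), F n := by
        refine Finset.sum_le_sum_of_subset_of_nonneg ?_ fun n _ _ => hF0 n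
        intro n hn
        obtain ⟨i, hi, rfl⟩ := Finset.mem_image.1 hn
        rw [Finset.mem_range, Nat.lt_succ_iff]
        exact Nat.floor_le_floor (by have := huR i hi; gcongr)
    _ = _ := by
        rw [Finset.sum_range_succ', add_comm, Finset.mul_sum]
        simp [F]

/-- A bound for the partial sums of `∑ n ^ (-(1 + a))` up to `X`, uniform in `X` if `a > 0` and
logarithmic if `a = 0`. -/
def zetaConst (a : ℝ) : ℝ := if 0 < a then ∑' n : ℕ, ((n : ℝ) + 1) ^ (-(1 + a)) else 1

theorem summable_zeta {a : ℝ} (ha : 0 < a) : Summable fun n : ℕ => ((n : ℝ) + 1) ^ (-(1 + a)) := by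
  have h := (summable_nat_add_iff 1).2 (Real.summable_nat_rpow (p := -(1 + a)).2 (by linarith))
  simpa using h

theorem one_le_zetaConst (a : ℝ) : 1 ≤ zetaConst a := by
  rw [zetaConst]
  split_ifs with h
  · have := (summable_zeta h).le_tsum 0 fun n _ => by positivity
    simpa using this
  · exact le_rfl

theorem sum_zeta_le {a X : ℝ} (ha : 0 ≤ a) (hX : 1 ≤ X) :
    ∑ n ∈ Finset.range ⌊X⌋₊, ((n : ℝ) + 1) ^ (-(1 + a)) ≤
      zetaConst a * (if 0 < a then 1 else 1 + Real.log X) := by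
  rw [zetaConst]
  split_ifs with h
  · rw [mul_one]
    exact (summable_zeta h).sum_le_tsum _ fun n _ => by positivity
  · obtain rfl : a = 0 := le_antisymm (not_lt.1 h) ha
    have h1 := harmonic_le_one_add_log ⌊X⌋₊
    have h2 : ((harmonic ⌊X⌋₊ : ℚ) : ℝ) =
        ∑ n ∈ Finset.range ⌊X⌋₊, ((n : ℝ) + 1) ^ (-(1 + (0 : ℝ))) := by
      rw [harmonic]
      push_cast
      refine Finset.sum_congr rfl fun n _ => ?_
      rw [add_zero, Real.rpow_neg_one]
    rw [one_mul, ← h2]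
    refine h1.trans ?_
    have h3 : (0 : ℝ) < ⌊X⌋₊ := Nat.cast_pos.2 (Nat.floor_pos.2 hX)
    gcongr
    exact Nat.floor_le (by linarith)

/-! ### Singularities of special Birkhoff sums -/

/-- `f` is differentiable inside the exchanged intervals, and its derivative has there singularities
of order at most `1 + a` at the end points, with constant `D`. -/
def HasSingularDeriv (T : IET 𝒜 m) (a D : ℝ) (f : ℝ → ℝ) : Prop :=
  ∀ γ, ∀ z ∈ Set.Ioo (T.left γ) (T.right γ), DifferentiableAt ℝ f z ∧
    |deriv f z| ≤ D * ((z - T.left γ) ^ (-(1 + a)) + (T.right γ - z) ^ (-(1 + a)))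

theorem hasSingularDeriv_of_mem_Pa {T : IET 𝒜 m} {a : ℝ} (φ : T.Pa a) :
    T.HasSingularDeriv a (T.pa a φ).toReal φ := by
  obtain ⟨φ, h1, h2, h3, h4⟩ := φ
  intro γ z hz
  refine ⟨differentiableAt_of_dom h2 (T.mem_dom hz.1 hz.2), ?_⟩
  have hl : 0 < z - T.left γ := by linarith [hz.1]
  have hr : 0 < T.right γ - z := by linarith [hz.2]
  have hl' := Real.rpow_pos_of_pos hl (1 + a)
  have hr' := Real.rpow_pos_of_pos hr (1 + a)
  have hp : 0 ≤ (T.pa a φ).toReal := ENNReal.toReal_nonneg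
  rcases le_or_gt z (T.mid γ) with hm | hm
  · have : ENNReal.ofReal |deriv φ z * (z - T.left γ) ^ (1 + a)| ≤ T.pa a φ :=
      le_iSup_of_le γ (le_sup_of_le_left (le_iSup₂_of_le z ⟨hz.1, hm⟩ le_rfl))
    rw [ENNReal.ofReal_le_iff_le_toReal h3, abs_mul, abs_of_pos hl', ← le_div_iff₀ hl'] at this
    refine this.trans ?_
    rw [div_eq_mul_inv, ← Real.rpow_neg hl.le]
    gcongr
    have := Real.rpow_nonneg hr.le (-(1 + a))
    linarith
  · have : ENNReal.ofReal |deriv φ z * (T.right γ - z) ^ (1 + a)| ≤ T.pa a φ :=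
      le_iSup_of_le γ (le_sup_of_le_right (le_iSup₂_of_le z ⟨hm.le, hz.2⟩ le_rfl))
    rw [ENNReal.ofReal_le_iff_le_toReal h3, abs_mul, abs_of_pos hr', ← le_div_iff₀ hr'] at this
    refine this.trans ?_
    rw [div_eq_mul_inv, ← Real.rpow_neg hr.le]
    gcongr
    have := Real.rpow_nonneg hl.le (-(1 + a))
    linarith

theorem len_le_total {T : IET 𝒜 m} (h : ∀ α, 0 < T.len α) (α : 𝒜) : T.len α ≤ T.total :=
  Finset.single_le_sum (fun i _ => (h i).le) (Finset.mem_univ α)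

namespace IsInduced

variable {T T' : IET 𝒜 m} {q : Matrix 𝒜 𝒜 ℕ}

/-- The floors of the tower over one interval: the translations, the intervals in which the
floors lie, and the separation of the floors. -/
theorem exists_floors (h : T.IsInduced T' q) (hpos' : ∀ α, 0 < T'.len α) (β : 𝒜) :
    ∃ (γ : ℕ → 𝒜) (c : ℕ → ℝ), ∀ i < ∑ δ, q β δ,
      (∀ x ∈ T'.piece β, T.map^[i] x = x + c i ∧ x + c i ∈ T.piece (γ i)) ∧
      T.left (γ i) ≤ T'.left β + c i ∧ T'.right β + c i ≤ T.right (γ i) ∧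
      ∀ i' < ∑ δ, q β δ, i ≠ i' → T'.len β ≤ |c i - c i'| := by
  have : Nonempty 𝒜 := ⟨β⟩
  choose! γ c hc using h.floor β
  have hlt : T'.left β < T'.right β := by rw [right_eq]; linarith [hpos' β]
  refine ⟨γ, c, fun i hi => ⟨hc i hi, ?_⟩⟩
  have hsub : Set.Ico (T'.left β + c i) (T'.right β + c i) ⊆
      Set.Ico (T.left (γ i)) (T.right (γ i)) := by
    intro y hy
    have := (hc i hi (y - c i) ⟨by linarith [hy.1], by linarith [hy.2]⟩).2
    rwa [sub_add_cancel] at this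
  obtain ⟨h1, h2⟩ := (Set.Ico_subset_Ico_iff (by linarith)).1 hsub
  refine ⟨h1, h2, ?_⟩
  -- two floors at a distance less than the length would intersect
  have hsep : ∀ i < ∑ δ, q β δ, ∀ i' < ∑ δ, q β δ, c i ≤ c i' → c i' - c i < T'.len β → i = i' := by
    intro i hi i' hi' hle hlen
    have hx : T'.left β + (c i' - c i) ∈ T'.piece β :=
      mem_piece.2 ⟨by linarith, by linarith⟩
    have hx' := left_mem_piece hpos' β
    refine (h.disjoint β β i i' _ _ hi hi' hx hx' ?_).2
    rw [(hc i hi _ hx).1, (hc i' hi' _ hx').1]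
    ring
  intro i' hi' hne
  by_contra hcon
  rw [not_le] at hcon
  rcases le_total (c i) (c i') with hle | hle
  · rw [abs_sub_comm, abs_of_nonneg (by linarith)] at hcon
    exact hne (hsep i hi i' hi' hle hcon)
  · rw [abs_of_nonneg (by linarith)] at hcon
    exact hne (hsep i' hi' i hi hle hcon).symm

/-- Special sums of a function with singularities have singularities of the same order. Floors lying
in one interval are at mutual distance at least the length of the base, so that all but the one
closest to an end point contribute at most a partial sum of `∑ n ^ (-(1 + a))`. -/
theorem hasSingularDeriv (h : T.IsInduced T' q) (hpos : ∀ α, 0 < T.len α)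
    (hpos' : ∀ α, 0 < T'.len α) {a D Z : ℝ}
    (ha0 : 0 ≤ a) (hD : 0 ≤ D) (hZ : ∀ β, ∑ n ∈ Finset.range ⌊T.total / T'.len β⌋₊,
      ((n : ℝ) + 1) ^ (-(1 + a)) ≤ Z) {φ : ℝ → ℝ} (hφ : T.HasSingularDeriv a D φ) :
    T'.HasSingularDeriv a (Fintype.card 𝒜 * (1 + Z) * D) (inducedSum T T' q φ) := by
  intro β z hz
  obtain ⟨γ, c, hfl⟩ := h.exists_floors hpos' β
  set t := z - T'.left β with ht
  set t' := T'.right β - z with ht'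
  have ht0 : 0 < t := by linarith [hz.1]
  have ht0' : 0 < t' := by linarith [hz.2]
  have hJ := hpos' β
  have hJr : T'.right β = T'.left β + T'.len β := right_eq _ _
  have hmem : ∀ i ∈ Finset.range (∑ δ, q β δ),
      z + c i ∈ Set.Ioo (T.left (γ i)) (T.right (γ i)) := by
    intro i hi
    obtain ⟨_, h1, h2, _⟩ := hfl i (Finset.mem_range.1 hi)
    exact ⟨by linarith [hz.1], by linarith [hz.2]⟩
  have heq : inducedSum T T' q φ =ᶠ[𝓝 z]
      fun y => ∑ i ∈ Finset.range (∑ δ, q β δ), φ (y + c i) := by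
    filter_upwards [isOpen_Ioo.mem_nhds hz] with y hy
    have hy' : y ∈ T'.piece β := ⟨hy.1.le, hy.2⟩
    rw [inducedSum_of_mem T hpos' q φ hy']
    refine Finset.sum_congr rfl fun i hi => ?_
    rw [((hfl i (Finset.mem_range.1 hi)).1 y hy').1]
  have hderiv : HasDerivAt (inducedSum T T' q φ)
      (∑ i ∈ Finset.range (∑ δ, q β δ), deriv φ (z + c i)) z := by
    refine HasDerivAt.congr_of_eventuallyEq ?_ heq
    refine HasDerivAt.fun_sum fun i hi => ?_
    exact ((hφ (γ i) _ (hmem i hi)).1.hasDerivAt).comp_add_const z (c i)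
  refine ⟨hderiv.differentiableAt, ?_⟩
  rw [hderiv.deriv]
  set P := t ^ (-(1 + a)) + t' ^ (-(1 + a)) with hP
  have hJt : T'.len β ^ (-(1 + a)) ≤ t ^ (-(1 + a)) :=
    Real.rpow_le_rpow_of_nonpos ht0 (by linarith) (by linarith)
  have hJt' : T'.len β ^ (-(1 + a)) ≤ t' ^ (-(1 + a)) :=
    Real.rpow_le_rpow_of_nonpos ht0' (by linarith) (by linarith)
  have hJ0 : 0 ≤ T'.len β ^ (-(1 + a)) := Real.rpow_nonneg hJ.le _
  have hZ0 : 0 ≤ Z := le_trans (Finset.sum_nonneg fun n _ => by positivity) (hZ β)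
  -- the floors contained in one interval of `T`
  have hfiber : ∀ δ, ∑ i ∈ (Finset.range (∑ δ, q β δ)).filter (fun i => γ i = δ),
      ((z + c i - T.left (γ i)) ^ (-(1 + a)) + (T.right (γ i) - (z + c i)) ^ (-(1 + a))) ≤
        (1 + Z) * P := by
    intro δ
    have hle := len_le_total hpos δ
    have hrl := right_eq T δ
    have h1 := sum_rpow_separated_le ((Finset.range (∑ δ, q β δ)).filter (fun i => γ i = δ))
      (fun i => z + c i - T.left (γ i)) (t := t) (J := T'.len β) (R := T.total) ha0 ht0 hJ
      (by
        intro i hi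
        obtain ⟨_, h1, h2, _⟩ := hfl i (Finset.mem_range.1 (Finset.mem_filter.1 hi).1)
        linarith)
      (by
        intro i hi
        have h1 := hmem i (Finset.mem_filter.1 hi).1
        rw [(Finset.mem_filter.1 hi).2] at h1 ⊢
        linarith [h1.2])
      (by
        intro i hi i' hi' hne
        obtain ⟨_, _, _, h3⟩ := hfl i (Finset.mem_range.1 (Finset.mem_filter.1 hi).1)
        have := h3 i' (Finset.mem_range.1 (Finset.mem_filter.1 hi').1) hne
        rw [(Finset.mem_filter.1 hi).2, (Finset.mem_filter.1 hi').2]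
        rwa [show z + c i - T.left δ - (z + c i' - T.left δ) = c i - c i' by ring])
    have h2 := sum_rpow_separated_le ((Finset.range (∑ δ, q β δ)).filter (fun i => γ i = δ))
      (fun i => T.right (γ i) - (z + c i)) (t := t') (J := T'.len β) (R := T.total) ha0 ht0' hJ
      (by
        intro i hi
        obtain ⟨_, h1, h2, _⟩ := hfl i (Finset.mem_range.1 (Finset.mem_filter.1 hi).1)
        linarith)
      (by
        intro i hi
        have h1 := hmem i (Finset.mem_filter.1 hi).1
        rw [(Finset.mem_filter.1 hi).2] at h1 ⊢
        linarith [h1.1])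
      (by
        intro i hi i' hi' hne
        obtain ⟨_, _, _, h3⟩ := hfl i (Finset.mem_range.1 (Finset.mem_filter.1 hi).1)
        have := h3 i' (Finset.mem_range.1 (Finset.mem_filter.1 hi').1) hne
        rw [(Finset.mem_filter.1 hi).2, (Finset.mem_filter.1 hi').2]
        rwa [show T.right δ - (z + c i) - (T.right δ - (z + c i')) = -(c i - c i') by ring,
          abs_neg])
    rw [Finset.sum_add_distrib]
    have h3 := mul_le_mul_of_nonneg_left (hZ β) hJ0
    have h4 := mul_le_mul_of_nonneg_right hJt hZ0
    have h5 := mul_le_mul_of_nonneg_right hJt' hZ0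
    calc _ ≤ _ := add_le_add h1 h2
      _ ≤ _ := by rw [hP]; linarith
  calc |∑ i ∈ Finset.range (∑ δ, q β δ), deriv φ (z + c i)|
      ≤ ∑ i ∈ Finset.range (∑ δ, q β δ), |deriv φ (z + c i)| := Finset.abs_sum_le_sum_abs _ _
    _ ≤ ∑ i ∈ Finset.range (∑ δ, q β δ), D * ((z + c i - T.left (γ i)) ^ (-(1 + a)) +
          (T.right (γ i) - (z + c i)) ^ (-(1 + a))) :=
        Finset.sum_le_sum fun i hi => (hφ (γ i) _ (hmem i hi)).2
    _ = D * ∑ δ, ∑ i ∈ (Finset.range (∑ δ, q β δ)).filter (fun i => γ i = δ),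
          ((z + c i - T.left (γ i)) ^ (-(1 + a)) +
            (T.right (γ i) - (z + c i)) ^ (-(1 + a))) := by
        rw [← Finset.mul_sum, Finset.sum_fiberwise]
    _ ≤ D * ∑ _δ : 𝒜, (1 + Z) * P := by
        gcongr with δ
        exact hfiber δ
    _ = _ := by
        rw [Finset.sum_const, Finset.card_univ, nsmul_eq_mul]; ring

end IsInduced

/-! ### Mean values of special Birkhoff sums -/

theorem HasSingularDeriv.integrableOn_and_oscillation {T : IET 𝒜 m} (hpos : ∀ α, 0 < T.len α)
    {a D : ℝ} (ha0 : 0 ≤ a) (ha1 : a < 1) (hD : 0 ≤ D) {f : ℝ → ℝ}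
    (hf : T.HasSingularDeriv a D f) (γ : 𝒜) :
    IntegrableOn f (T.piece γ) ∧
      ∫ x in T.piece γ, |f x - T.mean f γ| ≤ oscConst a * D * T.len γ ^ (1 - a) := by
  have hr := right_eq T γ
  have := integrable_and_oscillation (f := f) (f' := deriv f) (l := T.left γ) (r := T.right γ)
    ha0 ha1 (by linarith [hpos γ]) hD (fun z hz => (hf γ z hz).1.hasDerivAt)
    (fun z hz => (hf γ z hz).2)
  rwa [hr, add_sub_cancel_left, ← hr] at this

theorem mean_eq {T : IET 𝒜 m} (hpos : ∀ α, 0 < T.len α) (f : ℝ → ℝ) (γ : 𝒜) :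
    T.mean f γ = (T.len γ)⁻¹ * ∫ x in T.piece γ, f x := by
  have hvol : volume.real (T.piece γ) = T.len γ := by
    rw [piece, right_eq, Measure.real, Real.volume_Ico, add_sub_cancel_left,
      ENNReal.toReal_ofReal (hpos γ).le]
  rw [mean, setAverage_eq, hvol, smul_eq_mul]

theorem base_eq_iUnion {T : IET 𝒜 m} (hpos : ∀ α, 0 < T.len α) : T.base = ⋃ α, T.piece α := by
  ext x
  rw [Set.mem_iUnion]
  exact ⟨exists_mem_piece, fun ⟨α, hα⟩ => piece_subset_base hpos α hα⟩

theorem measurableSet_piece (T : IET 𝒜 m) (α : 𝒜) : MeasurableSet (T.piece α) := measurableSet_Ico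

theorem setIntegral_base {T : IET 𝒜 m} (hpos : ∀ α, 0 < T.len α) {F : ℝ → ℝ}
    (hF : ∀ α, IntegrableOn F (T.piece α)) :
    IntegrableOn F T.base ∧ ∫ x in T.base, F x = ∑ α, ∫ x in T.piece α, F x := by
  rw [base_eq_iUnion hpos]
  refine ⟨integrableOn_finite_iUnion.2 hF, ?_⟩
  refine integral_iUnion_fintype (fun α => T.measurableSet_piece α) ?_ hF
  intro α β hne
  exact Set.disjoint_left.2 fun x hα hβ => hne (eq_of_mem_piece hpos hα hβ)

namespace IsInduced

variable {T T' : IET 𝒜 m} {q : Matrix 𝒜 𝒜 ℕ}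

/-- Mean values of a special Birkhoff sum: up to the mean oscillation of `f` they are obtained
from those of `f` by the cocycle. -/
theorem abs_mean_inducedSum_sub_le (h : T.IsInduced T' q) (hpos : ∀ α, 0 < T.len α)
    (hpos' : ∀ α, 0 < T'.len α) {f : ℝ → ℝ} (hf : ∀ γ, IntegrableOn f (T.piece γ)) (β : 𝒜) :
    IntegrableOn (inducedSum T T' q f) (T'.piece β) ∧
    |T'.mean (inducedSum T T' q f) β - ∑ γ, q β γ * T.mean f γ| ≤
      (T'.len β)⁻¹ * ∑ γ, ∫ x in T.piece γ, |f x - T.mean f γ| := by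
  obtain ⟨γ, c, hfl⟩ := h.exists_floors hpos' β
  set n := ∑ δ, q β δ with hn
  set J : ℕ → Set ℝ := fun i => Set.Ico (T'.left β + c i) (T'.right β + c i) with hJ
  have hJsub : ∀ i < n, J i ⊆ T.piece (γ i) := by
    intro i hi x hx
    obtain ⟨_, h1, h2, _⟩ := hfl i hi
    exact ⟨h1.trans hx.1, hx.2.trans_le h2⟩
  have hlr : T'.left β ≤ T'.right β := by rw [right_eq]; linarith [hpos' β]
  have htrans : ∀ (g : ℝ → ℝ) i, ∫ x in T'.piece β, g (x + c i) = ∫ x in J i, g x := by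
    intro g i
    rw [piece, hJ, integral_Ico_eq_integral_Ioc, integral_Ico_eq_integral_Ioc,
      ← intervalIntegral.integral_of_le hlr, ← intervalIntegral.integral_of_le (by linarith),
      intervalIntegral.integral_comp_add_right]
  have htransI : ∀ (g : ℝ → ℝ) i, IntegrableOn g (J i) →
      IntegrableOn (fun x => g (x + c i)) (T'.piece β) := by
    intro g i hg
    rw [hJ, integrableOn_Ico_iff_integrableOn_Ioo,
      ← intervalIntegrable_iff_integrableOn_Ioo_of_le (by linarith)] at hg
    rw [piece, integrableOn_Ico_iff_integrableOn_Ioo,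
      ← intervalIntegrable_iff_integrableOn_Ioo_of_le hlr]
    have := hg.comp_add_right (c i)
    simpa using this
  set m₀ : ℝ → ℝ := fun y => ∑ δ, (T.piece δ).indicator (fun _ => T.mean f δ) y with hm₀
  have hm₀_mem : ∀ δ y, y ∈ T.piece δ → m₀ y = T.mean f δ := fun δ y hy =>
    sum_indicator_piece hpos hy fun δ _ => T.mean f δ
  set G : ℝ → ℝ := fun y => f y - m₀ y with hG
  have hm₀I : ∀ δ, IntegrableOn m₀ (T.piece δ) := by
    intro δ
    have : IntegrableOn (fun _ : ℝ => T.mean f δ) (T.piece δ) :=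
      integrableOn_const measure_Ico_lt_top.ne
    exact this.congr_fun (fun y hy => (hm₀_mem δ y hy).symm) (T.measurableSet_piece δ)
  have hGI : ∀ δ, IntegrableOn G (T.piece δ) := fun δ => (hf δ).sub (hm₀I δ)
  have hsum : ∀ (g : ℝ → ℝ), ∀ x ∈ T'.piece β, inducedSum T T' q g x =
      ∑ i ∈ Finset.range n, g (x + c i) := by
    intro g x hx
    rw [inducedSum_of_mem T hpos' q g hx]
    refine Finset.sum_congr rfl fun i hi => ?_
    rw [((hfl i (Finset.mem_range.1 hi)).1 x hx).1]
  have hsumI : ∀ (g : ℝ → ℝ), (∀ δ, IntegrableOn g (T.piece δ)) →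
      IntegrableOn (inducedSum T T' q g) (T'.piece β) ∧
        ∫ x in T'.piece β, inducedSum T T' q g x = ∑ i ∈ Finset.range n, ∫ x in J i, g x := by
    intro g hg
    have h1 : ∀ i ∈ Finset.range n, IntegrableOn (fun x => g (x + c i)) (T'.piece β) :=
      fun i hi => htransI g i ((hg (γ i)).mono_set (hJsub i (Finset.mem_range.1 hi)))
    refine ⟨?_, ?_⟩
    · exact IntegrableOn.congr_fun (integrable_finsetSum _ h1)
        (fun x hx => (hsum g x hx).symm) (T'.measurableSet_piece β)
    · rw [setIntegral_congr_fun (T'.measurableSet_piece β) (hsum g),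
        integral_finsetSum _ h1]
      exact Finset.sum_congr rfl fun i _ => htrans g i
  refine ⟨(hsumI f hf).1, ?_⟩
  have hmean : T'.mean (inducedSum T T' q f) β - ∑ γ, q β γ * T.mean f γ =
      (T'.len β)⁻¹ * ∑ i ∈ Finset.range n, ∫ x in J i, G x := by
    have e1 : ∑ i ∈ Finset.range n, ∫ x in J i, G x =
        (∑ i ∈ Finset.range n, ∫ x in J i, f x) - ∑ i ∈ Finset.range n, ∫ x in J i, m₀ x := by
      rw [← Finset.sum_sub_distrib]
      refine Finset.sum_congr rfl fun i hi => ?_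
      have hs := hJsub i (Finset.mem_range.1 hi)
      exact integral_sub ((hf _).mono_set hs) ((hm₀I _).mono_set hs)
    have e2 : ∑ i ∈ Finset.range n, ∫ x in J i, m₀ x =
        T'.len β * ∑ γ, q β γ * T.mean f γ := by
      rw [← (hsumI m₀ hm₀I).2, setIntegral_congr_fun (g := fun _ => ∑ γ, q β γ * T.mean f γ)
        (T'.measurableSet_piece β), setIntegral_const]
      · rw [piece, right_eq, Measure.real, Real.volume_Ico, add_sub_cancel_left,
          ENNReal.toReal_ofReal (hpos' β).le, smul_eq_mul]
      · intro x hx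
        simp only
        rw [inducedSum_of_mem T hpos' q m₀ hx]
        exact h.birkhoffSum_const hx _
    rw [mean_eq hpos', (hsumI f hf).2, e1, e2]
    have := (hpos' β).ne'
    field_simp
  rw [hmean, abs_mul, abs_of_pos (inv_pos.2 (hpos' β))]
  refine mul_le_mul_of_nonneg_left ?_ (inv_pos.2 (hpos' β)).le
  obtain ⟨hbI, hb⟩ := setIntegral_base hpos (F := fun x => |G x|) fun δ => (hGI δ).abs
  have hdisj : Set.PairwiseDisjoint (↑(Finset.range n)) J := by
    intro i hi i' hi' hne
    refine Set.disjoint_left.2 fun x hx hx' => ?_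
    have hi1 := Finset.mem_range.1 hi
    have hi1' := Finset.mem_range.1 hi'
    have h1 := (hfl i hi1).2.2.2 i' hi1' hne
    have hr := right_eq T' β
    have h2 : |c i - c i'| < T'.len β :=
      abs_lt.2 ⟨by linarith [hx.1, hx.2, hx'.1, hx'.2], by linarith [hx.1, hx.2, hx'.1, hx'.2]⟩
    linarith
  calc |∑ i ∈ Finset.range n, ∫ x in J i, G x|
      ≤ ∑ i ∈ Finset.range n, |∫ x in J i, G x| := Finset.abs_sum_le_sum_abs _ _
    _ ≤ ∑ i ∈ Finset.range n, ∫ x in J i, |G x| :=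
        Finset.sum_le_sum fun i _ => abs_integral_le_integral_abs
    _ = ∫ x in ⋃ i ∈ Finset.range n, J i, |G x| :=
        (integral_biUnion_finset _ (fun i _ => measurableSet_Ico) hdisj fun i hi =>
          ((hGI (γ i)).mono_set (hJsub i (Finset.mem_range.1 hi))).abs).symm
    _ ≤ ∫ x in T.base, |G x| := by
        refine setIntegral_mono_set hbI (Eventually.of_forall fun x => abs_nonneg _) ?_
        refine (Set.iUnion₂_subset fun i hi => ?_).eventuallyLE
        exact (hJsub i (Finset.mem_range.1 hi)).trans (piece_subset_base hpos _)
    _ = ∑ γ, ∫ x in T.piece γ, |f x - T.mean f γ| := by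
        rw [hb]
        refine Finset.sum_congr rfl fun δ _ => ?_
        refine setIntegral_congr_fun (T.measurableSet_piece δ) fun x hx => ?_
        simp only [hG, hm₀_mem δ x hx]

end IsInduced

/-! ### The cocycle in the original time -/

theorem nonempty_alphabet (T : IET 𝒜 m) : Nonempty 𝒜 := ⟨T.top.symm 0⟩

theorem IsKeane.acc {T : IET 𝒜 m} (h : T.IsKeane) (n : ℕ → ℕ) (k : ℕ) : (T.acc n k).IsKeane :=
  h.iterate _

theorem acc_acc (T : IET 𝒜 m) {N N' : ℕ} (hN : N ≤ N') :
    rauzy^[N' - N] (T.acc id N) = T.acc id N' := by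
  rw [acc, acc, id, id, ← Function.iterate_add_apply, Nat.sub_add_cancel hN]

theorem IsKeane.isInduced_acc {T : IET 𝒜 m} (h : T.IsKeane) {N N' : ℕ} (hN : N ≤ N') :
    (T.acc id N).IsInduced (T.acc id N') (T.QN id N N') := by
  have := (h.acc id N).isInduced_iterate (N' - N)
  rwa [acc_acc T hN] at this

theorem QN_mul (T : IET 𝒜 m) {N N' N'' : ℕ} (h : N ≤ N') (h' : N' ≤ N'') :
    T.QN id N N'' = T.QN id N' N'' * T.QN id N N' := by
  have h1 : N'' - N = (N' - N) + (N'' - N') := by omega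
  simp only [QN, id]
  rw [h1, kzCocycle_add, Matrix.transpose_mul, acc_acc T h]

theorem Q_mul (T : IET 𝒜 m) {N N' N'' : ℕ} (h : N ≤ N') (h' : N' ≤ N'') :
    T.Q id N N'' = T.Q id N' N'' * T.Q id N N' := by
  have := Matrix.map_mul (f := Nat.castRingHom ℝ) (L := T.QN id N' N'') (M := T.QN id N N')
  rw [Q, QN_mul T h h']
  simpa [Q] using this

theorem Q_self (T : IET 𝒜 m) (N : ℕ) : T.Q id N N = 1 := by
  simp [Q, QN, kzCocycle]

theorem Q_nonneg (T : IET 𝒜 m) (n : ℕ → ℕ) (k l : ℕ) (α β : 𝒜) : 0 ≤ T.Q n k l α β :=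
  Nat.cast_nonneg _

theorem one_le_Q_diag (T : IET 𝒜 m) (n : ℕ → ℕ) (k l : ℕ) (α : 𝒜) : 1 ≤ T.Q n k l α α := by
  have := one_le_kzCocycle_diag (T.acc n k) (n l - n k) α
  simpa [Q, QN] using this

theorem IsKeane.det_Q {T : IET 𝒜 m} (h : T.IsKeane) (n : ℕ → ℕ) (k l : ℕ) :
    (T.Q n k l).det = 1 := by
  rw [← (h.acc n k).det_kzCocycle (n l - n k), ← Matrix.det_transpose]
  rfl

theorem IsKeane.isUnit_det_Q {T : IET 𝒜 m} (h : T.IsKeane) (n : ℕ → ℕ) (k l : ℕ) :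
    IsUnit (T.Q n k l).det := by
  rw [h.det_Q]; exact isUnit_one

theorem one_le_mnorm_Q (T : IET 𝒜 m) (n : ℕ → ℕ) (k l : ℕ) : 1 ≤ mnorm (T.Q n k l) := by
  obtain ⟨α⟩ := T.nonempty_alphabet
  refine (T.one_le_Q_diag n k l α).trans (le_trans ?_ (row_sum_le_mnorm _ α))
  exact (le_abs_self _).trans
    (Finset.single_le_sum (f := fun β => |T.Q n k l α β|) (fun _ _ => abs_nonneg _)
      (Finset.mem_univ α))

theorem mnorm_Q_mono_right (T : IET 𝒜 m) {N N' N'' : ℕ} (h : N ≤ N') (h' : N' ≤ N'') :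
    mnorm (T.Q id N N') ≤ mnorm (T.Q id N N'') := by
  have := T.nonempty_alphabet
  refine mnorm_mono (T.Q_nonneg id N N') fun α β => ?_
  rw [T.Q_mul h h', Matrix.mul_apply]
  refine le_trans ?_ (Finset.single_le_sum (f := fun γ => T.Q id N' N'' α γ * T.Q id N N' γ β)
    (fun γ _ => mul_nonneg (T.Q_nonneg _ _ _ _ _) (T.Q_nonneg _ _ _ _ _)) (Finset.mem_univ α))
  exact le_mul_of_one_le_left (T.Q_nonneg _ _ _ _ _) (T.one_le_Q_diag _ _ _ _)

theorem mnorm_Q_mono_left (T : IET 𝒜 m) {N N' N'' : ℕ} (h : N ≤ N') (h' : N' ≤ N'') :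
    mnorm (T.Q id N' N'') ≤ mnorm (T.Q id N N'') := by
  have := T.nonempty_alphabet
  refine mnorm_mono (T.Q_nonneg id N' N'') fun α β => ?_
  rw [T.Q_mul h h', Matrix.mul_apply]
  refine le_trans ?_ (Finset.single_le_sum (f := fun γ => T.Q id N' N'' α γ * T.Q id N N' γ β)
    (fun γ _ => mul_nonneg (T.Q_nonneg _ _ _ _ _) (T.Q_nonneg _ _ _ _ _)) (Finset.mem_univ β))
  exact le_mul_of_one_le_right (T.Q_nonneg _ _ _ _ _) (T.one_le_Q_diag _ _ _ _)

theorem total_pos {T : IET 𝒜 m} (h : ∀ α, 0 < T.len α) : 0 < T.total := by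
  obtain ⟨α⟩ := T.nonempty_alphabet
  exact (h α).trans_le (len_le_total h α)

/-- The intervals shrink at most by the norm of the cocycle. -/
theorem IsKeane.total_le {T : IET 𝒜 m} (h : T.IsKeane) {N N' : ℕ} (hN : N ≤ N') :
    (T.acc id N).total ≤ mnorm (T.Q id N N') * (T.acc id N').total := by
  rw [total, Finset.sum_congr rfl fun γ _ => (h.isInduced_acc hN).len_eq γ, Finset.sum_comm, total,
    Finset.mul_sum]
  refine Finset.sum_le_sum fun β _ => ?_
  rw [← Finset.sum_mul]
  refine mul_le_mul_of_nonneg_right ?_ ((h.acc id N').pos β).le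
  refine le_trans (Finset.sum_le_sum fun γ _ => le_abs_self _) (row_sum_le_mnorm (T.Q id N N') β)

/-! ### Mean values of the special Birkhoff sums along the induction -/

/-- The mean values of the special Birkhoff sums for the first return to the interval of
the `N`-th step of the induction. -/
def specialMean (T : IET 𝒜 m) (N : ℕ) (φ : ℝ → ℝ) : 𝒜 → ℝ :=
  (T.acc id N).mean (T.special id N φ)

theorem special_eq (T : IET 𝒜 m) (N : ℕ) (φ : ℝ → ℝ) :
    T.special id N φ = inducedSum T (T.acc id N) (T.QN id 0 N) φ := rfl

/-- Along a sequence of times starting at `0`, the special Birkhoff sums are those at the times of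
the original induction. -/
theorem special_eq_of_zero (T : IET 𝒜 m) {n : ℕ → ℕ} (hn : n 0 = 0) (k : ℕ) (φ : ℝ → ℝ) :
    T.special n k φ = T.special id (n k) φ := by
  have hr : T.returnTime n k = T.returnTime id (n k) := by
    ext α
    simp only [returnTime, QN, acc, hn, id]
  ext x
  simp only [special, hr]
  rfl

theorem specialMeanNorm_eq (T : IET 𝒜 m) {n : ℕ → ℕ} (hn : n 0 = 0) (k : ℕ) (φ : ℝ → ℝ) :
    T.specialMeanNorm n k φ = vnorm (T.specialMean (n k) φ) := by
  rw [specialMeanNorm, specialMean, special_eq_of_zero T hn]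
  rfl

theorem mean_congr {T : IET 𝒜 m} {f f' : ℝ → ℝ} (h : ∀ α, ∀ x ∈ T.piece α, f x = f' x) :
    T.mean f = T.mean f' := by
  ext α
  exact setAverage_congr_fun (T.measurableSet_piece α) (Eventually.of_forall (h α))

/-- The mean oscillation of the special Birkhoff sums of a function with singularities. On a
balanced interval of length comparable to `‖Q‖⁻¹` the singularities contribute `‖Q‖ ^ a`, and for
`a = 0` the partial sums of the harmonic series contribute `1 + log ‖Q‖`. -/
theorem IsKeane.special_oscillation {T : IET 𝒜 m} (h : T.IsKeane) {a : ℝ} (ha0 : 0 ≤ a)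
    (ha1 : a < 1) {κ : ℝ} (hκ : 1 ≤ κ) {N : ℕ}
    (hN : ∀ α, (T.acc id N).total / (T.acc id N).len α ≤ κ) (φ : T.Pa a) (γ : 𝒜) :
    IntegrableOn (T.special id N φ) ((T.acc id N).piece γ) ∧
      ∫ x in (T.acc id N).piece γ, |T.special id N φ x - T.specialMean N φ γ| ≤
        oscConst a * (Fintype.card 𝒜 * (2 * zetaConst a * (1 + Real.log κ)) * T.total ^ (-a)) *
          (bracketPow (mnorm (T.Q id 0 N)) a * (T.pa a φ).toReal) * (T.acc id N).total := by
  set M := mnorm (T.Q id 0 N) with hM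
  have hM1 : 1 ≤ M := T.one_le_mnorm_Q id 0 N
  set p := (T.pa a φ).toReal with hp
  have hp0 : 0 ≤ p := ENNReal.toReal_nonneg
  have hpos' := (h.acc id N).pos
  have htot := total_pos h.pos
  have htot' := total_pos hpos'
  have htle : T.total ≤ M * (T.acc id N).total := h.total_le (Nat.zero_le N)
  set L : ℝ := if 0 < a then 1 else 1 + Real.log (κ * M) with hL
  have hX1 : 1 ≤ κ * M := one_le_mul_of_one_le_of_one_le hκ hM1
  have hL1 : 1 ≤ L := by
    rw [hL]; split_ifs
    · exact le_rfl
    · linarith [Real.log_nonneg hX1]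
  have hζ := one_le_zetaConst a
  have hlogκ := Real.log_nonneg hκ
  have hZ : ∀ β, ∑ n ∈ Finset.range ⌊T.total / (T.acc id N).len β⌋₊,
      ((n : ℝ) + 1) ^ (-(1 + a)) ≤ zetaConst a * L := by
    intro β
    refine le_trans ?_ (sum_zeta_le ha0 hX1)
    refine Finset.sum_le_sum_of_subset_of_nonneg ?_ fun n _ _ => by positivity
    refine Finset.range_subset_range.2 (Nat.floor_le_floor ?_)
    have h1 := hN β
    rw [div_le_iff₀ (hpos' β)] at h1 ⊢
    have := mul_le_mul_of_nonneg_left h1 (by linarith : 0 ≤ M)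
    linarith
  have hD : 0 ≤ Fintype.card 𝒜 * (1 + zetaConst a * L) * p := by positivity
  have hsing := (h.isInduced_acc (Nat.zero_le N)).hasSingularDeriv h.pos hpos' ha0 hp0 hZ
    (hasSingularDeriv_of_mem_Pa φ)
  obtain ⟨hint, hosc⟩ := hsing.integrableOn_and_oscillation hpos' ha0 ha1 hD γ
  refine ⟨hint, hosc.trans ?_⟩
  have hoscpos := oscConst_pos ha0 ha1
  have hlen : (T.acc id N).len γ ^ (1 - a) ≤ (T.acc id N).total ^ (1 - a) :=
    Real.rpow_le_rpow (hpos' γ).le (len_le_total hpos' γ) (by linarith)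
  have hpow : (T.acc id N).total ^ (1 - a) ≤
      T.total ^ (-a) * M ^ a * (T.acc id N).total := by
    rw [sub_eq_add_neg, Real.rpow_add htot', Real.rpow_one, mul_comm]
    gcongr
    calc (T.acc id N).total ^ (-a) ≤ (T.total / M) ^ (-a) :=
          Real.rpow_le_rpow_of_nonpos (by positivity)
            (by rw [div_le_iff₀ (by linarith)]; linarith) (by linarith)
      _ = T.total ^ (-a) * M ^ a := by
          rw [Real.div_rpow htot.le (by linarith), Real.rpow_neg (by linarith : 0 ≤ M),
            div_inv_eq_mul]
  have hbr : L * M ^ a ≤ (1 + Real.log κ) * bracketPow M a := by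
    rw [hL, bracketPow]
    split_ifs with h0
    · exact mul_le_mul_of_nonneg_right (by linarith) (by positivity)
    · obtain rfl : a = 0 := le_antisymm (not_lt.1 h0) ha0
      have := Real.log_nonneg hM1
      rw [Real.rpow_zero, mul_one, Real.log_mul (by linarith) (by linarith)]
      nlinarith
  have hone : 1 + zetaConst a * L ≤ 2 * zetaConst a * L := by
    nlinarith [one_le_mul_of_one_le_of_one_le hζ hL1]
  have hcard : (0 : ℝ) ≤ Fintype.card 𝒜 := Nat.cast_nonneg _
  calc oscConst a * (Fintype.card 𝒜 * (1 + zetaConst a * L) * p) * (T.acc id N).len γ ^ (1 - a)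
      ≤ oscConst a * (Fintype.card 𝒜 * (2 * zetaConst a * L) * p) *
          (T.total ^ (-a) * M ^ a * (T.acc id N).total) := by
        have := Real.rpow_nonneg (hpos' γ).le (1 - a)
        gcongr
        exact hlen.trans hpow
    _ = oscConst a * (Fintype.card 𝒜 * (2 * zetaConst a)) * p * T.total ^ (-a) *
          (T.acc id N).total * (L * M ^ a) := by ring
    _ ≤ oscConst a * (Fintype.card 𝒜 * (2 * zetaConst a)) * p * T.total ^ (-a) *
          (T.acc id N).total * ((1 + Real.log κ) * bracketPow M a) := by
        gcongr
    _ = _ := by ring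

/-- The mean values of the special Birkhoff sums follow the cocycle up to an error controlled
by the singularities. -/
theorem IsKeane.exists_specialMean_error {T : IET 𝒜 m} (h : T.IsKeane) {a : ℝ} (ha0 : 0 ≤ a)
    (ha1 : a < 1) {κ κ' : ℝ} (hκ : 1 ≤ κ) (hκ' : 1 ≤ κ') :
    ∃ C : ℝ, 0 ≤ C ∧ ∀ N N' : ℕ, N ≤ N' →
      (∀ α, (T.acc id N).total / (T.acc id N).len α ≤ κ) →
      (∀ α, (T.acc id N').total / (T.acc id N').len α ≤ κ') → ∀ φ : T.Pa a,
      vnorm (T.specialMean N' φ - (T.Q id N N').mulVec (T.specialMean N φ)) ≤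
        C * mnorm (T.Q id N N') * bracketPow (mnorm (T.Q id 0 N)) a * (T.pa a φ).toReal := by
  set A := oscConst a * (Fintype.card 𝒜 * (2 * zetaConst a * (1 + Real.log κ)) * T.total ^ (-a))
    with hA
  have hA0 : 0 ≤ A := by
    have h1 := oscConst_pos ha0 ha1
    have h2 := one_le_zetaConst a
    have h3 := Real.log_nonneg hκ
    have h4 := (total_pos h.pos).le
    positivity
  refine ⟨Fintype.card 𝒜 * κ' * (Fintype.card 𝒜 * A), by positivity, ?_⟩
  intro N N' hNN hN hN' φ
  set B := bracketPow (mnorm (T.Q id 0 N)) a * (T.pa a φ).toReal with hB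
  have hB0 : 0 ≤ B := mul_nonneg (bracketPow_nonneg (T.one_le_mnorm_Q id 0 N)) ENNReal.toReal_nonneg
  have hpos := (h.acc id N).pos
  have hpos' := (h.acc id N').pos
  have hosc := fun γ => h.special_oscillation ha0 ha1 hκ hN φ γ
  have hind := h.isInduced_acc hNN
  have hmean : T.specialMean N' φ = (T.acc id N').mean
      (inducedSum (T.acc id N) (T.acc id N') (T.QN id N N') (T.special id N φ)) := by
    refine mean_congr fun α x hx => ?_
    rw [special_eq, special_eq, T.QN_mul (Nat.zero_le N) hNN]
    exact (h.isInduced_acc (Nat.zero_le N)).inducedSum_comp hind hpos hpos' _ hx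
  have hcoord : ∀ β, |(T.specialMean N' φ - (T.Q id N N').mulVec (T.specialMean N φ)) β| ≤
      κ' * (Fintype.card 𝒜 * A) * mnorm (T.Q id N N') * B := by
    intro β
    have h1 := (hind.abs_mean_inducedSum_sub_le hpos hpos' (fun γ => (hosc γ).1) β).2
    have h2 : ∑ γ, ∫ x in (T.acc id N).piece γ,
        |T.special id N φ x - (T.acc id N).mean (T.special id N φ) γ| ≤
        Fintype.card 𝒜 * (A * B * (T.acc id N).total) := by
      calc _ ≤ ∑ _γ : 𝒜, A * B * (T.acc id N).total := Finset.sum_le_sum fun γ _ => (hosc γ).2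
        _ = _ := by rw [Finset.sum_const, Finset.card_univ, nsmul_eq_mul]
    have h3 : ((T.acc id N').len β)⁻¹ * (T.acc id N).total ≤ κ' * mnorm (T.Q id N N') := by
      have h4 := h.total_le hNN
      have h5 := hN' β
      have hm : 0 ≤ mnorm (T.Q id N N') := mnorm_nonneg _
      calc ((T.acc id N').len β)⁻¹ * (T.acc id N).total
          ≤ ((T.acc id N').len β)⁻¹ * (mnorm (T.Q id N N') * (T.acc id N').total) := by
            have := inv_pos.2 (hpos' β)
            gcongr
        _ = mnorm (T.Q id N N') * ((T.acc id N').total / (T.acc id N').len β) := by ring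
        _ ≤ _ := by rw [mul_comm κ']; gcongr
    rw [hmean]
    calc _ ≤ _ := h1
      _ ≤ ((T.acc id N').len β)⁻¹ * (Fintype.card 𝒜 * (A * B * (T.acc id N).total)) := by
          have := inv_pos.2 (hpos' β)
          gcongr
      _ = (((T.acc id N').len β)⁻¹ * (T.acc id N).total) * (Fintype.card 𝒜 * (A * B)) := by ring
      _ ≤ (κ' * mnorm (T.Q id N N')) * (Fintype.card 𝒜 * (A * B)) := by gcongr
      _ = _ := by ring
  calc vnorm (T.specialMean N' φ - (T.Q id N N').mulVec (T.specialMean N φ))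
      ≤ ∑ _β : 𝒜, κ' * (Fintype.card 𝒜 * A) * mnorm (T.Q id N N') * B :=
        Finset.sum_le_sum fun β _ => hcoord β
    _ = _ := by rw [Finset.sum_const, Finset.card_univ, nsmul_eq_mul, hB]; ring

/-! ### Linearity in the function -/

theorem IsKeane.integrableOn_special {T : IET 𝒜 m} (h : T.IsKeane) {a : ℝ} (ha0 : 0 ≤ a)
    (ha1 : a < 1) (N : ℕ) (φ : T.Pa a) (γ : 𝒜) :
    IntegrableOn (T.special id N φ) ((T.acc id N).piece γ) := by
  have hpos' := (h.acc id N).pos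
  have htot' := total_pos hpos'
  refine (h.special_oscillation ha0 ha1
    (κ := 1 + ∑ α, (T.acc id N).total / (T.acc id N).len α) ?_ ?_ φ γ).1
  · have : 0 ≤ ∑ α, (T.acc id N).total / (T.acc id N).len α :=
      Finset.sum_nonneg fun α _ => div_nonneg htot'.le (hpos' α).le
    linarith
  · intro α
    have := Finset.single_le_sum (f := fun α => (T.acc id N).total / (T.acc id N).len α)
      (fun α _ => div_nonneg htot'.le (hpos' α).le) (Finset.mem_univ α)
    linarith

theorem IsKeane.specialMean_add {T : IET 𝒜 m} (h : T.IsKeane) {a : ℝ} (ha0 : 0 ≤ a)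
    (ha1 : a < 1) (N : ℕ) (φ ψ : T.Pa a) :
    T.specialMean N (φ + ψ : T.Pa a) = T.specialMean N φ + T.specialMean N ψ := by
  have hpos' := (h.acc id N).pos
  have hadd : T.special id N (φ + ψ : T.Pa a) = T.special id N φ + T.special id N ψ := by
    ext x
    simp only [special, Pi.add_apply, ← Finset.sum_add_distrib]
    refine Finset.sum_congr rfl fun β _ => ?_
    by_cases hx : x ∈ (T.acc id N).piece β <;> simp [hx, Finset.sum_add_distrib]
  ext γ
  rw [specialMean, specialMean, specialMean, Pi.add_apply, mean_eq hpos', mean_eq hpos',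
    mean_eq hpos', hadd, ← mul_add,
    ← integral_add (h.integrableOn_special ha0 ha1 N φ γ) (h.integrableOn_special ha0 ha1 N ψ γ)]
  rfl

theorem IsKeane.specialMean_smul {T : IET 𝒜 m} (h : T.IsKeane) {a : ℝ}
    (N : ℕ) (s : ℝ) (φ : T.Pa a) :
    T.specialMean N (s • φ : T.Pa a) = s • T.specialMean N φ := by
  have hpos' := (h.acc id N).pos
  have hsmul : T.special id N (s • φ : T.Pa a) = s • T.special id N φ := by
    ext x
    simp only [special, Submodule.coe_smul, Pi.smul_apply, smul_eq_mul, ← Finset.mul_sum,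
      Set.indicator_const_mul]
  ext γ
  rw [specialMean, specialMean, Pi.smul_apply, mean_eq hpos', mean_eq hpos', hsmul]
  simp only [Pi.smul_apply, smul_eq_mul, integral_const_mul]
  ring

/-- The mean values of `φ` itself are bounded by its `L¹` norm. -/
theorem IsKeane.exists_vnorm_specialMean_zero_le {T : IET 𝒜 m} (h : T.IsKeane) :
    ∃ C : ℝ, 0 ≤ C ∧ ∀ a, 0 ≤ a → a < 1 → ∀ φ : T.Pa a,
      vnorm (T.specialMean 0 φ) ≤ C * (T.normL1 φ / T.total) := by
  refine ⟨(∑ α, (T.len α)⁻¹) * T.total, mul_nonneg (Finset.sum_nonneg fun α _ =>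
    (inv_pos.2 (h.pos α)).le) (total_pos h.pos).le, fun a ha0 ha1 φ => ?_⟩
  have hpos := h.pos
  have hmem : ∀ α, ∀ x ∈ T.piece α, T.special id 0 φ x = φ.1 x := by
    intro α x hx
    rw [special_eq, inducedSum_of_mem T (T' := T.acc id 0) hpos _ _ hx]
    have : ∑ γ, T.QN id 0 0 α γ = 1 := by simp [QN, kzCocycle, Matrix.one_apply]
    rw [this, birkhoffSum_one]
  have hI : ∀ α, IntegrableOn φ.1 (T.piece α) := fun α =>
    (h.integrableOn_special ha0 ha1 0 φ α).congr_fun (hmem α) (T.measurableSet_piece α)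
  obtain ⟨hb, -⟩ := setIntegral_base hpos (F := fun x => |φ.1 x|) fun α => (hI α).abs
  have hcoord : ∀ α, |T.specialMean 0 φ α| ≤ (T.len α)⁻¹ * T.normL1 φ := by
    intro α
    have e : T.specialMean 0 φ = T.mean φ.1 := mean_congr hmem
    rw [e, mean_eq hpos, abs_mul, abs_of_pos (inv_pos.2 (hpos α))]
    refine mul_le_mul_of_nonneg_left (abs_integral_le_integral_abs.trans ?_)
      (inv_pos.2 (hpos α)).le
    exact setIntegral_mono_set hb (Eventually.of_forall fun x => abs_nonneg _)
      (piece_subset_base hpos α).eventuallyLE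
  calc vnorm (T.specialMean 0 φ) ≤ ∑ α, (T.len α)⁻¹ * T.normL1 φ :=
        Finset.sum_le_sum fun α _ => hcoord α
    _ = _ := by
        have := (total_pos hpos).ne'
        rw [← Finset.sum_mul]
        field_simp

/-! ### Transported mean values and their projections -/

/-- The mean values of the special Birkhoff sums transported back by the cocycle to time zero. -/
def pulledMean (T : IET 𝒜 m) (N : ℕ) (φ : ℝ → ℝ) : 𝒜 → ℝ :=
  (T.Q id 0 N)⁻¹.mulVec (T.specialMean N φ)

theorem IsKeane.Q_mulVec_pulledMean {T : IET 𝒜 m} (h : T.IsKeane) (N : ℕ) (φ : ℝ → ℝ) :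
    (T.Q id 0 N).mulVec (T.pulledMean N φ) = T.specialMean N φ := by
  rw [pulledMean, Matrix.mulVec_mulVec, Matrix.mul_nonsing_inv _ (h.isUnit_det_Q id 0 N),
    Matrix.one_mulVec]

theorem pulledMean_zero (T : IET 𝒜 m) (φ : ℝ → ℝ) : T.pulledMean 0 φ = T.specialMean 0 φ := by
  rw [pulledMean, Q_self, inv_one, Matrix.one_mulVec]

theorem IsKeane.Q_mulVec_pulledMean_sub {T : IET 𝒜 m} (h : T.IsKeane) {N N' : ℕ} (hN : N ≤ N')
    (φ : ℝ → ℝ) : (T.Q id 0 N').mulVec (T.pulledMean N' φ - T.pulledMean N φ) =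
      T.specialMean N' φ - (T.Q id N N').mulVec (T.specialMean N φ) := by
  rw [Matrix.mulVec_sub, h.Q_mulVec_pulledMean, T.Q_mul (Nat.zero_le N) hN, ← Matrix.mulVec_mulVec,
    h.Q_mulVec_pulledMean]

theorem Q_zero_eq (T : IET 𝒜 m) {n : ℕ → ℕ} (hn : n 0 = 0) (k : ℕ) :
    T.Q n 0 k = T.Q id 0 (n k) := by
  simp only [Q, QN, acc, hn, id]

/-- An accelerating sequence along which the exchanges are balanced and the images of the
complementary subspaces `F` and `W` make an angle bounded below by `c ‖Q(k)‖ ^ (-τ)`. -/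
structure SplitsAlong (T : IET 𝒜 m) (n : ℕ → ℕ) (F W : Submodule ℝ (𝒜 → ℝ)) (τ c κ : ℝ) :
    Prop where
  acc : IsAccelerating n
  compl : IsCompl F W
  c_pos : 0 < c
  one_le : 1 ≤ κ
  balanced : ∀ k α, (T.acc id (n k)).total / (T.acc id (n k)).len α ≤ κ
  angle : ∀ k, c * mnorm (T.Q id 0 (n k)) ^ (-τ) ≤ sinAngle (T.push n k F) (T.push n k W)

theorem IsFDCAcceleration.splitsAlong {T : IET 𝒜 m} {g : ℕ} {lam : ℕ → ℝ}
    {E : ℤ → Submodule ℝ (𝒜 → ℝ)} {τ : ℝ} {n : ℕ → ℕ} {U : ℕ → Submodule ℝ (𝒜 → ℝ)}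
    (h : T.IsFDCAcceleration g lam E τ n U) {j : ℕ} (hj2 : 2 ≤ j) (hjg : j ≤ g + 1) :
    ∃ c κ, T.SplitsAlong n (E j) (U j) τ c κ := by
  obtain ⟨c, C, κ, hc, -, hκ, r, -, -, -, -, -, -, hbal, hang⟩ := h.bounds
  refine ⟨c, κ, h.accelerating, h.complementary.compl j (by omega) hjg, hc, hκ, hbal,
    fun k => ?_⟩
  rw [← T.Q_zero_eq h.accelerating.2]
  exact hang k j hj2 hjg

/-- The general term of the series controlling the convergence of the transported mean values
along an acceleration. It is the term of the Diophantine series `K` at `k = 0`, except that the norm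
of `Z(k + 1)` is squared: this pays for comparing all times between `n k` and `n (k + 1)`. -/
def gapTerm (T : IET 𝒜 m) (n : ℕ → ℕ) (W : Submodule ℝ (𝒜 → ℝ)) (a τ : ℝ) (k : ℕ) : ℝ :=
  T.normQInv n W 0 (k + 1) * mnorm (T.Q n k (k + 1)) ^ 2 *
    bracketPow (mnorm (T.Q n 0 k)) a * mnorm (T.Q n 0 (k + 1)) ^ τ

namespace SplitsAlong

variable {T : IET 𝒜 m} {n : ℕ → ℕ} {F W : Submodule ℝ (𝒜 → ℝ)} {τ c κ : ℝ}

/-- The projection onto `W` along `F`. -/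
def projW (s : T.SplitsAlong n F W τ c κ) : (𝒜 → ℝ) →ₗ[ℝ] (𝒜 → ℝ) := W.projection F s.compl.symm

/-- The projection onto `F` along `W`. -/
def projF (s : T.SplitsAlong n F W τ c κ) : (𝒜 → ℝ) →ₗ[ℝ] (𝒜 → ℝ) := F.projection W s.compl

theorem projW_mem (s : T.SplitsAlong n F W τ c κ) (x : 𝒜 → ℝ) : s.projW x ∈ W :=
  Submodule.projection_apply_mem _ _

theorem projF_mem (s : T.SplitsAlong n F W τ c κ) (x : 𝒜 → ℝ) : s.projF x ∈ F :=
  Submodule.projection_apply_mem _ _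

theorem proj_add (s : T.SplitsAlong n F W τ c κ) (x : 𝒜 → ℝ) : s.projF x + s.projW x = x :=
  Submodule.projection_add_projection_eq_self s.compl x

theorem mulVec_mem_push (s : T.SplitsAlong n F W τ c κ) {V : Submodule ℝ (𝒜 → ℝ)} {x : 𝒜 → ℝ}
    (hx : x ∈ V) (k : ℕ) : (T.Q id 0 (n k)).mulVec x ∈ T.push n k V := by
  rw [← T.Q_zero_eq s.acc.2]
  exact Submodule.mem_map_of_mem hx

/-- The components of a vector at time `k` are controlled by the angle. -/
theorem vnorm_proj_le (s : T.SplitsAlong n F W τ c κ) (k : ℕ) (x : 𝒜 → ℝ) :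
    vnorm ((T.Q id 0 (n k)).mulVec (s.projF x)) ≤
        Fintype.card 𝒜 / c * mnorm (T.Q id 0 (n k)) ^ τ * vnorm ((T.Q id 0 (n k)).mulVec x) ∧
      vnorm ((T.Q id 0 (n k)).mulVec (s.projW x)) ≤
        Fintype.card 𝒜 / c * mnorm (T.Q id 0 (n k)) ^ τ *
          vnorm ((T.Q id 0 (n k)).mulVec x) := by
  obtain ⟨h1, h2⟩ := vnorm_mul_sinAngle_le (s.mulVec_mem_push (s.projF_mem x) k)
    (s.mulVec_mem_push (s.projW_mem x) k)
  rw [← Matrix.mulVec_add, s.proj_add] at h1 h2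
  have hM : 0 < mnorm (T.Q id 0 (n k)) := lt_of_lt_of_le one_pos (T.one_le_mnorm_Q _ _ _)
  have hMτ := Real.rpow_pos_of_pos hM τ
  have hang := s.angle k
  have hc := s.c_pos
  rw [Real.rpow_neg hM.le, ← div_eq_mul_inv] at hang
  have key : ∀ u : 𝒜 → ℝ, vnorm u * sinAngle (T.push n k F) (T.push n k W) ≤
      Fintype.card 𝒜 * vnorm ((T.Q id 0 (n k)).mulVec x) → vnorm u ≤
        Fintype.card 𝒜 / c * mnorm (T.Q id 0 (n k)) ^ τ *
          vnorm ((T.Q id 0 (n k)).mulVec x) := by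
    intro u hu
    have h3 := (mul_le_mul_of_nonneg_left hang (vnorm_nonneg u)).trans hu
    rw [← mul_div_assoc, div_le_iff₀ hMτ, ← le_div_iff₀ hc] at h3
    exact h3.trans_eq (by ring)
  exact ⟨key _ h1, key _ h2⟩

theorem vnorm_le_normQInv (s : T.SplitsAlong n F W τ c κ) (h : T.IsKeane) {k l : ℕ} (hkl : k ≤ l)
    {x : 𝒜 → ℝ} (hx : x ∈ W) : vnorm ((T.Q id 0 (n k)).mulVec x) ≤
      T.normQInv n W k l * vnorm ((T.Q id 0 (n l)).mulVec x) := by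
  have hQ : T.Q id 0 (n l) = T.Q n k l * T.Q id 0 (n k) :=
    T.Q_mul (Nat.zero_le _) (s.acc.1.monotone hkl)
  have : (T.Q id 0 (n k)).mulVec x = (T.Q n k l)⁻¹.mulVec ((T.Q id 0 (n l)).mulVec x) := by
    rw [hQ, ← Matrix.mulVec_mulVec, Matrix.mulVec_mulVec _ (T.Q n k l)⁻¹,
      Matrix.nonsing_inv_mul _ (h.isUnit_det_Q n k l), Matrix.one_mulVec]
  rw [this]
  exact le_opNormOn _ (s.mulVec_mem_push hx l)

theorem vnorm_le_normQ (s : T.SplitsAlong n F W τ c κ) {k l : ℕ} (hkl : k ≤ l)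
    {x : 𝒜 → ℝ} (hx : x ∈ F) : vnorm ((T.Q id 0 (n l)).mulVec x) ≤
      T.normQ n F k l * vnorm ((T.Q id 0 (n k)).mulVec x) := by
  have hQ : T.Q id 0 (n l) = T.Q n k l * T.Q id 0 (n k) :=
    T.Q_mul (Nat.zero_le _) (s.acc.1.monotone hkl)
  rw [hQ, ← Matrix.mulVec_mulVec]
  exact le_opNormOn _ (s.mulVec_mem_push hx k)

/-- Between two consecutive times of the acceleration, the transported mean values of all
balanced exchanges stay close to each other modulo `F`. The difference is moved on to the
time `n (k + 1)`, where the angle between the images of `F` and `W` is known. -/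
theorem exists_gap (s : T.SplitsAlong n F W τ c κ) (h : T.IsKeane) {a : ℝ} (ha0 : 0 ≤ a)
    (ha1 : a < 1) {κ' : ℝ} (hκ' : 1 ≤ κ') : ∃ C : ℝ, 0 ≤ C ∧ ∀ k N : ℕ, n k ≤ N → N ≤ n (k + 1) →
      (∀ α, (T.acc id N).total / (T.acc id N).len α ≤ κ') → ∀ φ : T.Pa a,
      vnorm (s.projW (T.pulledMean N φ) - s.projW (T.pulledMean (n k) φ)) ≤
        C * gapTerm T n W a τ k * (T.pa a φ).toReal := by
  obtain ⟨C, hC, herr⟩ := h.exists_specialMean_error ha0 ha1 s.one_le hκ'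
  have hc := s.c_pos
  refine ⟨Fintype.card 𝒜 / c * (Fintype.card 𝒜 * C), by positivity, ?_⟩
  intro k N hkN hNk hN φ
  set y := T.pulledMean N φ - T.pulledMean (n k) φ with hy
  have h1 := herr (n k) N hkN (s.balanced k) hN φ
  rw [← h.Q_mulVec_pulledMean_sub hkN, ← hy] at h1
  have hZ1 : mnorm (T.Q id (n k) N) ≤ mnorm (T.Q n k (k + 1)) := T.mnorm_Q_mono_right hkN hNk
  have hZ2 : mnorm (T.Q id N (n (k + 1))) ≤ mnorm (T.Q n k (k + 1)) :=
    T.mnorm_Q_mono_left hkN hNk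
  set Z := mnorm (T.Q n k (k + 1)) with hZ
  have hZ0 : 0 ≤ Z := mnorm_nonneg _
  set B := bracketPow (mnorm (T.Q id 0 (n k))) a * (T.pa a φ).toReal with hB
  have hB0 : 0 ≤ B := mul_nonneg (bracketPow_nonneg (T.one_le_mnorm_Q id 0 _)) ENNReal.toReal_nonneg
  have h2 : vnorm ((T.Q id 0 (n (k + 1))).mulVec y) ≤ Fintype.card 𝒜 * Z * (C * Z * B) := by
    rw [T.Q_mul (Nat.zero_le N) hNk, ← Matrix.mulVec_mulVec]
    refine (vnorm_mulVec_le _ _).trans ?_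
    gcongr
    · exact vnorm_nonneg _
    · refine h1.trans ?_
      rw [mul_assoc (C * _)]
      gcongr
  have h3 := (s.vnorm_proj_le (k + 1) y).2
  have h4 := s.vnorm_le_normQInv h (Nat.zero_le (k + 1)) (s.projW_mem y)
  rw [s.acc.2, T.Q_self, Matrix.one_mulVec] at h4
  have hM : 0 ≤ mnorm (T.Q id 0 (n (k + 1))) ^ τ := Real.rpow_nonneg (mnorm_nonneg _) _
  have hI : 0 ≤ T.normQInv n W 0 (k + 1) := opNormOn_nonneg _ _
  rw [← map_sub, ← hy]
  calc vnorm (s.projW y) ≤ T.normQInv n W 0 (k + 1) *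
        (Fintype.card 𝒜 / c * mnorm (T.Q id 0 (n (k + 1))) ^ τ *
          (Fintype.card 𝒜 * Z * (C * Z * B))) := by
        refine h4.trans ?_
        gcongr
        refine h3.trans ?_
        gcongr
    _ = _ := by
        rw [gapTerm, T.Q_zero_eq s.acc.2, T.Q_zero_eq s.acc.2, hB, ← hZ]
        ring

/-- If the transported mean values tend to `0` modulo `F`, then the mean values of the special
Birkhoff sums are controlled by the Diophantine series: the component in `W` is the sum of all
later increments, transported back, and the component in `F` is the transported initial value plus
the sum of all earlier increments. -/
theorem exists_bound (s : T.SplitsAlong n F W τ c κ) (h : T.IsKeane) {a : ℝ} (ha0 : 0 ≤ a)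
    (ha1 : a < 1) : ∃ C : ℝ, 1 ≤ C ∧ ∀ φ : T.Pa a,
      Tendsto (fun k => s.projW (T.pulledMean (n k) φ)) atTop (𝓝 0) → ∀ k : ℕ,
      ENNReal.ofReal (T.specialMeanNorm n k φ) ≤ ENNReal.ofReal C *
        ((T.seriesK n W a τ k + ENNReal.ofReal (T.seriesC n F a τ k)) * T.pa a φ +
          ENNReal.ofReal (T.normQ n F 0 k * (T.normL1 φ / T.total))) := by
  obtain ⟨C₁, hC₁, herr⟩ := h.exists_specialMean_error ha0 ha1 s.one_le s.one_le
  obtain ⟨C₀, hC₀, hzero⟩ := h.exists_vnorm_specialMean_zero_le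
  have hc := s.c_pos
  have hcard : (0 : ℝ) ≤ Fintype.card 𝒜 := Nat.cast_nonneg _
  set A := Fintype.card 𝒜 / c * C₁ with hA
  set A₀ := Fintype.card 𝒜 / c * mnorm (T.Q id 0 (n 0)) ^ τ * C₀ with hA₀
  have hA0 : 0 ≤ A := by positivity
  have hA₀0 : 0 ≤ A₀ := by
    have := Real.rpow_nonneg (mnorm_nonneg (T.Q id 0 (n 0))) τ
    positivity
  refine ⟨1 + A + A₀, by linarith, fun φ hφ k => ?_⟩
  have hfin : T.pa a φ ≠ ∞ := φ.2.2.2.1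
  set p := (T.pa a φ).toReal with hp
  have hp0 : 0 ≤ p := ENNReal.toReal_nonneg
  set x : ℕ → 𝒜 → ℝ := fun l => T.pulledMean (n l) φ with hx
  -- the two components of one increment
  set R : ℕ → ℝ := fun i => mnorm (T.Q n i (i + 1)) * bracketPow (mnorm (T.Q n 0 i)) a *
    mnorm (T.Q n 0 (i + 1)) ^ τ with hR
  have hstep : ∀ i, vnorm ((T.Q id 0 (n (i + 1))).mulVec (s.projF (x (i + 1) - x i))) ≤
        A * R i * p ∧
      vnorm ((T.Q id 0 (n (i + 1))).mulVec (s.projW (x (i + 1) - x i))) ≤ A * R i * p := by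
    intro i
    have hle : n i ≤ n (i + 1) := s.acc.1.monotone (Nat.le_succ i)
    have h1 := herr (n i) (n (i + 1)) hle (s.balanced i) (s.balanced (i + 1)) φ
    rw [← h.Q_mulVec_pulledMean_sub hle] at h1
    obtain ⟨h2, h3⟩ := s.vnorm_proj_le (i + 1) (x (i + 1) - x i)
    have hM := Real.rpow_nonneg (mnorm_nonneg (T.Q id 0 (n (i + 1)))) τ
    have key : Fintype.card 𝒜 / c * mnorm (T.Q id 0 (n (i + 1))) ^ τ *
        vnorm ((T.Q id 0 (n (i + 1))).mulVec (x (i + 1) - x i)) ≤ A * R i * p := by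
      calc _ ≤ Fintype.card 𝒜 / c * mnorm (T.Q id 0 (n (i + 1))) ^ τ *
            (C₁ * mnorm (T.Q id (n i) (n (i + 1))) *
              bracketPow (mnorm (T.Q id 0 (n i))) a * p) := by gcongr
        _ = _ := by
          simp only [hR, T.Q_zero_eq s.acc.2, hA]
          change _ = Fintype.card 𝒜 / c * C₁ * (mnorm (T.Q id (n i) (n (i + 1))) * _ * _) * p
          ring
    exact ⟨h2.trans key, h3.trans key⟩
  have hR0 : ∀ i, 0 ≤ R i := fun i => by
    have h1 := mnorm_nonneg (T.Q n i (i + 1))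
    have h2 := bracketPow_nonneg (a := a) (T.one_le_mnorm_Q n 0 i)
    have h3 := Real.rpow_nonneg (mnorm_nonneg (T.Q n 0 (i + 1))) τ
    positivity
  -- the component in `W`
  set t : ℕ → ℝ := fun i => T.normQInv n W k (k + i + 1) * R (k + i) with ht
  have ht0 : ∀ i, 0 ≤ t i := fun i => mul_nonneg (opNormOn_nonneg _ _) (hR0 _)
  have hK : T.seriesK n W a τ k = ∑' i, ENNReal.ofReal (t i) := by
    rw [seriesK]
    refine tsum_congr fun i => ?_
    congr 1
    simp only [ht, hR]
    ring
  have hWL : ∀ L, vnorm ((T.Q id 0 (n k)).mulVec (s.projW (x k))) ≤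
      vnorm ((T.Q id 0 (n k)).mulVec (s.projW (x (k + L)))) +
        A * p * ∑ i ∈ Finset.range L, t i := by
    intro L
    induction L with
    | zero => simp
    | succ L ih =>
      refine ih.trans ?_
      have e : s.projW (x (k + L)) = s.projW (x (k + (L + 1))) -
          s.projW (x (k + L + 1) - x (k + L)) := by
        rw [← map_sub, ← add_assoc, sub_sub_cancel]
      have h1 := s.vnorm_le_normQInv h (show k ≤ k + L + 1 by omega)
        (s.projW_mem (x (k + L + 1) - x (k + L)))
      have h2 : vnorm ((T.Q id 0 (n k)).mulVec (s.projW (x (k + L + 1) - x (k + L)))) ≤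
          A * p * t L := by
        refine h1.trans ((mul_le_mul_of_nonneg_left (hstep (k + L)).2
          (opNormOn_nonneg _ _)).trans_eq ?_)
        simp only [ht, normQInv]
        ring
      have h3 := vnorm_sub_le ((T.Q id 0 (n k)).mulVec (s.projW (x (k + (L + 1)))))
        ((T.Q id 0 (n k)).mulVec (s.projW (x (k + L + 1) - x (k + L))))
      rw [← Matrix.mulVec_sub, ← e] at h3
      rw [Finset.sum_range_succ, mul_add]
      linarith
  have hW : ENNReal.ofReal (vnorm ((T.Q id 0 (n k)).mulVec (s.projW (x k)))) ≤
      ENNReal.ofReal (A * p) * T.seriesK n W a τ k := by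
    have hlim : Tendsto (fun L => vnorm ((T.Q id 0 (n k)).mulVec (s.projW (x (k + L)))))
        atTop (𝓝 0) := by
      have h1 : Tendsto (fun L => s.projW (x (k + L))) atTop (𝓝 0) :=
        (tendsto_add_atTop_iff_nat k).2 hφ |>.congr fun L => by rw [add_comm]
      have h2 : Continuous fun v : 𝒜 → ℝ => vnorm ((T.Q id 0 (n k)).mulVec v) :=
        continuous_vnorm.comp (by fun_prop)
      have h3 := (h2.tendsto 0).comp h1
      rw [Matrix.mulVec_zero, vnorm_zero] at h3
      exact h3
    have hlim' : Tendsto (fun L => ENNReal.ofReal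
        (vnorm ((T.Q id 0 (n k)).mulVec (s.projW (x (k + L))))) +
          ENNReal.ofReal (A * p) * T.seriesK n W a τ k) atTop
        (𝓝 (ENNReal.ofReal (A * p) * T.seriesK n W a τ k)) := by
      have := ENNReal.tendsto_ofReal hlim
      rw [ENNReal.ofReal_zero] at this
      simpa using this.add_const (ENNReal.ofReal (A * p) * T.seriesK n W a τ k)
    refine ge_of_tendsto' hlim' fun L => ?_
    refine (ENNReal.ofReal_le_ofReal (hWL L)).trans ?_
    rw [ENNReal.ofReal_add (vnorm_nonneg _)
      (mul_nonneg (by positivity) (Finset.sum_nonneg fun i _ => ht0 i)),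
      ENNReal.ofReal_mul (by positivity), ENNReal.ofReal_sum_of_nonneg fun i _ => ht0 i, hK]
    gcongr
    exact ENNReal.sum_le_tsum _
  -- the component in `F`
  set u : ℕ → ℝ := fun i => T.normQ n F (i + 1) k * R i with hu
  have hu0 : ∀ i, 0 ≤ u i := fun i => mul_nonneg (opNormOn_nonneg _ _) (hR0 _)
  have hCs : T.seriesC n F a τ k = ∑ i ∈ Finset.range k, u i := by
    have hIcc : Finset.Icc 1 k = Finset.Ico (0 + 1) (k + 1) := by
      ext i; simp only [Finset.mem_Icc, Finset.mem_Ico]; omega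
    rw [seriesC, hIcc, ← Finset.sum_Ico_add', Finset.range_eq_Ico]
    refine Finset.sum_congr rfl fun i _ => ?_
    simp only [hu, hR, Nat.add_sub_cancel]
    ring
  have hFL : ∀ L ≤ k, vnorm ((T.Q id 0 (n k)).mulVec (s.projF (x L))) ≤
      vnorm ((T.Q id 0 (n k)).mulVec (s.projF (x 0))) +
        A * p * ∑ i ∈ Finset.range L, u i := by
    intro L
    induction L with
    | zero => simp
    | succ L ih =>
      intro hL
      have e : s.projF (x (L + 1)) = s.projF (x L) + s.projF (x (L + 1) - x L) := by
        rw [← map_add, add_sub_cancel]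
      have h1 := s.vnorm_le_normQ hL (s.projF_mem (x (L + 1) - x L))
      have h2 : vnorm ((T.Q id 0 (n k)).mulVec (s.projF (x (L + 1) - x L))) ≤ A * p * u L := by
        refine h1.trans ((mul_le_mul_of_nonneg_left (hstep L).1
          (opNormOn_nonneg _ _)).trans_eq ?_)
        simp only [hu, normQ]
        ring
      rw [e, Matrix.mulVec_add, Finset.sum_range_succ, mul_add]
      have h3 := ih (by omega)
      exact (vnorm_add_le _ _).trans (by linarith)
  have hF0 : vnorm ((T.Q id 0 (n k)).mulVec (s.projF (x 0))) ≤
      A₀ * (T.normQ n F 0 k * (T.normL1 φ / T.total)) := by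
    have hN : 0 ≤ T.normQ n F 0 k := opNormOn_nonneg _ _
    have h1 := s.vnorm_le_normQ (Nat.zero_le k) (s.projF_mem (x 0))
    have h2 := (s.vnorm_proj_le 0 (x 0)).1
    have h3 : vnorm ((T.Q id 0 (n 0)).mulVec (x 0)) ≤ C₀ * (T.normL1 φ / T.total) := by
      rw [hx, h.Q_mulVec_pulledMean, s.acc.2]
      exact hzero a ha0 ha1 φ
    have hM := Real.rpow_nonneg (mnorm_nonneg (T.Q id 0 (n 0))) τ
    calc _ ≤ _ := h1
      _ ≤ T.normQ n F 0 k * (Fintype.card 𝒜 / c * mnorm (T.Q id 0 (n 0)) ^ τ *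
          (C₀ * (T.normL1 φ / T.total))) := by
          gcongr
          refine h2.trans ?_
          gcongr
      _ = _ := by rw [hA₀]; ring
  have hl1 : 0 ≤ T.normQ n F 0 k * (T.normL1 φ / T.total) :=
    mul_nonneg (opNormOn_nonneg _ _) (div_nonneg (integral_nonneg fun x => abs_nonneg _)
      (total_pos h.pos).le)
  have hCs0 : 0 ≤ T.seriesC n F a τ k := by
    rw [hCs]; exact Finset.sum_nonneg fun i _ => hu0 i
  have hsplit : T.specialMeanNorm n k φ ≤ vnorm ((T.Q id 0 (n k)).mulVec (s.projW (x k))) +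
      (A * p * T.seriesC n F a τ k + A₀ * (T.normQ n F 0 k * (T.normL1 φ / T.total))) := by
    rw [T.specialMeanNorm_eq s.acc.2, ← h.Q_mulVec_pulledMean (n k) φ]
    have e : T.pulledMean (n k) φ = s.projF (x k) + s.projW (x k) := (s.proj_add _).symm
    rw [e, Matrix.mulVec_add, hCs]
    have := hFL k le_rfl
    exact (vnorm_add_le _ _).trans (by linarith)
  have hpE : ENNReal.ofReal p = T.pa a φ := ENNReal.ofReal_toReal hfin
  refine (ENNReal.ofReal_le_ofReal hsplit).trans ?_
  rw [ENNReal.ofReal_add (vnorm_nonneg _) (by positivity),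
    ENNReal.ofReal_add (by positivity) (by positivity), ENNReal.ofReal_mul hA₀0]
  have hAC : ENNReal.ofReal A ≤ ENNReal.ofReal (1 + A + A₀) :=
    ENNReal.ofReal_le_ofReal (by linarith)
  have hA₀C : ENNReal.ofReal A₀ ≤ ENNReal.ofReal (1 + A + A₀) :=
    ENNReal.ofReal_le_ofReal (by linarith)
  rw [ENNReal.ofReal_mul (by positivity), ENNReal.ofReal_mul hA0, hpE]
  rw [ENNReal.ofReal_mul hA0, hpE] at hW
  calc _ ≤ ENNReal.ofReal A * T.pa a φ * T.seriesK n W a τ k +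
        (ENNReal.ofReal A * T.pa a φ * ENNReal.ofReal (T.seriesC n F a τ k) +
          ENNReal.ofReal A₀ * ENNReal.ofReal (T.normQ n F 0 k * (T.normL1 φ / T.total))) := by
        gcongr
    _ ≤ ENNReal.ofReal (1 + A + A₀) * T.pa a φ * T.seriesK n W a τ k +
        (ENNReal.ofReal (1 + A + A₀) * T.pa a φ * ENNReal.ofReal (T.seriesC n F a τ k) +
          ENNReal.ofReal (1 + A + A₀) *
            ENNReal.ofReal (T.normQ n F 0 k * (T.normL1 φ / T.total))) := by
        gcongr
    _ = _ := by ring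

end SplitsAlong

/-! ### The correction operator -/

theorem exists_between_of_strictMono {n : ℕ → ℕ} (hn : StrictMono n) {K N : ℕ} (hK : n K ≤ N) :
    ∃ k, K ≤ k ∧ n k ≤ N ∧ N ≤ n (k + 1) := by
  have hex : ∃ l, N < n l := ⟨N + 1, (Nat.lt_succ_self N).trans_le hn.le_apply⟩
  have h1 := Nat.find_spec hex
  have hKl : K < Nat.find hex := hn.lt_iff_lt.1 (hK.trans_lt h1)
  refine ⟨Nat.find hex - 1, by omega, ?_, ?_⟩
  · exact not_lt.1 (Nat.find_min hex (by omega))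
  · rw [Nat.sub_add_cancel (by omega)]
    exact h1.le

namespace SplitsAlong

variable {T : IET 𝒜 m} {n n' : ℕ → ℕ} {F W W' : Submodule ℝ (𝒜 → ℝ)} {τ τ' c c' κ κ' : ℝ}

theorem projW_projW (s : T.SplitsAlong n F W τ c κ) (s' : T.SplitsAlong n' F W' τ' c' κ')
    (x : 𝒜 → ℝ) : s'.projW (s.projW x) = s'.projW x := by
  conv_rhs => rw [← s.proj_add x, map_add]
  have : s'.projW (s.projF x) = 0 :=
    (Submodule.projection_apply_eq_zero_iff s'.compl.symm).2 (s.projF_mem x)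
  rw [this, zero_add]

/-- The limit of the transported mean values modulo `F` depends linearly on the function and is
bounded. -/
theorem exists_limit (s : T.SplitsAlong n F W τ c κ) (h : T.IsKeane) {a : ℝ} (ha0 : 0 ≤ a)
    (ha1 : a < 1) (hsum : Summable (T.gapTerm n W a τ)) :
    ∃ ℓ : T.Pa a →ₗ[ℝ] (𝒜 → ℝ), (∀ φ : T.Pa a,
      Tendsto (fun k => s.projW (T.pulledMean (n k) φ)) atTop (𝓝 (ℓ φ))) ∧
      ∃ B : ℝ, 0 ≤ B ∧ ∀ φ : T.Pa a, ‖ℓ φ‖ ≤ B * T.normPa a φ := by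
  obtain ⟨C, hC, hgap⟩ := s.exists_gap h ha0 ha1 s.one_le
  have hdist : ∀ (φ : T.Pa a) k, dist (s.projW (T.pulledMean (n k) φ))
      (s.projW (T.pulledMean (n (k + 1)) φ)) ≤ C * T.gapTerm n W a τ k * (T.pa a φ).toReal := by
    intro φ k
    rw [dist_comm, dist_eq_norm]
    exact (norm_le_vnorm _).trans
      (hgap k (n (k + 1)) (s.acc.1.monotone (Nat.le_succ k)) le_rfl (s.balanced _) φ)
  have hsum' : ∀ φ : T.Pa a,
      Summable fun k => C * T.gapTerm n W a τ k * (T.pa a φ).toReal := fun φ =>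
    (hsum.mul_left C).mul_right _
  have hlim : ∀ φ : T.Pa a, ∃ y,
      Tendsto (fun k => s.projW (T.pulledMean (n k) φ)) atTop (𝓝 y) := fun φ =>
    cauchySeq_tendsto_of_complete (cauchySeq_of_dist_le_of_summable _ (hdist φ) (hsum' φ))
  choose ℓ hℓ using hlim
  refine ⟨⟨⟨ℓ, fun φ ψ => ?_⟩, fun r φ => ?_⟩, hℓ, ?_⟩
  · refine tendsto_nhds_unique (hℓ (φ + ψ)) (((hℓ φ).add (hℓ ψ)).congr fun k => ?_)
    simp only [pulledMean]
    rw [h.specialMean_add ha0 ha1, Matrix.mulVec_add, map_add]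
  · refine tendsto_nhds_unique (hℓ (r • φ)) (((hℓ φ).const_smul r).congr fun k => ?_)
    simp only [pulledMean]
    rw [h.specialMean_smul, Matrix.mulVec_smul, map_smul]
  · obtain ⟨C₀, hC₀, hzero⟩ := h.exists_vnorm_specialMean_zero_le
    set P := LinearMap.toContinuousLinearMap s.projW with hP
    set S := ∑' k, T.gapTerm n W a τ k with hS
    have hgap0 : ∀ k, 0 ≤ T.gapTerm n W a τ k := fun k => by
      have h1 : 0 ≤ T.normQInv n W 0 (k + 1) := opNormOn_nonneg _ _
      have h2 := bracketPow_nonneg (a := a) (T.one_le_mnorm_Q n 0 k)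
      have h3 := Real.rpow_nonneg (mnorm_nonneg (T.Q n 0 (k + 1))) τ
      rw [gapTerm]
      positivity
    have hS0 : 0 ≤ S := tsum_nonneg hgap0
    have htot := total_pos h.pos
    refine ⟨‖P‖ * C₀ / T.total + C * S, by positivity, fun φ => ?_⟩
    have h1 := dist_le_tsum_of_dist_le_of_tendsto₀ _ (hdist φ) (hsum' φ) (hℓ φ)
    rw [tsum_mul_right, tsum_mul_left, ← hS] at h1
    have h2 : ‖s.projW (T.pulledMean (n 0) φ)‖ ≤ ‖P‖ * (C₀ * (T.normL1 φ / T.total)) := by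
      rw [s.acc.2, pulledMean_zero]
      refine (P.le_opNorm _).trans ?_
      gcongr
      exact (norm_le_vnorm _).trans (hzero a ha0 ha1 φ)
    have h3 : ‖ℓ φ‖ ≤ ‖s.projW (T.pulledMean (n 0) φ)‖ + C * S * (T.pa a φ).toReal := by
      have := norm_le_norm_add_norm_sub' (ℓ φ) (s.projW (T.pulledMean (n 0) φ))
      rw [dist_comm, dist_eq_norm] at h1
      linarith
    have hL : 0 ≤ T.normL1 φ := integral_nonneg fun x => abs_nonneg _
    have hp : 0 ≤ (T.pa a φ).toReal := ENNReal.toReal_nonneg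
    have h4 : 0 ≤ ‖P‖ * C₀ / T.total * (T.pa a φ).toReal := by positivity
    have h5 : 0 ≤ C * S * T.normL1 φ := by positivity
    rw [normPa]
    calc ‖ℓ φ‖ ≤ ‖P‖ * (C₀ * (T.normL1 φ / T.total)) + C * S * (T.pa a φ).toReal := by linarith
      _ = ‖P‖ * C₀ / T.total * T.normL1 φ + C * S * (T.pa a φ).toReal := by ring
      _ ≤ (‖P‖ * C₀ / T.total + C * S) * (T.normL1 φ + (T.pa a φ).toReal) := by
        rw [add_mul, mul_add, mul_add]
        linarith

/-- The correction operator with values in an arbitrary complement `U'` of `F`: where it vanishes,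
the transported mean values tend to `0` modulo `F` along every balanced acceleration. -/
theorem exists_correction (s : T.SplitsAlong n F W τ c κ) (h : T.IsKeane) {a : ℝ} (ha0 : 0 ≤ a)
    (ha1 : a < 1) (hsum : Summable (T.gapTerm n W a τ)) {U' : Submodule ℝ (𝒜 → ℝ)}
    (hU : IsCompl F U') :
    ∃ ℓ : T.Pa a →ₗ[ℝ] U', (∃ B : ℝ, ∀ φ : T.Pa a,
        vnorm (ℓ φ : 𝒜 → ℝ) ≤ B * T.normPa a φ) ∧
      ∀ φ : T.Pa a, ℓ φ = 0 → ∀ (n' : ℕ → ℕ) (W' : Submodule ℝ (𝒜 → ℝ)) (τ' c' κ' : ℝ)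
        (s' : T.SplitsAlong n' F W' τ' c' κ'),
        Tendsto (fun k => s'.projW (T.pulledMean (n' k) φ)) atTop (𝓝 0) := by
  obtain ⟨ℓ, hℓ, B, hB, hbound⟩ := s.exists_limit h ha0 ha1 hsum
  refine ⟨(U'.projectionOnto F hU.symm).comp ℓ, ?_, ?_⟩
  · set P := LinearMap.toContinuousLinearMap (U'.projection F hU.symm) with hP
    refine ⟨Fintype.card 𝒜 * (‖P‖ * B), fun φ => ?_⟩
    refine (vnorm_le_norm _).trans ?_
    rw [mul_assoc, mul_assoc]
    gcongr
    exact (P.le_opNorm (ℓ φ)).trans (by gcongr; exact hbound φ)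
  intro φ hφ n' W' τ' c' κ' s'
  have hcont : ∀ L : (𝒜 → ℝ) →ₗ[ℝ] (𝒜 → ℝ), Continuous L := fun L =>
    L.continuous_of_finiteDimensional
  -- the limit lies in `W` and, since its image in `U'` vanishes, also in `F`
  have hℓF : ℓ φ ∈ F := (Submodule.projectionOnto_apply_eq_zero_iff hU.symm).1 hφ
  have hℓ0 : ℓ φ = 0 := by
    have h1 : s.projW (ℓ φ) = ℓ φ := by
      refine tendsto_nhds_unique (((hcont s.projW).tendsto _).comp (hℓ φ)) ?_
      exact (hℓ φ).congr fun k => (s.projW_projW s _).symm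
    rw [← h1]
    exact (Submodule.projection_apply_eq_zero_iff s.compl.symm).2 hℓF
  -- every time `n' k'` lies between two consecutive times of `n`
  obtain ⟨C, hC, hgap⟩ := s.exists_gap h ha0 ha1 s'.one_le
  have hmain : Tendsto (fun k => s.projW (T.pulledMean (n' k) φ)) atTop (𝓝 0) := by
    rw [Metric.tendsto_atTop]
    intro ε hε
    have h1 := hℓ φ
    rw [hℓ0, Metric.tendsto_atTop] at h1
    obtain ⟨K₁, hK₁⟩ := h1 (ε / 2) (by linarith)
    have h2 := ((hsum.mul_left C).mul_right (T.pa a φ).toReal).tendsto_atTop_zero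
    rw [Metric.tendsto_atTop] at h2
    obtain ⟨K₂, hK₂⟩ := h2 (ε / 2) (by linarith)
    refine ⟨n (max K₁ K₂), fun k' hk' => ?_⟩
    obtain ⟨k, hk, hle, hge⟩ := exists_between_of_strictMono s.acc.1
      (hk'.trans (s'.acc.1.le_apply : k' ≤ n' k'))
    have h3 := (norm_le_vnorm _).trans (hgap k (n' k') hle hge (s'.balanced k') φ)
    have h4 := hK₁ k ((le_max_left _ _).trans hk)
    have h5 := hK₂ k ((le_max_right _ _).trans hk)
    rw [dist_zero_right] at h4 h5 ⊢
    have h6 := norm_le_norm_add_norm_sub' (s.projW (T.pulledMean (n' k') φ))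
      (s.projW (T.pulledMean (n k) φ))
    have h7 := (le_abs_self _).trans_lt (Real.norm_eq_abs _ ▸ h5)
    linarith
  have := ((hcont s'.projW).tendsto 0).comp hmain
  rw [map_zero] at this
  exact this.congr fun k => s.projW_projW s' _

end SplitsAlong

/-! ### Exponential bounds along an acceleration with a small parameter -/

section Exponents

variable {T : IET 𝒜 m} {g : ℕ} {lam : ℕ → ℝ} {E : ℤ → Submodule ℝ (𝒜 → ℝ)}

theorem IsOseledetsGeneric.lam_le_of_le (h : T.IsOseledetsGeneric g lam E) {i j : ℕ} (hi : 1 ≤ i)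
    (hij : i ≤ j) (hj : j ≤ g + 1) : lam j ≤ lam i := by
  induction j, hij using Nat.le_induction with
  | base => exact le_rfl
  | succ j hij ih =>
    exact (h.lam_anti j (by omega) (by omega)).le.trans (ih (by omega))

theorem IsOseledetsGeneric.lam_nonneg (h : T.IsOseledetsGeneric g lam E) {i : ℕ} (hi : 1 ≤ i)
    (hig : i ≤ g + 1) : 0 ≤ lam i :=
  h.lam_last ▸ h.lam_le_of_le hi hig le_rfl

theorem IsFDCAcceleration.mono (hgen : T.IsOseledetsGeneric g lam E) {s τ : ℝ}
    (hsτ : s ≤ τ) {n : ℕ → ℕ} {V : ℕ → Submodule ℝ (𝒜 → ℝ)}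
    (h : T.IsFDCAcceleration g lam E s n V) : T.IsFDCAcceleration g lam E τ n V := by
  obtain ⟨hacc, hcomp, htow, c, C, κ, hc, hC, hκ, r, hr0, ⟨ρ, hρ1, hρ2, hρ⟩, hE, hU, hZ, hQ, hbal,
    hang⟩ := h
  have hlam := hgen.lam_nonneg le_rfl (by omega)
  have hC0 : 0 ≤ C := zero_le_one.trans hC
  refine ⟨hacc, hcomp, htow, c, C, κ, hc, hC, hκ, r, hr0, ⟨ρ, hρ1, by linarith, hρ⟩,
    fun k l j hkl h1 h2 => (hE k l j hkl h1 h2).trans ?_,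
    fun k l j hkl h1 h2 => (hU k l j hkl h1 h2).trans ?_,
    fun k => (hZ k).trans ?_, fun k => ⟨(hQ k).1, (hQ k).2.trans ?_⟩, hbal,
    fun k j h1 h2 => le_trans ?_ (hang k j h1 h2)⟩
  · gcongr
  · gcongr
  · gcongr
  · gcongr
  · exact mul_le_mul_of_nonneg_left (Real.rpow_le_rpow_of_exponent_le (T.one_le_mnorm_Q n 0 k)
      (by linarith)) hc.le

theorem rsum_split (r : ℕ → ℕ) {k l : ℕ} (hkl : k ≤ l) :
    (rsum r k l : ℝ) = rsum r 0 l - rsum r 0 k := by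
  have h := Finset.sum_Ico_consecutive r (Nat.zero_le k) hkl
  have h' : rsum r 0 k + rsum r k l = rsum r 0 l := h
  rw [← h']
  push_cast
  ring

/-- A sequence of partial sums with slope in `(1, 1 + s)` stays at a bounded distance above the
line of slope `1` and below the line of slope `1 + s`. -/
theorem exists_rsum_bounds {r : ℕ → ℕ} {s ρ : ℝ} (hρ1 : 1 < ρ) (hρ2 : ρ < 1 + s)
    (hρ : Tendsto (fun k : ℕ => (rsum r 0 k : ℝ) / k) atTop (𝓝 ρ)) :
    ∃ C : ℝ, 0 ≤ C ∧ ∀ k : ℕ, (k : ℝ) - C ≤ rsum r 0 k ∧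
      (rsum r 0 k : ℝ) ≤ (1 + s) * k + C := by
  obtain ⟨K, hK⟩ := eventually_atTop.1 ((hρ.eventually (lt_mem_nhds hρ1)).and
    (hρ.eventually (gt_mem_nhds hρ2)))
  refine ⟨(K + 1 : ℕ) + rsum r 0 (K + 1), by positivity, fun k => ?_⟩
  have hk0 : (0 : ℝ) ≤ k := Nat.cast_nonneg k
  have hr0 : (0 : ℝ) ≤ rsum r 0 k := Nat.cast_nonneg _
  have hs : 0 ≤ (1 + s) * k := mul_nonneg (by linarith) hk0
  have hR : (0 : ℝ) ≤ rsum r 0 (K + 1) := Nat.cast_nonneg _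
  have hK0 : (0 : ℝ) ≤ (K + 1 : ℕ) := Nat.cast_nonneg _
  rcases le_or_gt k (K + 1) with hk | hk
  · have h1 : (k : ℝ) ≤ (K + 1 : ℕ) := by exact_mod_cast hk
    have h2 : (rsum r 0 k : ℝ) ≤ rsum r 0 (K + 1) := by
      have : rsum r 0 k ≤ rsum r 0 (K + 1) :=
        Finset.sum_le_sum_of_subset (Finset.Ico_subset_Ico_right hk)
      exact_mod_cast this
    constructor <;> linarith
  · obtain ⟨h1, h2⟩ := hK k (by omega)
    have hk' : (0 : ℝ) < k := by exact_mod_cast (by omega : 0 < k)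
    rw [lt_div_iff₀ hk'] at h1
    rw [div_lt_iff₀ hk'] at h2
    constructor <;> linarith

/-- The exponential bounds along an acceleration, in terms of the step numbers instead of the
sums of the `r_i`. -/
structure ExpBounds (T : IET 𝒜 m) (n : ℕ → ℕ) (F W : Submodule ℝ (𝒜 → ℝ)) (Λ μ ν s C : ℝ) :
    Prop where
  one_le : 1 ≤ C
  inv_le : ∀ k l : ℕ, k < l → T.normQInv n W k l ≤
    C * Real.exp (-(μ - s) * (l - k) + Λ * s * k)
  norm_le : ∀ k l : ℕ, k ≤ l → T.normQ n F k l ≤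
    C * Real.exp ((ν + s) * (l - k) + (Λ + 1) * s * l)
  step_le : ∀ k : ℕ, mnorm (T.Q n k (k + 1)) ≤ C * Real.exp (s * k)
  Q_le : ∀ k : ℕ, mnorm (T.Q n 0 k) ≤ C * Real.exp (Λ * (1 + s) * k)

/-- As the slope of the partial sums lies in `(1, 1 + s)`, replacing `r(k, l)` by `l - k` costs a
factor `exp (O(s) k)` or `exp (O(s) l)`. The condition `s ≤ λ_{j-1}` fixes the sign of the exponent
of the inverse. -/
theorem IsFDCAcceleration.exists_expBounds (hgen : T.IsOseledetsGeneric g lam E) {s : ℝ}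
    (hs0 : 0 < s) (hs1 : s ≤ 1) {j : ℕ} (hj2 : 2 ≤ j) (hjg : j ≤ g + 1) (hs : s ≤ lam (j - 1))
    {n : ℕ → ℕ} {V : ℕ → Submodule ℝ (𝒜 → ℝ)} (h : T.IsFDCAcceleration g lam E s n V) :
    ∃ C, T.ExpBounds n (E j) (V j) (lam 1) (lam (j - 1)) (lam j) s C := by
  obtain ⟨c, C, κ, hc, hC, hκ, r, hr0, ⟨ρ, hρ1, hρ2, hρ⟩, hE, hU, hZ, hQ, -, -⟩ := h.bounds
  obtain ⟨C₀, hC₀, hr⟩ := exists_rsum_bounds hρ1 hρ2 hρ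
  have hj0 : 0 ≤ lam j := hgen.lam_nonneg (by omega) hjg
  have hj1 : lam j ≤ lam 1 := hgen.lam_le_of_le le_rfl (by omega) hjg
  have hp1 : lam (j - 1) ≤ lam 1 := hgen.lam_le_of_le le_rfl (by omega) (by omega)
  have hexp1 : ∀ {x : ℝ}, 0 ≤ x → 1 ≤ Real.exp x := fun hx => Real.one_le_exp hx
  set D₁ := Real.exp (2 * C₀ * (lam (j - 1) - s)) with hD₁
  set D₂ := Real.exp (2 * C₀ * (lam j + s)) with hD₂
  have hD₁1 : 1 ≤ D₁ := hexp1 (mul_nonneg (by linarith) (by linarith))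
  have hD₂1 : 1 ≤ D₂ := hexp1 (mul_nonneg (by linarith) (by linarith))
  have hC0 : 0 ≤ C := zero_le_one.trans hC
  have hCD : C ≤ C * D₁ * D₂ := by
    rw [mul_assoc]; exact le_mul_of_one_le_right hC0 (one_le_mul_of_one_le_of_one_le hD₁1 hD₂1)
  have hCD₁ : C * D₁ ≤ C * D₁ * D₂ := le_mul_of_one_le_right (by positivity) hD₂1
  have hCD₂ : C * D₂ ≤ C * D₁ * D₂ := by
    rw [mul_right_comm]; exact le_mul_of_one_le_right (by positivity) hD₁1
  refine ⟨C * D₁ * D₂, hC.trans hCD, ?_, ?_, ?_, ?_⟩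
  · intro k l hkl
    have hk0 : (0 : ℝ) ≤ k := Nat.cast_nonneg k
    refine (hU k l j hkl hj2 hjg).trans ?_
    have h1 : (-lam (j - 1) + s) * rsum r k l ≤
        2 * C₀ * (lam (j - 1) - s) + (-(lam (j - 1) - s) * (l - k) + lam 1 * s * k) := by
      rw [rsum_split r hkl.le]
      have h2 : (l : ℝ) - (1 + s) * k - 2 * C₀ ≤ rsum r 0 l - rsum r 0 k := by
        linarith [(hr l).1, (hr k).2]
      have h3 := mul_le_mul_of_nonneg_left h2 (sub_nonneg.2 hs)
      have h4 : (lam (j - 1) - s) * (s * k) ≤ lam 1 * (s * k) :=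
        mul_le_mul_of_nonneg_right (by linarith) (by positivity)
      linarith
    calc C * Real.exp ((-lam (j - 1) + s) * rsum r k l)
        ≤ C * Real.exp (2 * C₀ * (lam (j - 1) - s) +
            (-(lam (j - 1) - s) * (l - k) + lam 1 * s * k)) := by gcongr
      _ = C * D₁ * Real.exp (-(lam (j - 1) - s) * (l - k) + lam 1 * s * k) := by
          rw [Real.exp_add, ← mul_assoc]
      _ ≤ _ := by gcongr
  · intro k l hkl
    have hl0 : (0 : ℝ) ≤ l := Nat.cast_nonneg l
    rcases hkl.lt_or_eq with hkl | rfl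
    · refine (hE k l j hkl (by omega) hjg).trans ?_
      have h1 : (lam j + s) * rsum r k l ≤
          2 * C₀ * (lam j + s) + ((lam j + s) * (l - k) + (lam 1 + 1) * s * l) := by
        rw [rsum_split r hkl.le]
        have h2 : (rsum r 0 l : ℝ) - rsum r 0 k ≤ (1 + s) * l - k + 2 * C₀ := by
          linarith [(hr l).2, (hr k).1]
        have h3 := mul_le_mul_of_nonneg_left h2 (by linarith : 0 ≤ lam j + s)
        have h4 : (lam j + s) * (s * l) ≤ (lam 1 + 1) * (s * l) :=
          mul_le_mul_of_nonneg_right (by linarith) (by positivity)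
        linarith
      calc C * Real.exp ((lam j + s) * rsum r k l)
          ≤ C * Real.exp (2 * C₀ * (lam j + s) +
              ((lam j + s) * (l - k) + (lam 1 + 1) * s * l)) := by gcongr
        _ = C * D₂ * Real.exp ((lam j + s) * (l - k) + (lam 1 + 1) * s * l) := by
            rw [Real.exp_add, ← mul_assoc]
        _ ≤ _ := by gcongr
    · have h1 : T.normQ n (E j) k k ≤ 1 := by
        have : T.Q n k k = 1 := T.Q_self (n k)
        rw [normQ, this]
        exact opNormOn_one_le _
      refine h1.trans (one_le_mul_of_one_le_of_one_le (hC.trans hCD) (hexp1 ?_))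
      rw [sub_self, mul_zero, zero_add]
      have : 0 ≤ lam 1 + 1 := by linarith
      positivity
  · exact fun k => (hZ k).trans (by gcongr)
  · exact fun k => (hQ k).2.trans (by gcongr)

namespace ExpBounds

variable {n : ℕ → ℕ} {F W : Submodule ℝ (𝒜 → ℝ)} {Λ μ ν s C a : ℝ}

/-- The factors common to the terms of all the series grow at most like `exp ((Λ a + O(s)) i)`. -/
theorem exists_weight_le (b : T.ExpBounds n F W Λ μ ν s C) (hΛ : 0 ≤ Λ) (hs0 : 0 < s)
    (hs1 : s ≤ 1) (ha0 : 0 ≤ a) (ha1 : a ≤ 1) : ∃ D : ℝ, 0 ≤ D ∧ ∀ i : ℕ,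
      mnorm (T.Q n i (i + 1)) ^ 2 * bracketPow (mnorm (T.Q n 0 i)) a *
        mnorm (T.Q n 0 (i + 1)) ^ s ≤ D * Real.exp ((Λ * a + (5 * Λ + 2) * s) * i) := by
  have hC := b.one_le
  have hC0 : 0 ≤ C := zero_le_one.trans hC
  refine ⟨C ^ 2 * ((1 + s⁻¹) * C ^ (a + s)) * (C ^ s * Real.exp (Λ * (1 + s) * s)),
    by positivity, fun i => ?_⟩
  have hi0 : (0 : ℝ) ≤ i := Nat.cast_nonneg i
  have hM : 0 ≤ mnorm (T.Q n 0 i) := mnorm_nonneg _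
  have hM' : 0 ≤ mnorm (T.Q n 0 (i + 1)) := mnorm_nonneg _
  have h1 : mnorm (T.Q n i (i + 1)) ^ 2 ≤ C ^ 2 * Real.exp (2 * s * i) := by
    have := pow_le_pow_left₀ (mnorm_nonneg _) (b.step_le i) 2
    rw [mul_pow, ← Real.exp_nat_mul] at this
    refine this.trans_eq ?_
    congr 2
    push_cast
    ring
  have h2 : bracketPow (mnorm (T.Q n 0 i)) a ≤
      (1 + s⁻¹) * C ^ (a + s) * Real.exp (Λ * (a + 3 * s) * i) := by
    refine (bracketPow_le_rpow (T.one_le_mnorm_Q n 0 i) ha0 hs0).trans ?_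
    rw [mul_assoc]
    refine mul_le_mul_of_nonneg_left ?_ (by positivity)
    refine (Real.rpow_le_rpow hM (b.Q_le i) (by linarith)).trans ?_
    rw [Real.mul_rpow hC0 (Real.exp_pos _).le, ← Real.exp_mul]
    refine mul_le_mul_of_nonneg_left (Real.exp_le_exp.2 ?_) (by positivity)
    have h3 : (1 + s) * (a + s) ≤ a + 3 * s := by nlinarith
    have h4 := mul_le_mul_of_nonneg_left h3 (mul_nonneg hΛ hi0)
    linarith
  have h3 : mnorm (T.Q n 0 (i + 1)) ^ s ≤
      C ^ s * Real.exp (Λ * (1 + s) * s) * Real.exp (Λ * (2 * s) * i) := by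
    refine (Real.rpow_le_rpow hM' (b.Q_le (i + 1)) hs0.le).trans ?_
    rw [Real.mul_rpow hC0 (Real.exp_pos _).le, ← Real.exp_mul, mul_assoc (C ^ s), ← Real.exp_add]
    refine mul_le_mul_of_nonneg_left (Real.exp_le_exp.2 ?_) (by positivity)
    have h5 := mul_le_mul_of_nonneg_left (by nlinarith : (1 + s) * s ≤ 2 * s) (mul_nonneg hΛ hi0)
    push_cast
    linarith
  calc _ ≤ (C ^ 2 * Real.exp (2 * s * i)) *
        ((1 + s⁻¹) * C ^ (a + s) * Real.exp (Λ * (a + 3 * s) * i)) *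
          (C ^ s * Real.exp (Λ * (1 + s) * s) * Real.exp (Λ * (2 * s) * i)) := by
        have := bracketPow_nonneg (a := a) (T.one_le_mnorm_Q n 0 i)
        gcongr
    _ = C ^ 2 * ((1 + s⁻¹) * C ^ (a + s)) * (C ^ s * Real.exp (Λ * (1 + s) * s)) *
        (Real.exp (2 * s * i) * Real.exp (Λ * (a + 3 * s) * i) *
          Real.exp (Λ * (2 * s) * i)) := by ring
    _ = _ := by
        rw [← Real.exp_add, ← Real.exp_add]
        congr 2
        ring

theorem weight_le (T : IET 𝒜 m) (n : ℕ → ℕ) (a s : ℝ) (i : ℕ) :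
    mnorm (T.Q n i (i + 1)) * bracketPow (mnorm (T.Q n 0 i)) a * mnorm (T.Q n 0 (i + 1)) ^ s ≤
      mnorm (T.Q n i (i + 1)) ^ 2 * bracketPow (mnorm (T.Q n 0 i)) a *
        mnorm (T.Q n 0 (i + 1)) ^ s := by
  have h1 := T.one_le_mnorm_Q n i (i + 1)
  have h2 := bracketPow_nonneg (a := a) (T.one_le_mnorm_Q n 0 i)
  have h3 := Real.rpow_nonneg (mnorm_nonneg (T.Q n 0 (i + 1))) s
  gcongr
  exact le_self_pow₀ h1 two_ne_zero

theorem summable_exp_neg {δ : ℝ} (hδ : 0 < δ) : Summable fun i : ℕ => Real.exp (-δ * i) := by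
  have := summable_geometric_of_lt_one (Real.exp_pos (-δ)).le (Real.exp_lt_one_iff.2 (by linarith))
  refine this.congr fun i => ?_
  rw [← Real.exp_nat_mul, mul_comm]

theorem summable_gapTerm (b : T.ExpBounds n F W Λ μ ν s C) (hΛ : 0 ≤ Λ) (hs0 : 0 < s)
    (hs1 : s ≤ 1) (ha0 : 0 ≤ a) (ha1 : a ≤ 1) (hμ : Λ * a + (5 * Λ + 3) * s < μ) :
    Summable (T.gapTerm n W a s) := by
  obtain ⟨D, hD, hw⟩ := b.exists_weight_le hΛ hs0 hs1 ha0 ha1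
  have hC0 : 0 ≤ C := zero_le_one.trans b.one_le
  set δ := μ - (Λ * a + (5 * Λ + 3) * s) with hδ
  refine Summable.of_nonneg_of_le (fun k => ?_) (fun k => ?_)
    ((summable_exp_neg (δ := δ) (by linarith)).mul_left (C * D))
  · have h1 : 0 ≤ T.normQInv n W 0 (k + 1) := opNormOn_nonneg _ _
    have h2 := bracketPow_nonneg (a := a) (T.one_le_mnorm_Q n 0 k)
    have h3 := Real.rpow_nonneg (mnorm_nonneg (T.Q n 0 (k + 1))) s
    rw [gapTerm]
    positivity
  · have hk0 : (0 : ℝ) ≤ k := Nat.cast_nonneg k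
    rw [gapTerm, mul_assoc, mul_assoc, ← mul_assoc (mnorm _ ^ 2)]
    have hI : 0 ≤ T.normQInv n W 0 (k + 1) := opNormOn_nonneg _ _
    calc _ ≤ (C * Real.exp (-(μ - s) * ((k + 1 : ℕ) - (0 : ℕ)) + Λ * s * (0 : ℕ))) *
          (D * Real.exp ((Λ * a + (5 * Λ + 2) * s) * k)) :=
          mul_le_mul (b.inv_le 0 (k + 1) (by omega)) (hw k)
            (by
              have h2 := bracketPow_nonneg (a := a) (T.one_le_mnorm_Q n 0 k)
              have h3 := Real.rpow_nonneg (mnorm_nonneg (T.Q n 0 (k + 1))) s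
              positivity) (by positivity)
      _ = C * D * Real.exp (-(μ - s) * ((k + 1 : ℕ) - (0 : ℕ)) + Λ * s * (0 : ℕ) +
            (Λ * a + (5 * Λ + 2) * s) * k) := by rw [Real.exp_add _ ((Λ * a + _) * k)]; ring
      _ ≤ _ := by
          refine mul_le_mul_of_nonneg_left (Real.exp_le_exp.2 ?_) (by positivity)
          push_cast
          rw [hδ]
          have : 0 ≤ μ - s := by
            have h1 : 0 ≤ Λ * a := by positivity
            have h2 : 0 ≤ (5 * Λ + 2) * s := by positivity
            linarith
          linarith

theorem exists_seriesK_le (b : T.ExpBounds n F W Λ μ ν s C) (hΛ : 0 ≤ Λ) (hs0 : 0 < s)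
    (hs1 : s ≤ 1) (ha0 : 0 ≤ a) (ha1 : a ≤ 1) (hμ : Λ * a + (5 * Λ + 3) * s < μ) :
    ∃ D : ℝ, 0 ≤ D ∧ ∀ k : ℕ, T.seriesK n W a s k ≤
      ENNReal.ofReal (D * Real.exp ((Λ * a + (6 * Λ + 4) * s) * k)) := by
  obtain ⟨D, hD, hw⟩ := b.exists_weight_le hΛ hs0 hs1 ha0 ha1
  have hC0 : 0 ≤ C := zero_le_one.trans b.one_le
  set δ := μ - (Λ * a + (5 * Λ + 3) * s) with hδ
  have hsum := summable_exp_neg (δ := δ) (by linarith)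
  set S := ∑' i : ℕ, Real.exp (-δ * i) with hS
  have hS0 : 0 ≤ S := tsum_nonneg fun i => (Real.exp_pos _).le
  refine ⟨C * D * S, by positivity, fun k => ?_⟩
  have hk0 : (0 : ℝ) ≤ k := Nat.cast_nonneg k
  set X := Real.exp ((Λ * a + (6 * Λ + 4) * s) * k) with hX
  have hterm : ∀ i : ℕ, T.normQInv n W k (k + i + 1) * mnorm (T.Q n (k + i) (k + i + 1)) *
      bracketPow (mnorm (T.Q n 0 (k + i))) a * mnorm (T.Q n 0 (k + i + 1)) ^ s ≤
        C * D * X * Real.exp (-δ * i) := by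
    intro i
    have hi0 : (0 : ℝ) ≤ i := Nat.cast_nonneg i
    rw [mul_assoc, mul_assoc, ← mul_assoc (mnorm _)]
    calc _ ≤ (C * Real.exp (-(μ - s) * ((k + i + 1 : ℕ) - (k : ℕ)) + Λ * s * k)) *
          (D * Real.exp ((Λ * a + (5 * Λ + 2) * s) * (k + i : ℕ))) :=
          mul_le_mul (b.inv_le k (k + i + 1) (by omega)) ((weight_le T n a s _).trans (hw (k + i)))
            (by
              have h1 := mnorm_nonneg (T.Q n (k + i) (k + i + 1))
              have h2 := bracketPow_nonneg (a := a) (T.one_le_mnorm_Q n 0 (k + i))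
              have h3 := Real.rpow_nonneg (mnorm_nonneg (T.Q n 0 (k + i + 1))) s
              positivity) (by positivity)
      _ = C * D * Real.exp (-(μ - s) * ((k + i + 1 : ℕ) - (k : ℕ)) + Λ * s * k +
            (Λ * a + (5 * Λ + 2) * s) * (k + i : ℕ)) := by
          rw [Real.exp_add _ ((Λ * a + _) * _)]; ring
      _ ≤ C * D * Real.exp ((Λ * a + (6 * Λ + 4) * s) * k + -δ * i) := by
          refine mul_le_mul_of_nonneg_left (Real.exp_le_exp.2 ?_) (by positivity)
          push_cast
          rw [hδ]
          have h1 : 0 ≤ μ - s := by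
            have h1 : 0 ≤ Λ * a := by positivity
            have h2 : 0 ≤ (5 * Λ + 2) * s := by positivity
            linarith
          have h2 : 0 ≤ s * k := by positivity
          linarith
      _ = _ := by rw [Real.exp_add, ← mul_assoc]
  have hsum' : Summable fun i : ℕ => C * D * X * Real.exp (-δ * i) := hsum.mul_left _
  calc T.seriesK n W a s k ≤ ∑' i : ℕ, ENNReal.ofReal (C * D * X * Real.exp (-δ * i)) :=
        ENNReal.tsum_le_tsum fun i => ENNReal.ofReal_le_ofReal (hterm i)
    _ = ENNReal.ofReal (∑' i : ℕ, C * D * X * Real.exp (-δ * i)) :=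
        (ENNReal.ofReal_tsum_of_nonneg (fun i => by positivity) hsum').symm
    _ = _ := by
        rw [tsum_mul_left, ← hS]
        congr 1
        ring

theorem normQ_le (b : T.ExpBounds n F W Λ μ ν s C) (hΛ : 0 ≤ Λ) (hs0 : 0 < s)
    (hν : ν ≤ Λ * a) (k : ℕ) :
    T.normQ n F 0 k ≤ C * Real.exp ((Λ * a + (6 * Λ + 4) * s) * k) := by
  have hk0 : (0 : ℝ) ≤ k := Nat.cast_nonneg k
  have hC0 : 0 ≤ C := zero_le_one.trans b.one_le
  refine (b.norm_le 0 k (Nat.zero_le k)).trans ?_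
  gcongr
  have h1 : 0 ≤ (Λ * a - ν) * k := mul_nonneg (by linarith) hk0
  have h2 : 0 ≤ (5 * Λ + 2) * (s * k) := by positivity
  push_cast
  linarith

theorem exists_seriesC_le (b : T.ExpBounds n F W Λ μ ν s C) (hΛ : 0 ≤ Λ) (hs0 : 0 < s)
    (hs1 : s ≤ 1) (ha0 : 0 ≤ a) (ha1 : a ≤ 1) (hν : ν ≤ Λ * a) :
    ∃ D : ℝ, 0 ≤ D ∧ ∀ k : ℕ, T.seriesC n F a s k ≤
      D * Real.exp ((Λ * a + (6 * Λ + 4) * s) * k) := by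
  obtain ⟨D, hD, hw⟩ := b.exists_weight_le hΛ hs0 hs1 ha0 ha1
  have hC0 : 0 ≤ C := zero_le_one.trans b.one_le
  refine ⟨C * D / s, by positivity, fun k => ?_⟩
  have hk0 : (0 : ℝ) ≤ k := Nat.cast_nonneg k
  have hterm : ∀ l ∈ Finset.Icc 1 k, T.normQ n F l k * mnorm (T.Q n (l - 1) l) *
      bracketPow (mnorm (T.Q n 0 (l - 1))) a * mnorm (T.Q n 0 l) ^ s ≤
        C * D * Real.exp ((Λ * a + (6 * Λ + 3) * s) * k) := by
    intro l hl
    obtain ⟨hl1, hlk⟩ := Finset.mem_Icc.1 hl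
    obtain ⟨i, rfl⟩ : ∃ i, l = i + 1 := ⟨l - 1, by omega⟩
    simp only [Nat.add_sub_cancel]
    have hi0 : (0 : ℝ) ≤ i := Nat.cast_nonneg i
    have hik : (i : ℝ) + 1 ≤ k := by exact_mod_cast hlk
    rw [mul_assoc, mul_assoc, ← mul_assoc (mnorm _)]
    calc _ ≤ (C * Real.exp ((ν + s) * (k - (i + 1 : ℕ)) + (Λ + 1) * s * k)) *
          (D * Real.exp ((Λ * a + (5 * Λ + 2) * s) * i)) :=
          mul_le_mul (b.norm_le (i + 1) k hlk) ((weight_le T n a s _).trans (hw i))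
            (by
              have h1 := mnorm_nonneg (T.Q n i (i + 1))
              have h2 := bracketPow_nonneg (a := a) (T.one_le_mnorm_Q n 0 i)
              have h3 := Real.rpow_nonneg (mnorm_nonneg (T.Q n 0 (i + 1))) s
              positivity) (by positivity)
      _ = C * D * Real.exp ((ν + s) * (k - (i + 1 : ℕ)) + (Λ + 1) * s * k +
            (Λ * a + (5 * Λ + 2) * s) * i) := by
          rw [Real.exp_add _ ((Λ * a + _) * _)]; ring
      _ ≤ _ := by
          refine mul_le_mul_of_nonneg_left (Real.exp_le_exp.2 ?_) (by positivity)
          push_cast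
          -- both exponents per step are at most `Λ a + (5 Λ + 2) s`
          have h1 : ν + s ≤ Λ * a + (5 * Λ + 2) * s := by nlinarith [mul_nonneg hΛ hs0.le]
          have h2 : (ν + s) * (k - (i + 1)) ≤ (Λ * a + (5 * Λ + 2) * s) * (k - (i + 1)) :=
            mul_le_mul_of_nonneg_right h1 (by linarith)
          have h3 : 0 ≤ Λ * a + (5 * Λ + 2) * s := by positivity
          linarith
  -- the number of terms is absorbed by an exponential of small exponent
  have hksum : (k : ℝ) ≤ Real.exp (s * k) / s := by
    rw [le_div_iff₀ hs0]
    have := Real.add_one_le_exp (s * k)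
    linarith
  calc T.seriesC n F a s k
      ≤ ∑ _l ∈ Finset.Icc 1 k, C * D * Real.exp ((Λ * a + (6 * Λ + 3) * s) * k) :=
        Finset.sum_le_sum hterm
    _ = k * (C * D * Real.exp ((Λ * a + (6 * Λ + 3) * s) * k)) := by
        rw [Finset.sum_const, Nat.card_Icc, Nat.add_sub_cancel, nsmul_eq_mul]
    _ ≤ Real.exp (s * k) / s * (C * D * Real.exp ((Λ * a + (6 * Λ + 3) * s) * k)) := by gcongr
    _ = C * D / s * (Real.exp ((Λ * a + (6 * Λ + 3) * s) * k) * Real.exp (s * k)) := by ring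
    _ = _ := by
        rw [← Real.exp_add]
        congr 2
        ring

end ExpBounds

end Exponents

theorem FDC.isKeane {T : IET 𝒜 m} {g : ℕ} {lam : ℕ → ℝ} {E : ℤ → Submodule ℝ (𝒜 → ℝ)}
    (h : T.FDC g lam E) (hg : 1 ≤ g) : T.IsKeane := by
  refine ⟨h.isIET.1, h.keane, ?_⟩
  rintro rfl
  -- with a single interval there are no translations, and the genus is `0`
  have hO : T.Omega = 0 := by
    ext α β
    have hb : T.bot β = T.bot α := by
      apply Fin.ext
      have := (T.bot β).2
      have := (T.bot α).2
      omega
    simp [Omega, hb]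
  have hgen := h.generic.genus
  rw [H, hO, Matrix.mulVecLin_zero, LinearMap.range_zero, finrank_bot] at hgen
  omega

end IET

end

/-! ### Exponents and the growth of special Birkhoff sums -/

/-- A parameter small enough for all exponents to stay below their limits. -/
theorem exists_small_parameter {Λ d τ : ℝ} (hΛ : 0 ≤ Λ) (hd : 0 < d) (hτ : 0 < τ) :
    ∃ s : ℝ, 0 < s ∧ s ≤ 1 ∧ s ≤ τ ∧ (6 * Λ + 4) * s ≤ τ ∧ (5 * Λ + 3) * s < d := by
  refine ⟨min 1 (min (τ / (6 * Λ + 4)) (d / (2 * (5 * Λ + 3)))),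
    by positivity, min_le_left _ _, ?_, ?_, ?_⟩
  · refine (min_le_right _ _).trans ((min_le_left _ _).trans (div_le_self hτ.le (by linarith)))
  · have h : min 1 (min (τ / (6 * Λ + 4)) (d / (2 * (5 * Λ + 3)))) ≤ τ / (6 * Λ + 4) :=
      (min_le_right _ _).trans (min_le_left _ _)
    rwa [le_div_iff₀' (by linarith)] at h
  · have h : min 1 (min (τ / (6 * Λ + 4)) (d / (2 * (5 * Λ + 3)))) ≤ d / (2 * (5 * Λ + 3)) :=
      (min_le_right _ _).trans (min_le_right _ _)
    rw [le_div_iff₀' (by linarith)] at h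
    linarith

theorem theorem6p1 {𝒜 : Type*} [Fintype 𝒜] [DecidableEq 𝒜] {m : ℕ} (T : IET 𝒜 m)
    (g : ℕ) (lam : ℕ → ℝ) (E : ℤ → Submodule ℝ (𝒜 → ℝ)) (hT : T.FDC g lam E)
    (U : ℕ → Submodule ℝ (𝒜 → ℝ)) (hU : T.IsComplementary g E U)
    (a : ℝ) (ha0 : 0 ≤ a) (ha1 : a < 1)
    (j : ℕ) (hj2 : 2 ≤ j) (hjg : j ≤ g + 1)
    (hlow : lam j ≤ lam 1 * a) (hhigh : lam 1 * a < lam (j - 1)) :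
    ∃ h : T.Pa a →ₗ[ℝ] U j,
      -- the operator is bounded
      (∃ B : ℝ, ∀ φ : T.Pa a, KZ.vnorm (h φ : 𝒜 → ℝ) ≤ B * T.normPa a φ) ∧
      -- the bound along every FDC-acceleration
      (∀ τ : ℝ, 0 < τ → ∀ (n : ℕ → ℕ) (V : ℕ → Submodule ℝ (𝒜 → ℝ)),
        T.IsFDCAcceleration g lam E τ n V →
        ∃ C : ℝ, 1 ≤ C ∧ ∀ φ ∈ T.PaG a, h φ = 0 → ∀ k : ℕ,
          ENNReal.ofReal (T.specialMeanNorm n k φ) ≤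
            ENNReal.ofReal C *
              ((T.seriesK n (V j) a τ k + ENNReal.ofReal (T.seriesC n (E (j : ℤ)) a τ k)) *
                  T.pa a φ +
                ENNReal.ofReal (T.normQ n (E (j : ℤ)) 0 k * (T.normL1 φ / T.total)))) ∧
      -- the resulting exponential growth
      (∀ τ : ℝ, 0 < τ → ∃ (n : ℕ → ℕ) (V : ℕ → Submodule ℝ (𝒜 → ℝ)),
        T.IsFDCAcceleration g lam E τ n V ∧
        ∀ φ ∈ T.PaG a, h φ = 0 →
          (fun k : ℕ => T.specialMeanNorm n k φ) =O[atTop]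
            (fun k : ℕ => Real.exp ((lam 1 * a + τ) * k))) := by
  have hK : T.IsKeane := hT.isKeane (by omega)
  have hΛ : 0 ≤ lam 1 := hT.generic.lam_nonneg le_rfl (by omega)
  have hΛa : 0 ≤ lam 1 * a := mul_nonneg hΛ ha0
  have hd : 0 < lam (j - 1) - lam 1 * a := by linarith
  -- The operator is the limit along one acceleration with a small parameter.
  obtain ⟨s₀, hs0, hs1, -, -, hs2⟩ := exists_small_parameter hΛ hd one_pos
  have hs3 : s₀ ≤ lam (j - 1) := by nlinarith [mul_nonneg hΛ hs0.le]
  obtain ⟨n₀, V₀, hFDC₀⟩ := hT.acceleration s₀ hs0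
  obtain ⟨c₀, κ₀, hsplit₀⟩ := hFDC₀.splitsAlong hj2 hjg
  obtain ⟨C₀, b₀⟩ := hFDC₀.exists_expBounds hT.generic hs0 hs1 hj2 hjg hs3
  obtain ⟨ℓ, hB, hℓ⟩ := hsplit₀.exists_correction hK ha0 ha1
    (b₀.summable_gapTerm hΛ hs0 hs1 ha0 ha1.le (by linarith)) (hU.compl j (by omega) hjg)
  -- Its kernel is described by every acceleration, whatever the parameter and the subspaces.
  have hmain : ∀ τ : ℝ, ∀ (n : ℕ → ℕ) (V : ℕ → Submodule ℝ (𝒜 → ℝ)),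
      T.IsFDCAcceleration g lam E τ n V →
      ∃ C : ℝ, 1 ≤ C ∧ ∀ φ : T.Pa a, ℓ φ = 0 → ∀ k : ℕ,
        ENNReal.ofReal (T.specialMeanNorm n k φ) ≤ ENNReal.ofReal C *
          ((T.seriesK n (V j) a τ k + ENNReal.ofReal (T.seriesC n (E (j : ℤ)) a τ k)) *
              T.pa a φ +
            ENNReal.ofReal (T.normQ n (E (j : ℤ)) 0 k * (T.normL1 φ / T.total))) := by
    intro τ n V hFDC
    obtain ⟨c, κ, hsplit⟩ := hFDC.splitsAlong hj2 hjg
    obtain ⟨C, hC1, hC⟩ := hsplit.exists_bound hK ha0 ha1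
    exact ⟨C, hC1, fun φ hφ => hC φ (hℓ φ hφ n (V j) τ c κ hsplit)⟩
  refine ⟨ℓ, hB, ?_, ?_⟩
  · intro τ _ n V hFDC
    obtain ⟨C, hC1, hC⟩ := hmain τ n V hFDC
    exact ⟨C, hC1, fun φ _ => hC φ⟩
  · intro τ hτ
    -- An acceleration for a small `s ≤ τ` is one for `τ`, but its exponents are those of `s`.
    obtain ⟨s, hs0, hs1, hsτ, hs6, hs2⟩ := exists_small_parameter hΛ hd hτ
    have hs3 : s ≤ lam (j - 1) := by nlinarith [mul_nonneg hΛ hs0.le]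
    obtain ⟨n, V, hFDC⟩ := hT.acceleration s hs0
    refine ⟨n, V, hFDC.mono hT.generic hsτ, fun φ _ hφ => ?_⟩
    obtain ⟨C₁, b⟩ := hFDC.exists_expBounds hT.generic hs0 hs1 hj2 hjg hs3
    obtain ⟨C, hC1, hC⟩ := hmain s n V hFDC
    obtain ⟨D, hD, hKs⟩ := b.exists_seriesK_le hΛ hs0 hs1 ha0 ha1.le (by linarith)
    obtain ⟨D', hD', hCs⟩ := b.exists_seriesC_le hΛ hs0 hs1 ha0 ha1.le hlow
    have hC0 : 0 ≤ C := zero_le_one.trans hC1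
    have hC₁0 : 0 ≤ C₁ := zero_le_one.trans b.one_le
    have hq : 0 ≤ T.normL1 φ / T.total :=
      div_nonneg (integral_nonneg fun x => abs_nonneg _) (IET.total_pos hK.pos).le
    have hp : 0 ≤ (T.pa a φ).toReal := ENNReal.toReal_nonneg
    have hpE : ENNReal.ofReal (T.pa a φ).toReal = T.pa a φ := ENNReal.ofReal_toReal φ.2.2.2.1
    refine Asymptotics.IsBigO.of_bound
      (C * ((D + D') * (T.pa a φ).toReal + C₁ * (T.normL1 φ / T.total)))
      (Eventually.of_forall fun k => ?_)
    have hk0 : (0 : ℝ) ≤ k := Nat.cast_nonneg k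
    set X := Real.exp ((lam 1 * a + (6 * lam 1 + 4) * s) * k) with hX
    have hX0 : 0 ≤ X := (Real.exp_pos _).le
    have hXle : X ≤ Real.exp ((lam 1 * a + τ) * k) := by
      rw [hX]; gcongr
    have h1 : ENNReal.ofReal (T.specialMeanNorm n k φ) ≤ ENNReal.ofReal
        (C * ((D * X + D' * X) * (T.pa a φ).toReal + C₁ * X * (T.normL1 φ / T.total))) := by
      refine (hC φ hφ k).trans ?_
      rw [ENNReal.ofReal_mul hC0, ENNReal.ofReal_add (by positivity) (by positivity),
        ENNReal.ofReal_mul (p := D * X + D' * X) (by positivity),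
        ENNReal.ofReal_add (p := D * X) (by positivity) (by positivity), hpE]
      gcongr
      · exact hKs k
      · exact hCs k
      · exact b.normQ_le hΛ hs0 hlow k
    rw [ENNReal.ofReal_le_ofReal_iff (by positivity)] at h1
    have hS : 0 ≤ T.specialMeanNorm n k φ := KZ.vnorm_nonneg _
    rw [Real.norm_of_nonneg hS, Real.norm_of_nonneg (Real.exp_pos _).le]
    calc T.specialMeanNorm n k φ ≤ _ := h1
      _ = C * ((D + D') * (T.pa a φ).toReal + C₁ * (T.normL1 φ / T.total)) * X := by ring
      _ ≤ _ := by gcongr
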